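/- Let $k$ be a field of characteristic $0$. For $n\ge 0$ let $B_n$ be the braid group on $n$ strands, with generators $\sigma_1,\dots,\sigma_{n-1}$ ($B_0,B_1$ trivial). The profinite braided associative operad $\widehat{\mathrm{BrAss}}$ is the braided operad in pro-vector spaces over $k$ whose $n$th term is the inverse system $\{k[B_n/N]\}_N$, where $N$ runs over the finite index normal subgroups of $B_n$; its right $B_n$-action is right multiplication, its compositions $\circ_i$ are induced by the cabling maps $\circ_i: B_m\times B_n\to B_{m+n-1}$, and its unit is $1\in k[B_1]$. An element $\alpha\in\widehat{\mathrm{BrAss}}(n)$ is an element of $\varprojlim_N k[B_n/N]$. For $p+q=n$ let $\mathfrak S_{p,q}=\sum_\tau\tilde\tau\in k[B_n]$, where $\tau\in S_n$ runs over the inverses of $(p,q)$-shuffles (permutations increasing on $\{1,\dots,p\}$ and on $\{p+1,\dots,n\}$) and $\tilde\tau\in B_n$ is the Matsumoto lift: write $\tau$ as a minimal length product of adjacent transpositions $(i,i+1)$ and replace each by $\sigma_i$. Let $\mathrm{BrPrim}_*\le\widehat{\mathrm{BrAss}}$ be the levelwise family of subspaces with $$\mathrm{BrPrim}_*(0)=0,\qquad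 \mathrm{BrPrim}_*(1)=k\cdot 1,\qquad \mathrm{BrPrim}_*(n)=\bigcap_{p+q=n,\ p,q>0}\ker\big(\mathfrak S_{p,q}\cdot:\widehat{\mathrm{BrAss}}(n)\to\widehat{\mathrm{BrAss}}(n)\big)\quad(n>1).$$ A braided Hopf algebra over $k$ (in the sense of Takeuchi) is a vector space $A$ with an automorphism $\sigma$ of $A\otimes A$ satisfying the braid equation, a unital associative algebra structure and a counital coassociative coalgebra structure which all commute with $\sigma$, such that $\Delta$ and $\epsilon$ are algebra maps (with $A\otimes A$ carrying the product $(\mu\otimes\mu)(\mathrm{id}\otimes\sigma\otimes\mathrm{id})$), and an antipode. It is finitely braided if, for every $n$, the action of $B_n$ on $A^{\otimes n}$, $\sigma_i\mapsto \mathrm{id}^{\otimes i-1}\otimes\sigma\otimes\mathrm{id}^{\otimes n-i-1}$, factors through a finite quotient of $B_n$. In this case, for $\alpha\in\widehat{\mathrm{BrAss}}(n)$ and $a_1,\dots,a_n\in A$, the element $\alpha(a_1,\dots,a_n)\in A$ is obtained by letting $\alpha$ act on $a_1\otimes\cdots\otimes a_n$ through such a quotient and applying the $n$-fold multiplication $A^{\otimes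 n}\to A$. Write $P(A)=\{x\in A:\Delta(x)=x\otimes1+1\otimes x\}$. **Theorem.** 1. For every $n\ge0$, an element $\alpha\in\widehat{\mathrm{BrAss}}(n)$ lies in $\mathrm{BrPrim}_*(n)$ if and only if for every finitely braided Hopf algebra $A$ over $k$ and all $a_1,\dots,a_n\in P(A)$ one has $\alpha(a_1,\dots,a_n)\in P(A)$. 2. $\mathrm{BrPrim}_*$ is a reduced, unital, strict suboperad of $\widehat{\mathrm{BrAss}}$. That is: it is compatible with the transition maps $k[B_n/N]\to k[B_n/N']$ and stable under the right actions of the groups $B_n$; each composition $\circ_i$, as a morphism of pro-vector spaces, restricts to it; $\mathrm{BrPrim}_*(0)=0$; it contains the unit $1\in k[B_1]$; and the transition maps $\mathrm{BrPrim}_*(n)_N\to\mathrm{BrPrim}_*(n)_{N'}$ ($N\subseteq N'$) are surjective. -/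

import Mathlib

open scoped TensorProduct

namespace BraidedPrimitive

/-! ## Braid groups -/

/-- The defining relations of the braid group on `n` strands, in the generators
`σ_0, …, σ_{n-2}`. -/
def braidRels (n : ℕ) : Set (FreeGroup (Fin (n - 1))) :=
  {r | (∃ i j : Fin (n - 1), (i : ℕ) + 1 = j ∧
        r = (.of i * .of j * .of i) * (.of j * .of i * .of j : FreeGroup (Fin (n - 1)))⁻¹) ∨
      (∃ i j : Fin (n - 1), (i : ℕ) + 1 < j ∧
        r = (.of i * .of j) * (.of j * .of i : FreeGroup (Fin (n - 1)))⁻¹)}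

/-- The braid group `B_n`. -/
abbrev BraidGroup (n : ℕ) : Type := PresentedGroup (braidRels n)

/-- The generator of `B_n` crossing the strands in positions `j` and `j + 1`, where positions are
numbered `0, …, n - 1` (and `1` if there are no such positions). -/
def gen (n j : ℕ) : BraidGroup n :=
  if h : j < n - 1 then PresentedGroup.of ⟨j, h⟩ else 1

theorem gen_of {n : ℕ} (j : Fin (n - 1)) : gen n j = PresentedGroup.of j := by
  simp [gen]

theorem gen_braid {n j : ℕ} (h : j + 2 < n) :
    gen n j * gen n (j + 1) * gen n j = gen n (j + 1) * gen n j * gen n (j + 1) := by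
  have h1 : j < n - 1 := by omega
  have h2 : j + 1 < n - 1 := by omega
  simp only [gen, h1, h2, dif_pos]
  exact PresentedGroup.mk_eq_mk_of_mul_inv_mem (Or.inl ⟨⟨j, h1⟩, ⟨j + 1, h2⟩, rfl, rfl⟩)

theorem gen_comm {n i j : ℕ} (h : i + 1 < j) : gen n i * gen n j = gen n j * gen n i := by
  by_cases h2 : j < n - 1
  · have h1 : i < n - 1 := by omega
    simp only [gen, h1, h2, dif_pos]
    exact PresentedGroup.mk_eq_mk_of_mul_inv_mem (Or.inr ⟨⟨i, h1⟩, ⟨j, h2⟩, h, rfl⟩)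
  · simp [gen, h2]

/-- A homomorphism out of the braid group is given by images of the generators satisfying the
braid relations. -/
def braidLift {G : Type*} [Group G] (n : ℕ) (f : ℕ → G)
    (hb : ∀ j, j + 2 < n → f j * f (j + 1) * f j = f (j + 1) * f j * f (j + 1))
    (hc : ∀ i j, i + 1 < j → j + 1 < n → f i * f j = f j * f i) : BraidGroup n →* G :=
  PresentedGroup.toGroup (f := fun j : Fin (n - 1) => f j) (by
    rintro r (⟨i, j, h, rfl⟩ | ⟨i, j, h, rfl⟩)
    · have := hb i (by have := j.2; omega)
      simp only [map_mul, map_inv, FreeGroup.lift_apply_of, mul_inv_eq_one, ← h]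
      exact this
    · have := hc i j h (by have := j.2; omega)
      simp only [map_mul, map_inv, FreeGroup.lift_apply_of, mul_inv_eq_one]
      exact this)

theorem braidLift_gen {G : Type*} [Group G] (n : ℕ) (f : ℕ → G)
    (hb : ∀ j, j + 2 < n → f j * f (j + 1) * f j = f (j + 1) * f j * f (j + 1))
    (hc : ∀ i j, i + 1 < j → j + 1 < n → f i * f j = f j * f i) {j : ℕ} (hj : j + 1 < n) :
    braidLift n f hb hc (gen n j) = f j := by
  have h1 : j < n - 1 := by omega
  simp only [gen, h1, dif_pos, braidLift]
  exact PresentedGroup.toGroup.of _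

/-- The adjacent transposition of the positions `j` and `j + 1`. -/
def adj (n j : ℕ) : Equiv.Perm (Fin n) :=
  if h : j + 1 < n then Equiv.swap ⟨j, by omega⟩ ⟨j + 1, h⟩ else 1

theorem adj_inv (m j : ℕ) : (adj m j)⁻¹ = adj m j := by
  unfold adj
  split_ifs <;> simp

theorem adj_val {n j : ℕ} (h : j + 1 < n) (x : Fin n) :
    ((adj n j x : Fin n) : ℕ) = if (x : ℕ) = j then j + 1 else if (x : ℕ) = j + 1 then j else x := by
  simp only [adj, h, dif_pos, Equiv.swap_apply_def, Fin.ext_iff]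
  split_ifs <;> rfl

theorem adj_braid {n j : ℕ} (h : j + 2 < n) :
    adj n j * adj n (j + 1) * adj n j = adj n (j + 1) * adj n j * adj n (j + 1) := by
  have h1 : j + 1 < n := by omega
  have h2 : j + 1 + 1 < n := by omega
  ext x
  simp only [Equiv.Perm.mul_apply, adj_val h1, adj_val h2]
  split_ifs <;> omega

theorem adj_comm {n i j : ℕ} (h : i + 1 < j) (hj : j + 1 < n) :
    adj n i * adj n j = adj n j * adj n i := by
  have h1 : i + 1 < n := by omega
  ext x
  simp only [Equiv.Perm.mul_apply, adj_val h1, adj_val hj]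
  split_ifs <;> omega

/-- The projection `B_n → S_n`. -/
def toPerm (n : ℕ) : BraidGroup n →* Equiv.Perm (Fin n) :=
  braidLift n (adj n) (fun _ h => adj_braid h) (fun _ _ h hj => adj_comm h hj)

theorem toPerm_gen {n j : ℕ} (h : j + 1 < n) : toPerm n (gen n j) = adj n j :=
  braidLift_gen _ _ _ _ h

/-! ## Matsumoto lifts and the elements `𝔖_{p,q}` -/

/-- The number of values `u < v` which form an inversion of `τ` with the value `v`. -/
def invCount {n : ℕ} (τ : Equiv.Perm (Fin n)) (v : Fin n) : ℕ :=
  (Finset.univ.filter fun u : Fin n => u < v ∧ τ.symm v < τ.symm u).card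

/-- A word of minimal length in the adjacent transpositions whose product is `τ` (see
`prod_reducedWord` and `length_reducedWord_le`). -/
def reducedWord {n : ℕ} (τ : Equiv.Perm (Fin n)) : List ℕ :=
  (List.finRange n).flatMap fun v =>
    (List.range (invCount τ v)).map fun t => (v : ℕ) - 1 - t

theorem card_val_lt {n v : ℕ} (hv : v ≤ n) :
    (Finset.univ.filter fun w : Fin n => (w : ℕ) < v).card = v := by
  have : (Finset.univ.filter fun w : Fin n => (w : ℕ) < v).map Fin.valEmbedding =
      Finset.range v := by
    ext x
    simp only [Finset.mem_map, Finset.mem_filter, Finset.mem_univ, true_and, Finset.mem_range,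
      Fin.valEmbedding_apply]
    exact ⟨by rintro ⟨w, h, rfl⟩; exact h, fun h => ⟨⟨x, by omega⟩, h, rfl⟩⟩
  rw [← Finset.card_map, this, Finset.card_range]

theorem invCount_le {n : ℕ} (τ : Equiv.Perm (Fin n)) (v : Fin n) : invCount τ v ≤ v := by
  refine (Finset.card_le_card (t := Finset.univ.filter fun u : Fin n => u < v) ?_).trans ?_
  · intro u; simp +contextual
  · exact (card_val_lt v.2.le).le

theorem chain_val {n : ℕ} {v : ℕ} (hv : v < n) (c : ℕ) (hc : c ≤ v) (x : Fin n) :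
    (((((List.range c).map fun t => v - 1 - t).map (adj n)).prod x : Fin n) : ℕ) =
      if (x : ℕ) < v - c then (x : ℕ) else if (x : ℕ) = v - c then v
      else if (x : ℕ) ≤ v then (x : ℕ) - 1 else x := by
  induction c generalizing x with
  | zero => simp; split_ifs <;> omega
  | succ c ih =>
    rw [List.range_succ, List.map_append, List.map_append, List.prod_append,
      Equiv.Perm.mul_apply, ih (by omega)]
    simp only [List.map_cons, List.map_nil, List.prod_cons, List.prod_nil, mul_one]
    rw [adj_val (by omega)]
    split_ifs <;> omega

theorem prod_reducedWord {n : ℕ} (τ : Equiv.Perm (Fin n)) :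
    ((reducedWord τ).map (adj n)).prod = τ := by
  let g : ℕ → List ℕ := fun v =>
    if h : v < n then (List.range (invCount τ ⟨v, h⟩)).map fun t => v - 1 - t else []
  have hg : reducedWord τ = (List.range n).flatMap g := by
    rw [← List.map_coe_finRange_eq_range, List.flatMap_map]
    simp [reducedWord, g]
  let r : ℕ → Fin n → ℕ := fun v u =>
    (Finset.univ.filter fun w : Fin n => (w : ℕ) < v ∧ τ.symm w < τ.symm u).card
  have key : ∀ v ≤ n, (∀ x : Fin n, v ≤ x → (((List.range v).flatMap g).map (adj n)).prod x = x) ∧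
      ∀ u x : Fin n, (u : ℕ) < v → (x : ℕ) = r v u →
        (((List.range v).flatMap g).map (adj n)).prod x = u := by
    intro v
    induction v with
    | zero => simp
    | succ v ih =>
      intro hv
      obtain ⟨ihA, ihB⟩ := ih (by omega)
      have hvn : v < n := hv
      set c := invCount τ ⟨v, hvn⟩ with hc
      have hcv : c ≤ v := invCount_le τ ⟨v, hvn⟩
      have hgv : g v = (List.range c).map fun t => v - 1 - t := by simp [g, hvn, hc]
      have hval := chain_val hvn c hcv
      have hP : (((List.range (v + 1)).flatMap g).map (adj n)).prod =
          (((List.range v).flatMap g).map (adj n)).prod *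
            (((List.range c).map fun t => v - 1 - t).map (adj n)).prod := by
        rw [List.range_succ, List.flatMap_append, List.map_append, List.prod_append]
        simp [hgv]
      rw [hP]
      simp only [Equiv.Perm.mul_apply]
      set C := (((List.range c).map fun t => v - 1 - t).map (adj n)).prod
      -- splitting the values below `v` according to their position relative to `u`
      have split : ∀ u : Fin n, r (v + 1) u = r v u +
          if τ.symm ⟨v, hvn⟩ < τ.symm u then 1 else 0 := by
        intro u
        simp only [r]
        rw [← Finset.card_filter_add_card_filter_not (s := Finset.univ.filter fun w : Fin n =>
          (w : ℕ) < v + 1 ∧ τ.symm w < τ.symm u) (fun w : Fin n => (w : ℕ) < v)]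
        congr 1
        · congr 1; ext w
          simp only [Finset.mem_filter, Finset.mem_univ, true_and]
          constructor
          · rintro ⟨⟨_, h2⟩, h3⟩; exact ⟨h3, h2⟩
          · rintro ⟨h1, h2⟩; exact ⟨⟨by omega, h2⟩, h1⟩
        · split_ifs with h
          · rw [Finset.card_eq_one]
            refine ⟨⟨v, hvn⟩, ?_⟩
            ext w
            simp only [Finset.mem_filter, Finset.mem_univ, true_and, Finset.mem_singleton]
            constructor
            · rintro ⟨⟨h1, _⟩, h3⟩; exact Fin.ext (by simp; omega)
            · rintro rfl; exact ⟨⟨by simp, h⟩, by simp⟩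
          · rw [Finset.card_eq_zero, Finset.filter_eq_empty_iff]
            intro w hw h3
            simp only [Finset.mem_filter, Finset.mem_univ, true_and] at hw
            have : w = ⟨v, hvn⟩ := Fin.ext (by simp; omega)
            subst this
            exact h hw.2
      have total : r v ⟨v, hvn⟩ + c = v := by
        have h1 : (Finset.univ.filter fun w : Fin n => (w : ℕ) < v).card = v := by
          exact card_val_lt hvn.le
        rw [hc, invCount]
        simp only [r]
        rw [← Finset.card_union_of_disjoint]
        · conv_rhs => rw [← h1]
          congr 1; ext w
          simp only [Finset.mem_union, Finset.mem_filter, Finset.mem_univ, true_and, Fin.lt_def]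
          constructor
          · rintro (h | h) <;> exact h.1
          · intro h
            have hne : τ.symm w ≠ τ.symm ⟨v, hvn⟩ := by
              intro e; have := τ.symm.injective e; subst this; simp at h
            have hne' : ((τ.symm w : Fin n) : ℕ) ≠ (τ.symm ⟨v, hvn⟩ : Fin n) :=
              fun e => hne (Fin.ext e)
            rcases lt_or_gt_of_ne hne' with h' | h'
            · exact Or.inl ⟨h, h'⟩
            · exact Or.inr ⟨h, h'⟩
        · rw [Finset.disjoint_left]
          intro w h1 h2
          simp only [Finset.mem_filter, Finset.mem_univ, true_and] at h1 h2
          exact absurd h1.2 (lt_asymm h2.2)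
      refine ⟨fun x hx => ?_, fun u x hu hx => ?_⟩
      · have : C x = x := Fin.ext (by rw [hval]; split_ifs <;> omega)
        rw [this]; exact ihA x (by omega)
      · rw [split] at hx
        rcases Nat.lt_or_ge u v with huv | huv
        · by_cases h : τ.symm ⟨v, hvn⟩ < τ.symm u
          · have hle : r v ⟨v, hvn⟩ ≤ r v u := by
              apply Finset.card_le_card
              intro w hw
              simp only [Finset.mem_filter, Finset.mem_univ, true_and] at hw ⊢
              exact ⟨hw.1, hw.2.trans h⟩
            have hlt : r v u < v := by
              have h1 : (Finset.univ.filter fun w : Fin n => (w : ℕ) < v).card = v := by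
                exact card_val_lt hvn.le
              conv_rhs => rw [← h1]
              apply Finset.card_lt_card
              rw [Finset.ssubset_iff_of_subset]
              · exact ⟨u, by simpa using huv, by simp⟩
              · intro w; simp +contextual
            rw [if_pos h] at hx
            refine ihB u (C x) huv ?_
            rw [hval]
            split_ifs <;> omega
          · have hne : τ.symm u ≠ τ.symm ⟨v, hvn⟩ := by
              intro e; have := τ.symm.injective e; subst this; simp at huv
            have h' : τ.symm u < τ.symm ⟨v, hvn⟩ := lt_of_le_of_ne (not_lt.1 h) hne
            have hlt : r v u < r v ⟨v, hvn⟩ := by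
              apply Finset.card_lt_card
              rw [Finset.ssubset_iff_of_subset]
              · exact ⟨u, by simpa using ⟨huv, h'⟩, by simp⟩
              · intro w hw
                simp only [Finset.mem_filter, Finset.mem_univ, true_and] at hw ⊢
                exact ⟨hw.1, hw.2.trans h'⟩
            rw [if_neg h] at hx
            refine ihB u (C x) huv ?_
            rw [hval]
            split_ifs <;> omega
        · have hu' : u = ⟨v, hvn⟩ := Fin.ext (by simp; omega)
          subst hu'
          simp only [lt_irrefl, if_false] at hx
          have : C x = ⟨v, hvn⟩ := Fin.ext (by rw [hval]; simp only; split_ifs <;> omega)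
          rw [this]; exact ihA _ (by simp)
  rw [hg]
  ext1 y
  refine (key n le_rfl).2 (τ y) y (τ y).2 ?_
  have : (Finset.univ.filter fun w : Fin n => (w : ℕ) < n ∧ τ.symm w < τ.symm (τ y)).card =
      (Finset.univ.filter fun z : Fin n => z < y).card := by
    apply Finset.card_equiv τ.symm
    intro w; simp
  exact (this.trans (card_val_lt y.2.le)).symm

theorem length_reducedWord {n : ℕ} (τ : Equiv.Perm (Fin n)) :
    (reducedWord τ).length =
      (Finset.univ.filter fun x : Fin n × Fin n => x.1 < x.2 ∧ τ.symm x.2 < τ.symm x.1).card := by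
  rw [Finset.card_filter, Fintype.sum_prod_type_right]
  simp only [reducedWord, List.length_flatMap, List.length_map, List.length_range, invCount,
    Finset.card_filter, ← Fin.sum_univ_def]

theorem length_reducedWord_le {n : ℕ} (τ : Equiv.Perm (Fin n)) (w : List ℕ)
    (hw : (w.map (adj n)).prod = τ) : (reducedWord τ).length ≤ w.length := by
  induction w generalizing τ with
  | nil =>
    subst hw
    rw [length_reducedWord, List.length_nil, Nat.le_zero, Finset.card_eq_zero,
      Finset.filter_eq_empty_iff]
    rintro ⟨u, v⟩ - ⟨h1, h2⟩
    exact lt_asymm h1 h2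
  | cons j w ih =>
    have h := ih _ rfl
    set τ' := (w.map (adj n)).prod
    have hτ : τ = adj n j * τ' := by rw [← hw]; simp [τ']
    rw [List.length_cons]
    refine le_trans ?_ (Nat.add_le_add_right h 1)
    by_cases hj : j + 1 < n
    · rw [length_reducedWord, length_reducedWord]
      have hs : ∀ x, τ.symm x = τ'.symm (adj n j x) := by
        intro x
        have : τ⁻¹ x = (τ'⁻¹ * (adj n j)⁻¹) x := by rw [hτ, mul_inv_rev]
        rw [adj_inv] at this
        exact this
      have hinv : ∀ x, adj n j (adj n j x) = x := by
        intro x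
        have : adj n j * adj n j = 1 := mul_eq_one_iff_eq_inv.2 (adj_inv n j).symm
        rw [← Equiv.Perm.mul_apply, this, Equiv.Perm.one_apply]
      refine le_trans (Finset.card_le_card (t := insert
        ((⟨j, by omega⟩ : Fin n), (⟨j + 1, hj⟩ : Fin n)) ((Finset.univ.filter fun x : Fin n × Fin n =>
          x.1 < x.2 ∧ τ'.symm x.2 < τ'.symm x.1).map
            ((adj n j).prodCongr (adj n j)).toEmbedding)) ?_) ?_
      · rintro ⟨u, v⟩ hx
        simp only [Finset.mem_filter, Finset.mem_univ, true_and, hs] at hx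
        rw [Finset.mem_insert, Finset.mem_map]
        by_cases hc : (u : ℕ) = j ∧ (v : ℕ) = j + 1
        · left; exact Prod.ext (Fin.ext hc.1) (Fin.ext hc.2)
        · right
          refine ⟨(adj n j u, adj n j v), ?_, by simp [hinv]⟩
          simp only [Finset.mem_filter, Finset.mem_univ, true_and]
          refine ⟨?_, hx.2⟩
          have h1 : (u : ℕ) < v := hx.1
          rw [Fin.lt_def, adj_val hj, adj_val hj]
          split_ifs <;> omega
      · refine (Finset.card_insert_le _ _).trans ?_
        rw [Finset.card_map]
    · have : adj n j = 1 := by simp [adj, hj]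
      rw [hτ, this, one_mul]
      omega

/-- The Matsumoto lift `τ ↦ τ̃` of a permutation to the braid group: replace every adjacent
transposition in a minimal length word for `τ` by the corresponding generator of `B_n`. -/
def matsumotoLift {n : ℕ} (τ : Equiv.Perm (Fin n)) : BraidGroup n :=
  ((reducedWord τ).map (gen n)).prod

/-- The inverses of `(p, n - p)`-shuffles, i.e. of permutations which are increasing on the first
`p` positions and on the last `n - p` positions. -/
def IsUnshuffle {n : ℕ} (p : ℕ) (τ : Equiv.Perm (Fin n)) : Prop :=
  ∀ i j : Fin n, i < j → ((j : ℕ) < p ∨ p ≤ (i : ℕ)) → τ.symm i < τ.symm j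

open Classical in
/-- The element `𝔖_{p,q} ∈ k[B_n]`, where `p + q = n`: the sum of the Matsumoto lifts of all
`(p,q)`-unshuffles. -/
noncomputable def shuffleSum (k : Type*) [Field k] (n p : ℕ) : MonoidAlgebra k (BraidGroup n) :=
  ∑ τ : Equiv.Perm (Fin n) with IsUnshuffle p τ, MonoidAlgebra.of k _ (matsumotoLift τ)

/-! ## Cabling -/

/-- The braid on `N` strands moving `n` parallel strands, which start in positions
`j, …, j + n - 1`, past the strand in position `j + n`. -/
def fatLeft (N n j : ℕ) : BraidGroup N := ((List.range n).map fun t => gen N (j + t)).prod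

/-- The braid on `N` strands moving the strand in position `j` past `n` parallel strands in
positions `j + 1, …, j + n`. -/
def fatRight (N n j : ℕ) : BraidGroup N :=
  ((List.range n).map fun t => gen N (j + (n - 1 - t))).prod

theorem fatLeft_zero (N j : ℕ) : fatLeft N 0 j = 1 := rfl
theorem fatRight_zero (N j : ℕ) : fatRight N 0 j = 1 := rfl

theorem fatLeft_succ (N n j : ℕ) : fatLeft N (n + 1) j = fatLeft N n j * gen N (j + n) := by
  simp [fatLeft, List.range_succ]

theorem fatRight_succ (N n j : ℕ) : fatRight N (n + 1) j = gen N (j + n) * fatRight N n j := by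
  simp only [fatRight, List.range_succ_eq_map, List.map_cons, List.prod_cons, List.map_map]
  congr 3
  funext t
  simp only [Function.comp]
  congr 1
  omega

theorem fatLeft_comm_of_lt (N n : ℕ) {i j : ℕ} (h : i + 1 < j) :
    gen N i * fatLeft N n j = fatLeft N n j * gen N i := by
  induction n with
  | zero => simp [fatLeft_zero]
  | succ n ih =>
    rw [fatLeft_succ, ← mul_assoc, ih, mul_assoc, mul_assoc, gen_comm (by omega)]

theorem fatLeft_comm_of_gt (N n : ℕ) {i j : ℕ} (h : j + n < i) :
    gen N i * fatLeft N n j = fatLeft N n j * gen N i := by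
  induction n with
  | zero => simp [fatLeft_zero]
  | succ n ih =>
    rw [fatLeft_succ, ← mul_assoc, ih (by omega), mul_assoc, mul_assoc,
      gen_comm (i := j + n) (by omega)]

theorem fatRight_comm_of_lt (N n : ℕ) {i j : ℕ} (h : i + 1 < j) :
    gen N i * fatRight N n j = fatRight N n j * gen N i := by
  induction n with
  | zero => simp [fatRight_zero]
  | succ n ih =>
    rw [fatRight_succ, mul_assoc, ← ih, ← mul_assoc, ← mul_assoc, gen_comm (by omega)]

theorem fatRight_comm_of_gt (N n : ℕ) {i j : ℕ} (h : j + n < i) :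
    gen N i * fatRight N n j = fatRight N n j * gen N i := by
  induction n with
  | zero => simp [fatRight_zero]
  | succ n ih =>
    rw [fatRight_succ, mul_assoc, ← ih (by omega), ← mul_assoc, ← mul_assoc,
      gen_comm (i := j + n) (by omega)]

theorem fatLeft_braid (N n j : ℕ) (h : j + n + 1 < N) :
    gen N j * (fatLeft N n (j + 1) * fatLeft N n j) =
      fatLeft N n (j + 1) * fatLeft N n j * gen N (j + n) := by
  induction n with
  | zero => simp [fatLeft_zero]
  | succ n ih =>
    have e : fatLeft N (n + 1) (j + 1) * fatLeft N (n + 1) j =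
        fatLeft N n (j + 1) * fatLeft N n j * (gen N (j + n + 1) * gen N (j + n)) := by
      rw [fatLeft_succ, fatLeft_succ, show j + 1 + n = j + n + 1 by omega]
      simp only [mul_assoc]
      rw [← mul_assoc (gen N (j + n + 1)), fatLeft_comm_of_gt N n (by omega)]
      simp only [mul_assoc]
    rw [e, ← mul_assoc, ih (by omega), mul_assoc, mul_assoc,
      ← mul_assoc (gen N (j + n)), gen_braid (by omega)]
    simp only [mul_assoc, Nat.add_assoc]

theorem fatRight_braid (N n j : ℕ) (h : j + n + 1 < N) :
    fatRight N n j * fatRight N n (j + 1) * gen N j =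
      gen N (j + n) * (fatRight N n j * fatRight N n (j + 1)) := by
  induction n with
  | zero => simp [fatRight_zero]
  | succ n ih =>
    have e : fatRight N (n + 1) j * fatRight N (n + 1) (j + 1) =
        gen N (j + n) * gen N (j + n + 1) * (fatRight N n j * fatRight N n (j + 1)) := by
      rw [fatRight_succ, fatRight_succ, show j + 1 + n = j + n + 1 by omega]
      simp only [mul_assoc]
      rw [← mul_assoc (fatRight N n j) (gen N (j + n + 1)),
        ← fatRight_comm_of_gt N n (i := j + n + 1) (by omega)]
      simp only [mul_assoc]
    rw [e, mul_assoc, ih (by omega), ← mul_assoc, ← mul_assoc, ← mul_assoc,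
      gen_braid (by omega)]
    simp only [mul_assoc, Nat.add_assoc]

theorem fat_braid (N n j : ℕ) (h : j + n + 1 < N) :
    fatLeft N n j * gen N (j + n) * fatRight N n j =
      fatRight N n (j + 1) * gen N j * fatLeft N n (j + 1) := by
  induction n with
  | zero => simp [fatLeft_zero, fatRight_zero]
  | succ n ih =>
    have c1 := fatLeft_comm_of_gt N n (j := j) (i := j + n + 1) (by omega)
    have c2 := fatRight_comm_of_gt N n (j := j) (i := j + n + 1) (by omega)
    calc fatLeft N (n + 1) j * gen N (j + (n + 1)) * fatRight N (n + 1) j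
        = fatLeft N n j * (gen N (j + n) * gen N (j + n + 1) * gen N (j + n)) *
            fatRight N n j := by
          rw [fatLeft_succ, fatRight_succ]; simp only [mul_assoc, Nat.add_assoc]
      _ = (fatLeft N n j * gen N (j + n + 1)) * gen N (j + n) *
            (gen N (j + n + 1) * fatRight N n j) := by
          rw [gen_braid (by omega)]; simp only [mul_assoc]
      _ = gen N (j + n + 1) * (fatLeft N n j * gen N (j + n) * fatRight N n j) *
            gen N (j + n + 1) := by
          rw [← c1, c2]; simp only [mul_assoc]
      _ = _ := by
          rw [ih (by omega), fatLeft_succ, fatRight_succ, show j + 1 + n = j + n + 1 by omega]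
          simp only [mul_assoc]

/-- The effect of the generator `σ_j` after the strand in position `i` has been replaced by `n`
parallel strands. -/
def block (N n j i : ℕ) : BraidGroup N :=
  if i = j then fatLeft N n j else if i = j + 1 then fatRight N n j
  else if i < j then gen N (j + n - 1) else gen N j

abbrev CableTarget (N m : ℕ) : Type :=
  (Fin m → BraidGroup N) ⋊[mulAutArrow] (Equiv.Perm (Fin m))

def cableGen (N m n j : ℕ) : CableTarget N m :=
  ⟨fun x => block N n j ((adj m j)⁻¹ x : Fin m), adj m j⟩

theorem mulAutArrow_app {N m : ℕ} (g : Equiv.Perm (Fin m)) (f : Fin m → BraidGroup N) (x : Fin m) :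
    (mulAutArrow g f : Fin m → BraidGroup N) x = f (g⁻¹ x) := rfl

theorem cableGen_braid {m n j : ℕ} (h : j + 2 < m) :
    cableGen (m + n - 1) m n j * cableGen (m + n - 1) m n (j + 1) * cableGen (m + n - 1) m n j =
      cableGen (m + n - 1) m n (j + 1) * cableGen (m + n - 1) m n j *
        cableGen (m + n - 1) m n (j + 1) := by
  have h1 : j + 1 < m := by omega
  have h2 : j + 1 + 1 < m := by omega
  have f1 : j + 1 + 1 ≠ j := by omega
  have f2 : j ≠ j + 1 + 1 := by omega
  have f3 : ¬ j + 1 + 1 < j := by omega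
  ext x
  · obtain ⟨x, hx⟩ := x
    simp only [cableGen, SemidirectProduct.mul_left, SemidirectProduct.mul_right, Pi.mul_apply,
      mulAutArrow_app, adj_inv, mul_inv_rev, Equiv.Perm.mul_apply, adj_val h1, adj_val h2, block]
    rcases lt_or_ge x j with hxj | hxj
    · have a1 : x ≠ j := by omega
      have a2 : x ≠ j + 1 := by omega
      have a3 : x ≠ j + 1 + 1 := by omega
      have a4 : x < j + 1 := by omega
      simp only [a1, a2, a3, a4, hxj, if_true, if_false]
      rw [show j + 1 + n - 1 = (j + n - 1) + 1 by omega]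
      exact gen_braid (by omega)
    rcases Nat.eq_or_lt_of_le hxj with rfl | hxj
    · have := fatRight_braid (m + n - 1) n j (by omega)
      simpa [mul_assoc, f1, f2, f3, show j + 1 + n - 1 = j + n by omega] using this
    rcases Nat.eq_or_lt_of_le hxj with rfl | hxj
    · have := fat_braid (m + n - 1) n j (by omega)
      simpa [mul_assoc, f1, f2, f3, show j + 1 + n - 1 = j + n by omega] using this
    rcases Nat.eq_or_lt_of_le hxj with rfl | hxj
    · have := fatLeft_braid (m + n - 1) n j (by omega)
      simpa [mul_assoc, f1, f2, f3, show j + 1 + n - 1 = j + n by omega] using this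
    · have a1 : x ≠ j := by omega
      have a2 : x ≠ j + 1 := by omega
      have a3 : x ≠ j + 1 + 1 := by omega
      have a4 : ¬ x < j + 1 := by omega
      have a5 : ¬ x < j := by omega
      simp only [a1, a2, a3, a4, a5, if_false]
      exact gen_braid (by omega)
  · simp only [cableGen, SemidirectProduct.mul_right, adj_braid h]

theorem cableGen_comm {m n i j : ℕ} (h : i + 1 < j) (hj : j + 1 < m) :
    cableGen (m + n - 1) m n i * cableGen (m + n - 1) m n j =
      cableGen (m + n - 1) m n j * cableGen (m + n - 1) m n i := by
  have h1 : i + 1 < m := by omega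
  ext x
  · obtain ⟨x, hx⟩ := x
    simp only [cableGen, SemidirectProduct.mul_left, Pi.mul_apply,
      mulAutArrow_app, adj_inv, adj_val h1, adj_val hj, block]
    rcases lt_or_ge x i with hx1 | hx1
    · have a1 : x ≠ i := by omega
      have a2 : x ≠ i + 1 := by omega
      have a3 : x ≠ j := by omega
      have a4 : x ≠ j + 1 := by omega
      have a5 : x < j := by omega
      simp only [a1, a2, a3, a4, a5, hx1, if_true, if_false]
      exact gen_comm (by omega)
    rcases Nat.eq_or_lt_of_le hx1 with rfl | hx2
    · have a1 : i ≠ j := by omega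
      have a2 : i ≠ j + 1 := by omega
      have a3 : i + 1 ≠ j := by omega
      have a4 : i < j := by omega
      simp [a1, a2, a3, a4, h, (fatRight_comm_of_gt (m + n - 1) n (j := i) (i := j + n - 1)
        (by omega)).symm]
    rcases Nat.eq_or_lt_of_le hx2 with rfl | hx3
    · have a1 : i ≠ j := by omega
      have a2 : i ≠ j + 1 := by omega
      have a3 : i + 1 ≠ j := by omega
      have a4 : i < j := by omega
      simp [a1, a2, a3, a4, h, (fatLeft_comm_of_gt (m + n - 1) n (j := i) (i := j + n - 1)
        (by omega)).symm]
    have a1 : x ≠ i := by omega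
    have a2 : x ≠ i + 1 := by omega
    have a6 : ¬ x < i := by omega
    rcases lt_or_ge x j with hx4 | hx4
    · have a3 : x ≠ j := by omega
      have a4 : x ≠ j + 1 := by omega
      simp only [a1, a2, a3, a4, a6, hx4, if_true, if_false]
      exact gen_comm (by omega)
    rcases Nat.eq_or_lt_of_le hx4 with rfl | hx5
    · have b1 : j ≠ i := by omega
      have b2 : j + 1 ≠ i := by omega
      have b3 : j ≠ i + 1 := by omega
      have b4 : ¬ j + 1 < i := by omega
      have b5 : j ≠ i := by omega
      have b6 : ¬ j < i := by omega
      simp [b1, b2, b3, b4, b6, (fatRight_comm_of_lt (m + n - 1) n h)]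
    rcases Nat.eq_or_lt_of_le hx5 with rfl | hx6
    · have b1 : j ≠ i := by omega
      have b2 : j + 1 ≠ i := by omega
      have b3 : j ≠ i + 1 := by omega
      have b4 : ¬ j + 1 < i := by omega
      have b6 : ¬ j < i := by omega
      simp [b1, b2, b3, b4, b6, (fatLeft_comm_of_lt (m + n - 1) n h)]
    · have a3 : x ≠ j := by omega
      have a4 : x ≠ j + 1 := by omega
      have a5 : ¬ x < j := by omega
      simp only [a1, a2, a3, a4, a5, a6, if_false]
      exact gen_comm h
  · simp only [cableGen, SemidirectProduct.mul_right, adj_comm h hj]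

/-- The homomorphism recording how the braids on `m` strands act on positions and how they look
after one strand has been replaced by `n` parallel strands. The first component is indexed by the
final position of that strand. -/
def cableHom (m n : ℕ) : BraidGroup m →* CableTarget (m + n - 1) m :=
  braidLift m (cableGen (m + n - 1) m n) (fun _ h => cableGen_braid h)
    (fun _ _ h hj => cableGen_comm h hj)

/-- The braid obtained from `γ ∈ B_m` by replacing the strand which starts in position `i` by `n`
parallel strands. -/
def fatten {m : ℕ} (n : ℕ) (i : Fin m) (γ : BraidGroup m) : BraidGroup (m + n - 1) :=
  (cableHom m n γ).left (toPerm m γ i)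

theorem cableHom_right {m : ℕ} (n : ℕ) (γ : BraidGroup m) :
    (cableHom m n γ).right = toPerm m γ := by
  have : SemidirectProduct.rightHom.comp (cableHom m n) = toPerm m := by
    apply PresentedGroup.ext
    intro j
    have hj : (j : ℕ) + 1 < m := by have := j.2; omega
    rw [← gen_of, MonoidHom.comp_apply, cableHom, braidLift_gen _ _ _ _ hj, toPerm_gen hj]
    rfl
  exact DFunLike.congr_fun this γ

theorem fatten_gen {m n j : ℕ} (hj : j + 1 < m) (i : Fin m) :
    fatten n i (gen m j) = block (m + n - 1) n j i := by
  simp only [fatten, cableHom, braidLift_gen _ _ _ _ hj, toPerm_gen hj, cableGen]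
  simp

theorem fatten_mul {m n : ℕ} (i : Fin m) (γ γ' : BraidGroup m) :
    fatten n i (γ * γ') = fatten n (toPerm m γ' i) γ * fatten n i γ' := by
  simp only [fatten, map_mul, SemidirectProduct.mul_left, Pi.mul_apply, mulAutArrow_app,
    cableHom_right, Equiv.Perm.mul_apply]
  simp

/-- The homomorphism `B_n → B_{m + n - 1}` placing a braid on the strands in positions
`i, …, i + n - 1`. -/
def insertAt {m : ℕ} (n : ℕ) (i : Fin m) : BraidGroup n →* BraidGroup (m + n - 1) :=
  braidLift n (fun t => gen (m + n - 1) (i + t))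
    (fun j h => by
      have := i.2
      exact gen_braid (j := (i : ℕ) + j) (by omega))
    (fun s t h _ => gen_comm (by omega))

/-- The cabling `γ ∘_i ρ`: replace the strand of `γ` starting in position `i` by a narrow tube, and
fill that tube with `ρ`. -/
def cabling {m n : ℕ} (i : Fin m) (γ : BraidGroup m) (ρ : BraidGroup n) :
    BraidGroup (m + n - 1) :=
  fatten n i γ * insertAt n i ρ

/-! ## Braided vector spaces and the action of the braid groups on tensor powers -/

section Tensor

variable {k : Type*} [Field k] {V : Type*} [AddCommGroup V] [Module k V]

/-- The endomorphism `id ⊗ f` of `V ⊗ V ⊗ V`, with `f` applied to the last two factors. -/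
noncomputable def applyRight (f : V ⊗[k] V →ₗ[k] V ⊗[k] V) :
    (V ⊗[k] V) ⊗[k] V →ₗ[k] (V ⊗[k] V) ⊗[k] V :=
  (TensorProduct.assoc k V V V).symm.toLinearMap ∘ₗ f.lTensor V ∘ₗ
    (TensorProduct.assoc k V V V).toLinearMap

variable (k V) in
/-- A braiding on a vector space: an automorphism of `V ⊗ V` satisfying the braid equation. -/
structure Braiding where
  /-- The automorphism of `V ⊗ V`. -/
  σ : V ⊗[k] V ≃ₗ[k] V ⊗[k] V
  braid_eq : σ.toLinearMap.rTensor V ∘ₗ applyRight σ.toLinearMap ∘ₗ σ.toLinearMap.rTensor V =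
    applyRight σ.toLinearMap ∘ₗ σ.toLinearMap.rTensor V ∘ₗ applyRight σ.toLinearMap

variable {n : ℕ}

/-- Insert a tensor into the factors `i` and `j` of the pure tensor `⨂ a`. -/
noncomputable def insertPair (a : Fin n → V) (i j : Fin n) (h : i ≠ j) :
    V ⊗[k] V →ₗ[k] ⨂[k] _ : Fin n, V :=
  TensorProduct.lift (LinearMap.mk₂ k
    (fun x y => PiTensorProduct.tprod k (Function.update (Function.update a i x) j y))
    (fun x x' y => by
      rw [Function.update_comm h, Function.update_comm h, Function.update_comm h,
        MultilinearMap.map_update_add])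
    (fun c x y => by
      rw [Function.update_comm h, Function.update_comm h, MultilinearMap.map_update_smul])
    (fun x y y' => by rw [MultilinearMap.map_update_add])
    (fun c x y => by rw [MultilinearMap.map_update_smul]))

theorem insertPair_tmul (a : Fin n → V) (i j : Fin n) (h : i ≠ j) (x y : V) :
    insertPair a i j h (x ⊗ₜ[k] y) =
      PiTensorProduct.tprod k (Function.update (Function.update a i x) j y) := by
  simp [insertPair]

theorem insertPair_update_left (a : Fin n → V) (i j : Fin n) (h : i ≠ j) (z : V) :
    insertPair (k := k) (Function.update a i z) i j h = insertPair a i j h := by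
  ext x y; simp [insertPair]

theorem insertPair_update_right (a : Fin n → V) (i j : Fin n) (h : i ≠ j) (z : V) :
    insertPair (k := k) (Function.update a j z) i j h = insertPair a i j h := by
  ext x y; simp [insertPair, Function.update_comm h]

theorem insertPair_update_add (a : Fin n → V) (i j : Fin n) (h : i ≠ j) (l : Fin n)
    (hi : l ≠ i) (hj : l ≠ j) (z z' : V) :
    insertPair (k := k) (Function.update a l (z + z')) i j h =
      insertPair (Function.update a l z) i j h + insertPair (Function.update a l z') i j h := by
  ext x y
  simp [insertPair, Function.update_comm hi, Function.update_comm hj]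

theorem insertPair_update_smul (a : Fin n → V) (i j : Fin n) (h : i ≠ j) (l : Fin n)
    (hi : l ≠ i) (hj : l ≠ j) (c : k) (z : V) :
    insertPair (k := k) (Function.update a l (c • z)) i j h =
      c • insertPair (Function.update a l z) i j h := by
  ext x y
  simp [insertPair, Function.update_comm hi, Function.update_comm hj]

/-- The endomorphism of `V^{⊗ n}` applying `f` to the tensor factors `i` and `j`. -/
noncomputable def applyAt (f : V ⊗[k] V →ₗ[k] V ⊗[k] V) (i j : Fin n) (h : i ≠ j) :
    (⨂[k] _ : Fin n, V) →ₗ[k] ⨂[k] _ : Fin n, V :=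
  PiTensorProduct.lift (MultilinearMap.mk'
    (fun a => insertPair a i j h (f (a i ⊗ₜ[k] a j)))
    (fun a l z z' => by
      by_cases hi : l = i
      · subst hi
        simp [insertPair_update_left, Function.update_of_ne h.symm, TensorProduct.add_tmul]
      by_cases hj : l = j
      · subst hj
        simp [insertPair_update_right, Function.update_of_ne h, TensorProduct.tmul_add]
      · simp [insertPair_update_add a i j h l hi hj, Function.update_of_ne (Ne.symm hi),
          Function.update_of_ne (Ne.symm hj)])
    (fun a l c z => by
      by_cases hi : l = i
      · subst hi
        simp [insertPair_update_left, Function.update_of_ne h.symm, ← TensorProduct.smul_tmul']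
      by_cases hj : l = j
      · subst hj
        simp [insertPair_update_right, Function.update_of_ne h]
      · simp [insertPair_update_smul a i j h l hi hj, Function.update_of_ne (Ne.symm hi),
          Function.update_of_ne (Ne.symm hj)]))

theorem applyAt_tprod (f : V ⊗[k] V →ₗ[k] V ⊗[k] V) (i j : Fin n) (h : i ≠ j) (a : Fin n → V) :
    applyAt f i j h (PiTensorProduct.tprod k a) = insertPair a i j h (f (a i ⊗ₜ[k] a j)) := by
  simp [applyAt]

/-- `applyAt f i j` intertwines with `f` on the factors `i`, `j`. -/
theorem applyAt_insertPair (f : V ⊗[k] V →ₗ[k] V ⊗[k] V) (i j : Fin n) (h : i ≠ j)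
    (a : Fin n → V) (t : V ⊗[k] V) :
    applyAt f i j h (insertPair a i j h t) = insertPair a i j h (f t) := by
  induction t with
  | zero => simp
  | add x y hx hy => simp [hx, hy]
  | tmul x y =>
    rw [insertPair_tmul, applyAt_tprod, insertPair_update_right, insertPair_update_left]
    simp [Function.update_of_ne h]

theorem applyAt_comp (f g : V ⊗[k] V →ₗ[k] V ⊗[k] V) (i j : Fin n) (h : i ≠ j) :
    applyAt f i j h ∘ₗ applyAt g i j h = applyAt (f ∘ₗ g) i j h := by
  apply PiTensorProduct.ext
  ext a
  simp [applyAt_tprod, applyAt_insertPair]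

theorem applyAt_id (i j : Fin n) (h : i ≠ j) :
    applyAt (LinearMap.id : V ⊗[k] V →ₗ[k] V ⊗[k] V) i j h = LinearMap.id := by
  apply PiTensorProduct.ext
  ext a
  simp [applyAt_tprod, insertPair_tmul]

/-- `applyAt` for an automorphism of `V ⊗ V`. -/
noncomputable def applyAtEquiv (f : V ⊗[k] V ≃ₗ[k] V ⊗[k] V) (i j : Fin n) (h : i ≠ j) :
    (⨂[k] _ : Fin n, V) ≃ₗ[k] ⨂[k] _ : Fin n, V :=
  LinearEquiv.ofLinearMap (applyAt f.toLinearMap i j h) (applyAt f.symm.toLinearMap i j h)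
    (by rw [applyAt_comp, LinearEquiv.comp_symm, applyAt_id])
    (by rw [applyAt_comp, LinearEquiv.symm_comp, applyAt_id])

/-- Insert a tensor into the factors `i`, `j`, `l` of a pure tensor. -/
noncomputable def insertTriple (a : Fin n → V) (i j l : Fin n) (hij : i ≠ j) (hjl : j ≠ l)
    (hil : i ≠ l) : (V ⊗[k] V) ⊗[k] V →ₗ[k] ⨂[k] _ : Fin n, V :=
  TensorProduct.lift (LinearMap.mk₂ k
    (fun t z => insertPair (Function.update a l z) i j hij t)
    (fun t t' z => map_add _ _ _) (fun c t z => map_smul _ _ _)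
    (fun t z z' => by rw [insertPair_update_add a i j hij l hil.symm hjl.symm]; rfl)
    (fun c t z => by rw [insertPair_update_smul a i j hij l hil.symm hjl.symm]; rfl))

theorem insertTriple_tmul (a : Fin n → V) (i j l : Fin n) (hij : i ≠ j) (hjl : j ≠ l)
    (hil : i ≠ l) (t : V ⊗[k] V) (z : V) :
    insertTriple a i j l hij hjl hil (t ⊗ₜ[k] z) =
      insertPair (Function.update a l z) i j hij t := by
  simp [insertTriple]

theorem insertTriple_tmul' (a : Fin n → V) (i j l : Fin n) (hij : i ≠ j) (hjl : j ≠ l)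
    (hil : i ≠ l) (x : V) (t : V ⊗[k] V) :
    insertTriple a i j l hij hjl hil ((TensorProduct.assoc k V V V).symm (x ⊗ₜ[k] t)) =
      insertPair (Function.update a i x) j l hjl t := by
  induction t with
  | zero => simp
  | add x y hx hy => simp [TensorProduct.tmul_add, hx, hy]
  | tmul y z =>
    rw [TensorProduct.assoc_symm_tmul, insertTriple_tmul, insertPair_tmul, insertPair_tmul,
      Function.update_comm hil.symm, Function.update_comm hjl.symm]

theorem applyAt_insertTriple_left (f : V ⊗[k] V →ₗ[k] V ⊗[k] V) (a : Fin n → V) (i j l : Fin n)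
    (hij : i ≠ j) (hjl : j ≠ l) (hil : i ≠ l) :
    applyAt f i j hij ∘ₗ insertTriple a i j l hij hjl hil =
      insertTriple a i j l hij hjl hil ∘ₗ f.rTensor V := by
  apply TensorProduct.ext'
  intro t z
  simp [insertTriple_tmul, applyAt_insertPair]

theorem applyAt_insertTriple_right (f : V ⊗[k] V →ₗ[k] V ⊗[k] V) (a : Fin n → V) (i j l : Fin n)
    (hij : i ≠ j) (hjl : j ≠ l) (hil : i ≠ l) :
    applyAt f j l hjl ∘ₗ insertTriple a i j l hij hjl hil =
      insertTriple a i j l hij hjl hil ∘ₗ applyRight f := by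
  rw [← LinearMap.cancel_right (TensorProduct.assoc k V V V).symm.surjective]
  apply TensorProduct.ext'
  intro x t
  simp [applyRight, insertTriple_tmul', applyAt_insertPair]

theorem applyAt_braid (c : Braiding k V) (i j l : Fin n) (hij : i ≠ j) (hjl : j ≠ l)
    (hil : i ≠ l) :
    applyAtEquiv c.σ i j hij * applyAtEquiv c.σ j l hjl * applyAtEquiv c.σ i j hij =
      applyAtEquiv c.σ j l hjl * applyAtEquiv c.σ i j hij * applyAtEquiv c.σ j l hjl := by
  apply LinearEquiv.toLinearMap_injective
  apply PiTensorProduct.ext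
  ext a
  have ha : PiTensorProduct.tprod k a =
      insertTriple (k := k) a i j l hij hjl hil ((a i ⊗ₜ a j) ⊗ₜ a l) := by
    simp [insertTriple_tmul, insertPair_tmul]
  have h1 := fun t => LinearMap.congr_fun
    (applyAt_insertTriple_left c.σ.toLinearMap a i j l hij hjl hil) t
  have h2 := fun t => LinearMap.congr_fun
    (applyAt_insertTriple_right c.σ.toLinearMap a i j l hij hjl hil) t
  have h3 := LinearMap.congr_fun c.braid_eq ((a i ⊗ₜ a j) ⊗ₜ a l)
  simp only [LinearMap.comp_apply] at h1 h2 h3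
  simp only [LinearMap.compMultilinearMap_apply, ha]
  change applyAt c.σ.toLinearMap i j hij (applyAt c.σ.toLinearMap j l hjl
    (applyAt c.σ.toLinearMap i j hij _)) = applyAt c.σ.toLinearMap j l hjl
    (applyAt c.σ.toLinearMap i j hij (applyAt c.σ.toLinearMap j l hjl _))
  rw [h1, h2, h1, h3, h2, h1, h2]

theorem applyAt_comm (c : Braiding k V) (i j i' j' : Fin n)
    (h : i ≠ j) (h' : i' ≠ j') (h1 : i ≠ i') (h2 : i ≠ j') (h3 : j ≠ i') (h4 : j ≠ j') :
    applyAtEquiv c.σ i j h * applyAtEquiv c.σ i' j' h' =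
      applyAtEquiv c.σ i' j' h' * applyAtEquiv c.σ i j h := by
  apply LinearEquiv.toLinearMap_injective
  apply PiTensorProduct.ext
  ext a
  let Φ : V ⊗[k] V →ₗ[k] V ⊗[k] V →ₗ[k] ⨂[k] _ : Fin n, V :=
    TensorProduct.lift (LinearMap.mk₂ k
      (fun x y => insertPair (Function.update (Function.update a i x) j y) i' j' h')
      (fun x x' y => by
        rw [Function.update_comm h, Function.update_comm h, Function.update_comm h,
          insertPair_update_add _ _ _ _ _ h1 h2])
      (fun c x y => by
        rw [Function.update_comm h, Function.update_comm h,
          insertPair_update_smul _ _ _ _ _ h1 h2])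
      (fun x y y' => by rw [insertPair_update_add _ _ _ _ _ h3 h4])
      (fun c x y => by rw [insertPair_update_smul _ _ _ _ _ h3 h4]))
  have hΦ : ∀ x y t, Φ (x ⊗ₜ y) t =
      insertPair (Function.update (Function.update a i x) j y) i' j' h' t := by
    intro x y t; simp [Φ]
  have hΦ' : ∀ s x y, Φ s (x ⊗ₜ y) =
      insertPair (Function.update (Function.update a i' x) j' y) i j h s := by
    intro s x y
    induction s with
    | zero => simp
    | add u v hu hv => simp [hu, hv]
    | tmul u v =>
      rw [hΦ, insertPair_tmul, insertPair_tmul, Function.update_comm h3.symm.symm,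
        Function.update_comm h1, Function.update_comm h4, Function.update_comm h2]
  have e1 : ∀ s t, applyAt c.σ.toLinearMap i j h (Φ s t) = Φ (c.σ s) t := by
    intro s t
    induction t with
    | zero => simp
    | add u v hu hv => simp [hu, hv]
    | tmul u v => rw [hΦ', hΦ', applyAt_insertPair]; rfl
  have e2 : ∀ s t, applyAt c.σ.toLinearMap i' j' h' (Φ s t) = Φ s (c.σ t) := by
    intro s t
    induction s with
    | zero => simp
    | add u v hu hv => simp [hu, hv]
    | tmul u v => rw [hΦ, hΦ, applyAt_insertPair]; rfl
  have ha : PiTensorProduct.tprod k a = Φ (a i ⊗ₜ a j) (a i' ⊗ₜ a j') := by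
    simp [hΦ, insertPair_tmul]
  simp only [LinearMap.compMultilinearMap_apply, ha]
  change applyAt c.σ.toLinearMap i j h (applyAt c.σ.toLinearMap i' j' h' _) =
    applyAt c.σ.toLinearMap i' j' h' (applyAt c.σ.toLinearMap i j h _)
  rw [e1, e2, e1, e2]

namespace Braiding

variable (c : Braiding k V)

/-- The automorphism `id^{⊗ j} ⊗ σ ⊗ id^{⊗ (n - j - 2)}` of `V^{⊗ n}`, applying `σ` to the tensor
factors in positions `j` and `j + 1`. -/
noncomputable def crossing (n j : ℕ) : (⨂[k] _ : Fin n, V) ≃ₗ[k] ⨂[k] _ : Fin n, V :=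
  if h : j + 1 < n then
    applyAtEquiv c.σ ⟨j, by omega⟩ ⟨j + 1, h⟩ (by simp)
  else 1

/-- The action of the braid group `B_n` on `V^{⊗ n}`. -/
noncomputable def action (n : ℕ) :
    BraidGroup n →* ((⨂[k] _ : Fin n, V) ≃ₗ[k] ⨂[k] _ : Fin n, V) :=
  braidLift n (c.crossing n)
    (fun j h => by
      have h1 : j + 1 < n := by omega
      have h2 : j + 1 + 1 < n := by omega
      simp only [crossing, h1, h2, dif_pos]
      exact applyAt_braid c _ _ _ _ _ (by simp [Fin.ext_iff]; omega))
    (fun i j h hj => by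
      have h1 : i + 1 < n := by omega
      simp only [crossing, h1, hj, dif_pos]
      apply applyAt_comm <;> simp <;> omega)

/-- A braided vector space is finitely braided if, for each `n`, the action of `B_n` on `V^{⊗ n}`
factors through a finite quotient of `B_n`. -/
def FinitelyBraided : Prop := ∀ n : ℕ, (c.action n).ker.FiniteIndex

end Braiding

end Tensor

/-! ## Braided Hopf algebras -/

section Hopf

variable (k : Type*) [Field k] (A : Type*) [Ring A] [Algebra k A] [Coalgebra k A]

/-- A braided Hopf algebra over `k` in the sense of Takeuchi: a braided vector space which is a
unital associative algebra and a counital coassociative coalgebra, such that all structure maps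
commute with the braiding, the comultiplication and the counit are algebra maps for the braided
product on `A ⊗ A`, and there is an
antipode (it is unique and commutes with the braiding). -/
structure BraidedHopfAlgebra extends Braiding k A where
  braid_mul_left : σ.toLinearMap ∘ₗ (LinearMap.mul' k A).rTensor A =
    (LinearMap.mul' k A).lTensor A ∘ₗ (TensorProduct.assoc k A A A).toLinearMap ∘ₗ
      σ.toLinearMap.rTensor A ∘ₗ applyRight σ.toLinearMap
  braid_mul_right : σ.toLinearMap ∘ₗ (LinearMap.mul' k A).lTensor A ∘ₗ
      (TensorProduct.assoc k A A A).toLinearMap =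
    (LinearMap.mul' k A).rTensor A ∘ₗ applyRight σ.toLinearMap ∘ₗ σ.toLinearMap.rTensor A
  braid_one_left : ∀ a : A, σ (1 ⊗ₜ[k] a) = a ⊗ₜ[k] 1
  braid_one_right : ∀ a : A, σ (a ⊗ₜ[k] 1) = 1 ⊗ₜ[k] a
  braid_comul_left : (TensorProduct.assoc k A A A).symm.toLinearMap ∘ₗ
      (Coalgebra.comul (R := k) (A := A)).lTensor A ∘ₗ σ.toLinearMap =
    σ.toLinearMap.rTensor A ∘ₗ applyRight σ.toLinearMap ∘ₗ
      (Coalgebra.comul (R := k) (A := A)).rTensor A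
  braid_comul_right : (Coalgebra.comul (R := k) (A := A)).rTensor A ∘ₗ σ.toLinearMap =
    applyRight σ.toLinearMap ∘ₗ σ.toLinearMap.rTensor A ∘ₗ
      (TensorProduct.assoc k A A A).symm.toLinearMap ∘ₗ
      (Coalgebra.comul (R := k) (A := A)).lTensor A
  braid_counit_left : (TensorProduct.rid k A).toLinearMap ∘ₗ
      (Coalgebra.counit (R := k) (A := A)).lTensor A ∘ₗ σ.toLinearMap =
    (TensorProduct.lid k A).toLinearMap ∘ₗ (Coalgebra.counit (R := k) (A := A)).rTensor A
  braid_counit_right : (TensorProduct.lid k A).toLinearMap ∘ₗ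
      (Coalgebra.counit (R := k) (A := A)).rTensor A ∘ₗ σ.toLinearMap =
    (TensorProduct.rid k A).toLinearMap ∘ₗ (Coalgebra.counit (R := k) (A := A)).lTensor A
  comul_mul : Coalgebra.comul (R := k) (A := A) ∘ₗ LinearMap.mul' k A =
    TensorProduct.map (LinearMap.mul' k A) (LinearMap.mul' k A) ∘ₗ
      -- the map `id ⊗ σ ⊗ id`
      (TensorProduct.assoc k A A (A ⊗[k] A)).symm.toLinearMap ∘ₗ
      ((TensorProduct.assoc k A A A).toLinearMap ∘ₗ σ.toLinearMap.rTensor A ∘ₗ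
        (TensorProduct.assoc k A A A).symm.toLinearMap).lTensor A ∘ₗ
      (TensorProduct.assoc k A A (A ⊗[k] A)).toLinearMap ∘ₗ
      TensorProduct.map (Coalgebra.comul (R := k) (A := A)) (Coalgebra.comul (R := k) (A := A))
  comul_one : Coalgebra.comul (R := k) (1 : A) = 1 ⊗ₜ[k] 1
  counit_mul : ∀ a b : A, Coalgebra.counit (R := k) (a * b) =
    Coalgebra.counit (R := k) a * Coalgebra.counit (R := k) b
  counit_one : Coalgebra.counit (R := k) (1 : A) = 1
  exists_antipode : ∃ S : A →ₗ[k] A,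
    LinearMap.mul' k A ∘ₗ S.rTensor A ∘ₗ Coalgebra.comul =
      Algebra.linearMap k A ∘ₗ Coalgebra.counit ∧
    LinearMap.mul' k A ∘ₗ S.lTensor A ∘ₗ Coalgebra.comul =
      Algebra.linearMap k A ∘ₗ Coalgebra.counit

variable {A}

/-- The primitive elements of a coalgebra with unit. -/
def IsPrimitive (x : A) : Prop := Coalgebra.comul (R := k) x = x ⊗ₜ[k] 1 + 1 ⊗ₜ[k] x

end Hopf

/-! ## The profinite braided associative operad -/

section Operad

variable (k : Type*) [Field k]

/-- The inverse system of finite quotients of `B_n`, encoded by the finite index normal subgroups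
(smaller subgroups correspond to larger quotients). -/
abbrev FinQuot (n : ℕ) : Type := FiniteIndexNormalSubgroup (BraidGroup n)

/-- The term `k[B_n / N]` of the inverse system which is the `n`th term of the profinite completion
of the braided associative operad. -/
abbrev BrAssLevel (n : ℕ) (N : FinQuot n) : Type _ :=
  MonoidAlgebra k (BraidGroup n ⧸ N.toSubgroup)

/-- The transition maps `k[B_n / N] → k[B_n / N']` of the inverse system, for `N ≤ N'`. -/
noncomputable def transition {n : ℕ} {N N' : FinQuot n} (h : N ≤ N') :
    BrAssLevel k n N →ₐ[k] BrAssLevel k n N' :=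
  MonoidAlgebra.mapDomainAlgHom k k
    (QuotientGroup.map N.toSubgroup N'.toSubgroup (MonoidHom.id _) h)

/-- The projection `k[B_n] → k[B_n / N]`. -/
noncomputable def toLevel {n : ℕ} (N : FinQuot n) :
    MonoidAlgebra k (BraidGroup n) →ₐ[k] BrAssLevel k n N :=
  MonoidAlgebra.mapDomainAlgHom k k (QuotientGroup.mk' N.toSubgroup)

/-- The space of elements of the pro-vector space `{k[B_n / N]}_N`: compatible families, i.e. the
morphisms from the constant pro-vector space `k`. -/
noncomputable def BrAssHat (n : ℕ) : Submodule k (∀ N : FinQuot n, BrAssLevel k n N) where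
  carrier := {α | ∀ (N N' : FinQuot n) (h : N ≤ N'), transition k h (α N) = α N'}
  add_mem' ha hb N N' h := by simp [ha N N' h, hb N N' h]
  zero_mem' N N' h := by simp
  smul_mem' c a ha N N' h := by simp [ha N N' h]

variable {k}

section Action

variable {A : Type*} [Ring A] [Algebra k A]

/-- The kernel of the action of `B_n` on `A^{⊗ n}`, a finite index normal subgroup: the action
factors through the quotient of `B_n` by it, and by every smaller subgroup. -/
noncomputable def actionKernel (c : Braiding k A) (hc : c.FinitelyBraided) (n : ℕ) : FinQuot n :=
  { toSubgroup := (c.action n).ker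
    isNormal' := inferInstance
    isFiniteIndex' := hc n }

/-- The value `α(a_1, …, a_n) ∈ A` for a finitely braided algebra `A`: the element `α` acts on
`a_1 ⊗ ⋯ ⊗ a_n` through a finite quotient of `B_n` which acts on `A^{⊗ n}` (which one is irrelevant,
as the components of `α` are compatible), and the result is multiplied out. -/
noncomputable def evaluate (c : Braiding k A) (hc : c.FinitelyBraided) {n : ℕ} (α : BrAssHat k n)
    (a : Fin n → A) : A :=
  PiTensorProduct.lift (MultilinearMap.mkPiAlgebraFin k n A)
    (MonoidAlgebra.lift k _ _
      ((LinearEquiv.automorphismGroup.toLinearMapMonoidHom).comp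
        (QuotientGroup.kerLift (c.action n)))
      (α.1 (actionKernel c hc n)) (PiTensorProduct.tprod k a))

end Action

/-- The cabling map `∘_i : B_m × B_n → B_{m+n-1}` descends to the given finite quotients. -/
def CablingDescends {m n : ℕ} (i : Fin m) (P : FinQuot m) (Q : FinQuot n)
    (L : FinQuot (m + n - 1)) : Prop :=
  ∀ (γ γ' : BraidGroup m) (ρ ρ' : BraidGroup n), γ⁻¹ * γ' ∈ P → ρ⁻¹ * ρ' ∈ Q →
    (cabling i γ ρ)⁻¹ * cabling i γ' ρ' ∈ L

theorem exists_cablingDescends {m n : ℕ} (i : Fin m) (L : FinQuot (m + n - 1)) :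
   ∃ (P₀ : FinQuot m) (Q₀ : FinQuot n), CablingDescends i P₀ Q₀ L := by
  let Q₀ : FinQuot n := L.comap (insertAt n i)
  let π := QuotientGroup.mk' L.toSubgroup
  let F : BraidGroup m →* (Fin m → (BraidGroup (m + n - 1) ⧸ L.toSubgroup)) ⋊[mulAutArrow]
      (Equiv.Perm (Fin m)) :=
   { toFun := fun γ => ⟨fun x => π ((cableHom m n γ).left x), toPerm m γ⟩
     map_one' := by ext <;> simp
     map_mul' := by
      intro a b
      ext x
      · rw [map_mul, SemidirectProduct.mul_left, cableHom_right, SemidirectProduct.mul_left]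
        exact map_mul π _ _
      · simp }
  have : Finite ((Fin m → (BraidGroup (m + n - 1) ⧸ L.toSubgroup)) ⋊[mulAutArrow]
      (Equiv.Perm (Fin m))) :=
    Finite.of_equiv _ SemidirectProduct.equivProd.symm
  let P₀ : FinQuot m := { toSubgroup := F.ker }
  refine ⟨P₀, Q₀, ?_⟩
  intro γ γ' ρ ρ' hγ hρ
  have hF : F γ = F γ' := by
    have : F (γ⁻¹ * γ') = 1 := hγ
    rw [map_mul, map_inv, inv_mul_eq_one] at this; exact this
  have h1 := congrArg (fun z => z.right) hF
  have h2 := congrArg (fun z => z.left) hF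
  simp only [F, MonoidHom.coe_mk, OneHom.coe_mk] at h1 h2
  have h3 := congrFun h2 (toPerm m γ i)
  have hρ2 : (insertAt n i (ρ⁻¹ * ρ')) ∈ L.toSubgroup := hρ
  rw [map_mul, map_inv, ← QuotientGroup.eq] at hρ2
  rw [← FiniteIndexNormalSubgroup.mem_toSubgroup_iff, ← QuotientGroup.eq]
  simp only [cabling, QuotientGroup.mk_mul, fatten]
  rw [← h1, hρ2]
  exact congrArg (· * _) h3

/-- The map `B_m / P × B_n / Q → B_{m+n-1} / L` induced by cabling. -/
def cablingQuot {m n : ℕ} (i : Fin m) {P : FinQuot m} {Q : FinQuot n} {L : FinQuot (m + n - 1)}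
    (h : CablingDescends i P Q L) :
    BraidGroup m ⧸ P.toSubgroup → BraidGroup n ⧸ Q.toSubgroup →
      BraidGroup (m + n - 1) ⧸ L.toSubgroup :=
  Quotient.map₂ (cabling i) (fun γ γ' hγ ρ ρ' hρ => by
    rw [← Quotient.eq_iff_equiv] at hγ hρ ⊢
    exact QuotientGroup.eq.2 (h γ γ' ρ ρ' (QuotientGroup.eq.1 hγ) (QuotientGroup.eq.1 hρ)))

/-- The bilinear map `∘_i : k[B_m / P] × k[B_n / Q] → k[B_{m+n-1} / L]` induced by cabling. For
fixed `L` and all sufficiently small `P` and `Q` these maps represent the operadic composition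
`∘_i`, which is a morphism of pro-vector spaces. -/
noncomputable def comp {m n : ℕ} (i : Fin m) {P : FinQuot m} {Q : FinQuot n}
    {L : FinQuot (m + n - 1)} (h : CablingDescends i P Q L)
    (x : BrAssLevel k m P) (y : BrAssLevel k n Q) : BrAssLevel k (m + n - 1) L :=
  x.coeff.sum fun g a => y.coeff.sum fun r b => MonoidAlgebra.single (cablingQuot i h g r) (a * b)

variable (k) in
/-- A family of subspaces of the terms of the inverse systems `{k[B_n / N]}_N`. -/
abbrev LevelwiseSubspace : Type _ := ∀ (n : ℕ) (N : FinQuot n), Submodule k (BrAssLevel k n N)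

/-- A levelwise family of subspaces is a suboperad if it is a subobject of the inverse systems
(`transition_mem`), is stable under the right action of the braid groups (`right_mem`), and if every
operadic composition `∘_i`, as a morphism of pro-vector spaces, restricts to it (`comp_mem`). -/
structure IsSuboperad (C : LevelwiseSubspace k) : Prop where
  transition_mem : ∀ (n : ℕ) (N N' : FinQuot n) (h : N ≤ N'), ∀ x ∈ C n N,
    transition k h x ∈ C n N'
  right_mem : ∀ (n : ℕ) (N : FinQuot n) (γ : BraidGroup n), ∀ x ∈ C n N,
    x * MonoidAlgebra.of k _ (γ : BraidGroup n ⧸ N.toSubgroup) ∈ C n N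
  comp_mem : ∀ (m n : ℕ) (i : Fin m) (L : FinQuot (m + n - 1)),
    ∃ (P₀ : FinQuot m) (Q₀ : FinQuot n), ∀ P ≤ P₀, ∀ Q ≤ Q₀, ∃ h : CablingDescends i P Q L,
      ∀ x ∈ C m P, ∀ y ∈ C n Q, comp i h x y ∈ C (m + n - 1) L

/-- `C(0) = 0`. -/
def IsReducedSeq (C : LevelwiseSubspace k) : Prop := ∀ N : FinQuot 0, C 0 N = ⊥

/-- The identity operation, i.e. the unit of `k[B_1]`, belongs to `C(1)`. -/
def IsUnitalSeq (C : LevelwiseSubspace k) : Prop := ∀ N : FinQuot 1, 1 ∈ C 1 N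

/-- All transition maps `C(n)_N → C(n)_{N'}` are epimorphisms. -/
def IsStrictSeq (C : LevelwiseSubspace k) : Prop :=
  ∀ (n : ℕ) (N N' : FinQuot n) (h : N ≤ N'), (C n N).map (transition k h).toLinearMap = C n N'

variable (k) in
/-- The braided primitive operad: for `n > 1`, the intersection over all `p + q = n` with
`p, q > 0` of the kernels of left multiplication by `𝔖_{p,q}`. -/
noncomputable def brPrim : LevelwiseSubspace k := fun n N =>
  if 1 < n then
    ⨅ p ∈ Finset.Ioo 0 n, LinearMap.ker (LinearMap.mulLeft k (toLevel k N (shuffleSum k n p)))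
  else ⊥

variable (k) in
/-- The unital enhancement of the braided primitive operad, which differs from it only in arity
`1`, where it is spanned by the identity operation. -/
noncomputable def brPrimStar : LevelwiseSubspace k := fun n N =>
  if n = 1 then Submodule.span k {1} else brPrim k n N

/-- The elements of a levelwise subspace: compatible families whose components lie in it. -/
def LevelwiseSubspace.elements (C : LevelwiseSubspace k) (n : ℕ) : Set (BrAssHat k n) :=
  {α | ∀ N, α.1 N ∈ C n N}

end Operad

end BraidedPrimitive

open BraidedPrimitive

universe u v

/-!
The first part rests on two computations. On the one hand, for primitive elements `a₁, …, aₙ` of a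
braided Hopf algebra, `Δ(a₁ ⋯ aₙ)` is the sum over `p + q = n` of the elements obtained from
`𝔖_{p,q} · (a₁ ⊗ ⋯ ⊗ aₙ)` by multiplying the first `p` and the last `q` factors separately. The
span of the tensor products of primitive elements is stable under `B_n`, because the kernels of the
defect `Δ(x) - x ⊗ 1 - 1 ⊗ x` in the single factors are; so the formula applies to
`α · (a₁ ⊗ ⋯ ⊗ aₙ)` as well, and an operation `α` killed by all `𝔖_{p,q}` with `p, q > 0` preserves
primitive elements.

On the other hand, the words in a finite augmented rack form a finitely braided Hopf algebra, with
braiding `v ⊗ w ↦ |v| w ⊗ v`, in which the letters are primitive. If `α` preserves primitive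
elements, its value on a sequence of letters is primitive, and the component of bidegree `(p, q)` of
the coproduct shows that `𝔖_{p,q} α` kills that sequence. It remains to find, for every finite
quotient of `B_n`, a finite augmented rack and a sequence of `n` letters whose `B_n`-orbit detects
the quotient: then `𝔖_{p,q} α = 0` there. The letters are strands, free over a finite group `G`, and
their degrees are found by combing, by induction on `n`: when the last strand has degree `1`, the
braids in which only that strand moves act by multiplying it by elements of `G`, the braid around
strand `i` by the inverse of the degree of that strand, which may thus record its image in the
quotient.

Compositions of operations which preserve primitive elements preserve primitive elements, and for
the letters of a detecting rack this shows that `BrPrim_*` is closed under composition. For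
strictness, multiplication on the right by the average over the kernel of `B_n/N → B_n/N'`, which
is available in characteristic `0`, turns an arbitrary lift of an element of `BrPrim_*(n)_{N'}` into
an element of `BrPrim_*(n)_N`.
-/

namespace BraidedPrimitive

/-! ### Generators of the braid groups -/

theorem closure_gen (n : ℕ) : Subgroup.closure (gen n '' {j | j + 1 < n}) = ⊤ := by
  rw [eq_top_iff, ← PresentedGroup.closure_range_of (braidRels n), Subgroup.closure_le]
  rintro _ ⟨j, rfl⟩
  exact Subgroup.subset_closure ⟨j, Nat.add_lt_of_lt_sub j.2, gen_of j⟩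

theorem braid_induction {n : ℕ} {P : BraidGroup n → Prop} (one : P 1)
    (of_gen : ∀ j, j + 1 < n → P (gen n j)) (mul : ∀ β γ, P β → P γ → P (β * γ))
    (inv : ∀ β, P β → P β⁻¹) (β : BraidGroup n) : P β := by
  have hβ : β ∈ Subgroup.closure (gen n '' {j | j + 1 < n}) := by simp [closure_gen]
  induction hβ using Subgroup.closure_induction with
  | mem x hx => obtain ⟨j, hj, rfl⟩ := hx; exact of_gen j hj
  | one => exact one
  | mul x y _ _ hx hy => exact mul x y hx hy
  | inv x _ hx => exact inv x hx

theorem braidHom_ext {n : ℕ} {M : Type*} [Monoid M] {f g : BraidGroup n →* M}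
    (h : ∀ j, j + 1 < n → f (gen n j) = g (gen n j)) : f = g :=
  MonoidHom.eq_of_eqOn_dense (closure_gen n) (by rintro _ ⟨j, hj, rfl⟩; exact h j hj)

theorem braidGroup_subsingleton {n : ℕ} (hn : n ≤ 1) : Subsingleton (BraidGroup n) := by
  have eq_one : ∀ β : BraidGroup n, β = 1 := braid_induction rfl (fun j hj => by omega)
    (fun β γ hβ hγ => by simp [hβ, hγ]) (fun β hβ => by simp [hβ])
  exact ⟨fun β γ => (eq_one β).trans (eq_one γ).symm⟩

/-! ### Combing -/

section Combing

variable {Γ : Type*} [Group Γ]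

theorem closure_le_normalizer_closure {S T : Set Γ}
    (h : ∀ g ∈ S, ∀ a ∈ T,
      g * a * g⁻¹ ∈ Subgroup.closure T ∧ g⁻¹ * a * g ∈ Subgroup.closure T) :
    Subgroup.closure S ≤ Subgroup.normalizer (Subgroup.closure T : Set Γ) := by
  rw [Subgroup.closure_le]
  intro g hg
  have hconj : Subgroup.closure T ≤ (Subgroup.closure T).comap (MulAut.conj g).toMonoidHom :=
    (Subgroup.closure_le _).2 fun a ha => (h g hg a ha).1
  have hconj' : Subgroup.closure T ≤ (Subgroup.closure T).comap (MulAut.conj g⁻¹).toMonoidHom :=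
    (Subgroup.closure_le _).2 fun a ha => by simpa using (h g hg a ha).2
  refine Subgroup.mem_normalizer_iff.2 fun u => ⟨fun hu => hconj hu, fun hu => ?_⟩
  simpa [mul_assoc] using hconj' hu

variable (s : ℕ → Γ) (n : ℕ)

/-- The relations of the braid group on `n + 1` strands for the elements `s 0, …, s (n - 1)`. -/
structure BraidRelations : Prop where
  braid : ∀ j, j + 1 < n → s j * s (j + 1) * s j = s (j + 1) * s j * s (j + 1)
  comm : ∀ i j, i + 1 < j → j < n → Commute (s i) (s j)

/-- The product `s_p s_{p+1} ⋯ s_{n-1}`, in which the last strand moves to position `p`. -/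
def strandChain (p : ℕ) : Γ := ((List.range (n - p)).map fun t => s (p + t)).prod

/-- For generators `s` of a braid group, the pure braid in which the last strand moves around the
strand in position `i`. -/
def pureGen (i : ℕ) : Γ := (strandChain s n (i + 1))⁻¹ * (s i * s i) * strandChain s n (i + 1)

/-- The subgroup of the braids in which only the last strand moves. -/
def combSubgroup : Subgroup Γ := Subgroup.closure (pureGen s n '' {i | i < n})

/-- The subgroup of the braids on all strands but the last. -/
def initSubgroup : Subgroup Γ := Subgroup.closure (s '' {j | j + 1 < n})

theorem strandChain_self : strandChain s n n = 1 := by simp [strandChain]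

variable {n}

theorem strandChain_of_lt {p : ℕ} (hp : p < n) :
    strandChain s n p = s p * strandChain s n (p + 1) := by
  obtain ⟨d, rfl⟩ : ∃ d, n = p + 1 + d := ⟨n - (p + 1), by omega⟩
  have hlen : p + 1 + d - p = d + 1 := by omega
  rw [strandChain, strandChain, hlen, Nat.add_sub_cancel_left, List.range_succ_eq_map]
  simp only [List.map_cons, List.map_map, List.prod_cons, add_zero, Function.comp_def,
    Nat.succ_eq_add_one, add_assoc, add_comm 1]

variable {s}

theorem pureGen_mem_combSubgroup {i : ℕ} (hi : i < n) : pureGen s n i ∈ combSubgroup s n :=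
  Subgroup.subset_closure ⟨i, hi, rfl⟩

theorem mem_initSubgroup {j : ℕ} (hj : j + 1 < n) : s j ∈ initSubgroup s n :=
  Subgroup.subset_closure ⟨j, hj, rfl⟩

namespace BraidRelations

variable (hs : BraidRelations s n)
include hs

theorem commute_strandChain {j p : ℕ} (hp : p ≤ n) (h : j + 1 < p) :
    Commute (s j) (strandChain s n p) := by
  induction hp using Nat.decreasingInduction with
  | self => simp [strandChain_self]
  | of_succ p hp ih =>
    rw [strandChain_of_lt s hp]
    exact (hs.comm j p h hp).mul_right (ih (by omega))

theorem semiconjBy_strandChain {j p : ℕ} (hj : j + 1 < n) (h : p ≤ j) :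
    SemiconjBy (strandChain s n p) (s j) (s (j + 1)) := by
  induction h using Nat.decreasingInduction with
  | self =>
    have hbraid : SemiconjBy (s j * s (j + 1)) (s j) (s (j + 1)) := by
      rw [SemiconjBy, hs.braid j hj, mul_assoc]
    rw [strandChain_of_lt s (by omega), strandChain_of_lt s hj, ← mul_assoc]
    exact hbraid.mul_left (hs.commute_strandChain (by omega) (by omega)).symm
  | of_succ p hp ih =>
    rw [strandChain_of_lt s (by omega)]
    exact SemiconjBy.mul_left (hs.comm p (j + 1) (by omega) hj) ih

theorem commute_pureGen_of_lt {i j : ℕ} (hi : i < n) (h : j + 1 < i) :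
    Commute (s j) (pureGen s n i) := by
  have hchain := hs.commute_strandChain hi (show j + 1 < i + 1 by omega)
  have hi := hs.comm j i h hi
  exact (hchain.inv_right.mul_right (hi.mul_right hi)).mul_right hchain

theorem commute_pureGen_of_gt {i j : ℕ} (hj : j + 1 < n) (h : i < j) :
    Commute (s j) (pureGen s n i) := by
  have hchain := hs.semiconjBy_strandChain hj (Nat.succ_le_of_lt h)
  have hi : Commute (s i) (s (j + 1)) := hs.comm i (j + 1) (by omega) hj
  exact Commute.symm ((hchain.inv_symm_left.mul_left (hi.mul_left hi)).mul_left hchain)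

theorem conj_pureGen_succ {i : ℕ} (hi : i + 1 < n) :
    s i * pureGen s n (i + 1) * (s i)⁻¹ = pureGen s n i := by
  have hchain : Commute (s i) (strandChain s n (i + 1 + 1)) :=
    hs.commute_strandChain hi (by omega)
  have hsq : s i * (s (i + 1) * s (i + 1)) * (s i)⁻¹ = (s (i + 1))⁻¹ * (s i * s i) * s (i + 1) := by
    have hconj : SemiconjBy (s (i + 1) * s i) (s (i + 1)) (s i) := by
      rw [SemiconjBy, ← hs.braid i hi, mul_assoc]
    rw [mul_inv_eq_iff_eq_mul, mul_assoc, mul_assoc, eq_inv_mul_iff_mul_eq, ← mul_assoc,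
      (hconj.mul_right hconj).eq]
  rw [pureGen, pureGen, strandChain_of_lt s hi]
  generalize strandChain s n (i + 1 + 1) = c at *
  calc s i * (c⁻¹ * (s (i + 1) * s (i + 1)) * c) * (s i)⁻¹
      = (s i * c⁻¹) * (s (i + 1) * s (i + 1)) * (c * (s i)⁻¹) := by group
    _ = c⁻¹ * (s i * (s (i + 1) * s (i + 1)) * (s i)⁻¹) * c := by
      rw [hchain.inv_right.eq, hchain.symm.inv_right.eq]; group
    _ = (s (i + 1) * c)⁻¹ * (s i * s i) * (s (i + 1) * c) := by rw [hsq]; group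

theorem commute_pureGen_mul_pureGen {i : ℕ} (hi : i + 1 < n) :
    Commute (s i) (pureGen s n (i + 1) * pureGen s n i) := by
  have hchain : Commute (s i) (strandChain s n (i + 1 + 1)) :=
    hs.commute_strandChain hi (by omega)
  have hfull : Commute (s i) (s (i + 1) * s i * (s i * s (i + 1))) := by
    have h₁ : SemiconjBy (s (i + 1) * s i) (s (i + 1)) (s i) := by
      rw [SemiconjBy, ← hs.braid i hi, mul_assoc]
    have h₂ : SemiconjBy (s i * s (i + 1)) (s i) (s (i + 1)) := by
      rw [SemiconjBy, hs.braid i hi, mul_assoc]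
    exact (h₁.mul_left h₂).symm
  have hprod : pureGen s n (i + 1) * pureGen s n i = (strandChain s n (i + 1 + 1))⁻¹ *
      (s (i + 1) * s i * (s i * s (i + 1))) * strandChain s n (i + 1 + 1) := by
    rw [pureGen, pureGen, strandChain_of_lt s hi]; group
  rw [hprod]
  exact (hchain.inv_right.mul_right hfull).mul_right hchain

theorem conj_pureGen_self {i : ℕ} (hi : i + 1 < n) :
    s i * pureGen s n i * (s i)⁻¹ =
      (pureGen s n i)⁻¹ * pureGen s n (i + 1) * pureGen s n i := by
  have hconj := hs.conj_pureGen_succ hi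
  have hcomm := (hs.commute_pureGen_mul_pureGen hi).eq
  calc s i * pureGen s n i * (s i)⁻¹ = (s i * pureGen s n (i + 1) * (s i)⁻¹)⁻¹ *
        (s i * (pureGen s n (i + 1) * pureGen s n i)) * (s i)⁻¹ := by group
    _ = (pureGen s n i)⁻¹ * pureGen s n (i + 1) * pureGen s n i := by
      rw [hconj, hcomm]; group

theorem inv_conj_pureGen_succ {i : ℕ} (hi : i + 1 < n) :
    (s i)⁻¹ * pureGen s n (i + 1) * s i =
      pureGen s n (i + 1) * pureGen s n i * (pureGen s n (i + 1))⁻¹ := by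
  have hcomm := (hs.commute_pureGen_mul_pureGen hi).eq
  calc (s i)⁻¹ * pureGen s n (i + 1) * s i
      = (s i)⁻¹ * (pureGen s n (i + 1) * pureGen s n i * s i) *
        ((s i)⁻¹ * (pureGen s n i)⁻¹ * s i) := by group
    _ = pureGen s n (i + 1) * pureGen s n i * (pureGen s n (i + 1))⁻¹ := by
      rw [← hcomm, ← hs.conj_pureGen_succ hi]; group

theorem initSubgroup_le_normalizer :
    initSubgroup s n ≤ Subgroup.normalizer (combSubgroup s n : Set Γ) := by
  refine closure_le_normalizer_closure ?_
  rintro _ ⟨j, hj, rfl⟩ _ ⟨i, hi, rfl⟩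
  have mem_self : pureGen s n j ∈ combSubgroup s n :=
    pureGen_mem_combSubgroup (Nat.lt_of_succ_lt hj)
  have mem_succ : pureGen s n (j + 1) ∈ combSubgroup s n := pureGen_mem_combSubgroup hj
  have mem_of_commute (h : Commute (s j) (pureGen s n i)) :
      s j * pureGen s n i * (s j)⁻¹ ∈ combSubgroup s n ∧
        (s j)⁻¹ * pureGen s n i * s j ∈ combSubgroup s n := by
    rw [h.eq, mul_inv_cancel_right, mul_assoc, ← h.eq, inv_mul_cancel_left]
    exact ⟨pureGen_mem_combSubgroup hi, pureGen_mem_combSubgroup hi⟩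
  rcases lt_or_ge i j with hij | hij
  · exact mem_of_commute (hs.commute_pureGen_of_gt hj hij)
  obtain rfl | rfl | hij : i = j ∨ i = j + 1 ∨ j + 1 < i := by omega
  · refine ⟨hs.conj_pureGen_self hj ▸ mul_mem (mul_mem (inv_mem mem_self) mem_succ) mem_self, ?_⟩
    rw [← hs.conj_pureGen_succ hj]
    change _ ∈ combSubgroup s n
    simpa [mul_assoc] using mem_succ
  · refine ⟨hs.conj_pureGen_succ hj ▸ mem_self, ?_⟩
    rw [hs.inv_conj_pureGen_succ hj]
    exact mul_mem (mul_mem mem_succ mem_self) (inv_mem mem_succ)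
  · exact mem_of_commute (hs.commute_pureGen_of_lt hi hij)

theorem inv_strandChain_mul_gen_mul_mem {j p : ℕ} (hj : j < n) (hp : p ≤ n) :
    (strandChain s n (Equiv.swap j (j + 1) p))⁻¹ * s j * strandChain s n p ∈
      initSubgroup s n ⊔ combSubgroup s n := by
  obtain h | rfl | rfl | h : j + 1 < p ∨ p = j + 1 ∨ p = j ∨ p < j := by omega
  · rw [Equiv.swap_apply_of_ne_of_ne (by omega) (by omega), mul_assoc,
      (hs.commute_strandChain hp h).eq, inv_mul_cancel_left]
    exact Subgroup.mem_sup_left (mem_initSubgroup (by omega))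
  · rw [Equiv.swap_apply_right, mul_assoc, ← strandChain_of_lt s hj, inv_mul_cancel]
    exact one_mem _
  · rw [Equiv.swap_apply_left, strandChain_of_lt s hj, mul_assoc, ← mul_assoc (s p),
      ← mul_assoc]
    exact Subgroup.mem_sup_right (pureGen_mem_combSubgroup hj)
  · obtain ⟨i, rfl⟩ : ∃ i, j = i + 1 := ⟨j - 1, by omega⟩
    rw [Equiv.swap_apply_of_ne_of_ne (by omega) (by omega), mul_assoc,
      ← (hs.semiconjBy_strandChain hj (by omega)).eq, inv_mul_cancel_left]
    exact Subgroup.mem_sup_left (mem_initSubgroup hj)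

theorem exists_inv_strandChain_mul_mul_mem {g : Γ}
    (hg : g ∈ Subgroup.closure (s '' {j | j < n})) {p : ℕ} (hp : p ≤ n) :
    ∃ q ≤ n, (strandChain s n q)⁻¹ * g * strandChain s n p ∈
      initSubgroup s n ⊔ combSubgroup s n := by
  have swap_le {j q : ℕ} (hj : j < n) (hq : q ≤ n) : Equiv.swap j (j + 1) q ≤ n := by
    rw [Equiv.swap_apply_def]; split_ifs <;> omega
  induction hg using Subgroup.closure_induction'' generalizing p with
  | mem x hx =>
    obtain ⟨j, hj, rfl⟩ := hx
    exact ⟨_, swap_le hj hp, hs.inv_strandChain_mul_gen_mul_mem hj hp⟩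
  | inv_mem x hx =>
    obtain ⟨j, hj, rfl⟩ := hx
    refine ⟨_, swap_le hj hp, ?_⟩
    have h := inv_mem (hs.inv_strandChain_mul_gen_mul_mem hj (swap_le hj hp))
    rwa [Equiv.swap_apply_self, mul_inv_rev, mul_inv_rev, inv_inv, ← mul_assoc] at h
  | one => exact ⟨p, hp, by simp⟩
  | mul x y _ _ hx hy =>
    obtain ⟨q, hq, hyq⟩ := hy hp
    obtain ⟨r, hr, hxr⟩ := hx hq
    refine ⟨r, hr, ?_⟩
    convert mul_mem hxr hyq using 1
    group

theorem exists_comb {g : Γ} (hg : g ∈ Subgroup.closure (s '' {j | j < n})) :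
    ∃ p ≤ n, ∃ h ∈ initSubgroup s n, ∃ u ∈ combSubgroup s n, g = strandChain s n p * h * u := by
  obtain ⟨p, hp, hmem⟩ := hs.exists_inv_strandChain_mul_mul_mem hg le_rfl
  rw [strandChain_self, mul_one, ← SetLike.mem_coe,
    Subgroup.coe_mul_of_left_le_normalizer_right _ _ hs.initSubgroup_le_normalizer] at hmem
  obtain ⟨h, hh, u, hu, huv⟩ := hmem
  exact ⟨p, hp, h, hh, u, hu, by rw [mul_assoc, eq_mul_of_inv_mul_eq huv.symm]⟩

end BraidRelations

end Combing


/-! ### Augmented racks and their braid group actions -/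

/-- A set with an action of a group `G` and an equivariant map to `G`, which acts on itself by
conjugation. It carries the braiding `(x, y) ↦ (deg x • y, x)`. -/
structure AugRack (G Y : Type*) [Group G] [MulAction G Y] where
  /-- The augmentation. -/
  deg : Y → G
  deg_smul : ∀ g y, deg (g • y) = g * deg y * g⁻¹

namespace AugRack

variable {G Y : Type*} [Group G] [MulAction G Y] (R : AugRack G Y)

/-- The crossing of the entries in positions `j` and `j + 1` of a sequence. -/
def cross (j : ℕ) : Equiv.Perm (ℕ → Y) where
  toFun w i := if i = j then R.deg (w j) • w (j + 1) else if i = j + 1 then w j else w i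
  invFun w i :=
    if i = j then w (j + 1) else if i = j + 1 then (R.deg (w (j + 1)))⁻¹ • w j else w i
  left_inv w := by
    funext i
    by_cases h1 : i = j
    · simp [h1]
    · by_cases h2 : i = j + 1 <;> simp [h1, h2]
  right_inv w := by
    funext i
    by_cases h1 : i = j
    · simp [h1]
    · by_cases h2 : i = j + 1 <;> simp [h1, h2]

theorem cross_apply (j : ℕ) (w : ℕ → Y) (i : ℕ) : R.cross j w i =
    if i = j then R.deg (w j) • w (j + 1) else if i = j + 1 then w j else w i := rfl

theorem cross_inv_apply (j : ℕ) (w : ℕ → Y) (i : ℕ) : (R.cross j)⁻¹ w i =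
    if i = j then w (j + 1) else if i = j + 1 then (R.deg (w (j + 1)))⁻¹ • w j else w i := rfl

theorem cross_left (j : ℕ) (w : ℕ → Y) : R.cross j w j = R.deg (w j) • w (j + 1) := by
  simp [cross_apply]

theorem cross_right (j : ℕ) (w : ℕ → Y) : R.cross j w (j + 1) = w j := by
  simp [cross_apply]

theorem cross_of_ne {i j : ℕ} (w : ℕ → Y) (h1 : i ≠ j) (h2 : i ≠ j + 1) : R.cross j w i = w i := by
  simp [cross_apply, h1, h2]

theorem cross_braid (j : ℕ) : R.cross j * R.cross (j + 1) * R.cross j =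
    R.cross (j + 1) * R.cross j * R.cross (j + 1) := by
  ext w i
  have hne : j + 1 + 1 ≠ j := by omega
  obtain rfl | rfl | rfl | ⟨h₀, h₁, h₂⟩ :
    i = j ∨ i = j + 1 ∨ i = j + 1 + 1 ∨ i ≠ j ∧ i ≠ j + 1 ∧ i ≠ j + 1 + 1 := by omega
  · simp [cross_apply, smul_smul, R.deg_smul, hne, hne.symm]
  · simp [cross_apply, hne, hne.symm]
  · simp [cross_apply, hne, hne.symm]
  · simp [cross_apply, h₀, h₁, h₂]

theorem cross_comm {i j : ℕ} (h : i + 1 < j) : R.cross i * R.cross j = R.cross j * R.cross i := by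
  ext w l
  simp only [Equiv.Perm.mul_apply, cross_apply]
  grind

/-- The action of the braid group `B_n` on the first `n` entries of sequences. -/
def seqAct (n : ℕ) : BraidGroup n →* Equiv.Perm (ℕ → Y) :=
  braidLift n R.cross (fun j _ => R.cross_braid j) (fun _ _ h _ => R.cross_comm h)

theorem seqAct_gen {n j : ℕ} (h : j + 1 < n) : R.seqAct n (gen n j) = R.cross j :=
  braidLift_gen _ _ _ _ h

theorem seqAct_of_le {n : ℕ} (β : BraidGroup n) (w : ℕ → Y) {i : ℕ} (hi : n ≤ i) :
    R.seqAct n β w i = w i := by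
  induction β using braid_induction generalizing w with
  | one => simp
  | of_gen j hj => rw [seqAct_gen R hj, cross_of_ne R w (by omega) (by omega)]
  | mul β γ h1 h2 => rw [map_mul, Equiv.Perm.mul_apply, h1, h2]
  | inv β h => rw [← h (R.seqAct n β⁻¹ w), ← Equiv.Perm.mul_apply, ← map_mul]; simp

theorem seqAct_map {G' Y' : Type*} [Group G'] [MulAction G' Y'] (R' : AugRack G' Y')
    {f : Y → Y'} (hf : ∀ y z, f (R.deg y • z) = R'.deg (f y) • f z) {n : ℕ} (β : BraidGroup n)
    (w : ℕ → Y) : R'.seqAct n β (f ∘ w) = f ∘ R.seqAct n β w := by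
  induction β using braid_induction generalizing w with
  | one => simp
  | of_gen j hj =>
    rw [seqAct_gen R hj, seqAct_gen R' hj]
    funext i
    simp only [cross_apply, Function.comp]
    split_ifs <;> simp [hf]
  | mul β γ h1 h2 => rw [map_mul, map_mul, Equiv.Perm.mul_apply, h2, h1]; rfl
  | inv β h =>
    apply (R'.seqAct n β).injective
    rw [h, ← Equiv.Perm.mul_apply, ← map_mul, ← Equiv.Perm.mul_apply, ← map_mul]
    simp

theorem seqAct_label {L : Type*} {f : Y → L} (hf : ∀ (g : G) y, f (g • y) = f y) {n : ℕ}
    (β : BraidGroup n) (w : ℕ → Y) (i : Fin n) :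
    f (R.seqAct n β w (toPerm n β i)) = f (w i) := by
  induction β using braid_induction generalizing w i with
  | one => simp
  | of_gen j hj =>
    rw [seqAct_gen R hj, toPerm_gen hj, cross_apply, adj_val hj]
    by_cases h1 : (i : ℕ) = j
    · simp [h1]
    by_cases h2 : (i : ℕ) = j + 1
    · simp [h2, hf]
    · simp [h1, h2]
  | mul β γ h1 h2 =>
    rw [map_mul, map_mul, Equiv.Perm.mul_apply, Equiv.Perm.mul_apply, h1, h2]
  | inv β h =>
    rw [← h, ← Equiv.Perm.mul_apply, ← map_mul, ← Equiv.Perm.mul_apply, ← map_mul]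
    simp

end AugRack

/-! ### Free strands over a group -/

/-- The free `G`-set on the labels `ℕ`. -/
@[ext]
structure Strand (G : Type*) where
  /-- The position in the group. -/
  val : G
  /-- The label. -/
  label : ℕ

namespace Strand

variable {G : Type*} [Group G]

instance : MulAction G (Strand G) where
  smul g z := ⟨g * z.val, z.label⟩
  one_smul z := by ext <;> simp [HSMul.hSMul]
  mul_smul g h z := by ext <;> simp [HSMul.hSMul, mul_assoc]

@[simp] theorem smul_val (g : G) (z : Strand G) : (g • z).val = g * z.val := rfl
@[simp] theorem smul_label (g : G) (z : Strand G) : (g • z).label = z.label := rfl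

/-- The augmented rack in which the strand `(1, i)` has degree `t i`. -/
def rack (t : ℕ → G) : AugRack G (Strand G) where
  deg z := z.val * t z.label * z.val⁻¹
  deg_smul g z := by simp [mul_assoc]

theorem rack_deg (t : ℕ → G) (z : Strand G) : (rack t).deg z = z.val * t z.label * z.val⁻¹ := rfl

variable (G) in
/-- The sequence of the strands in their initial positions. -/
def base : ℕ → Strand G := fun i => ⟨1, i⟩

theorem toPerm_eq_one {n : ℕ} (t : ℕ → G) {β : BraidGroup n}
    (h : (rack t).seqAct n β (base G) = base G) : toPerm n β = 1 := by
  ext i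
  have hlabel := (rack t).seqAct_label (f := label) (by simp) β (base G) i
  rw [h] at hlabel
  simpa [base] using hlabel

end Strand

/-! ### Detecting finite quotients of braid groups -/

/-- The inclusion `B_n → B_{n+1}` of the braids which leave the last strand alone. -/
def inclBraid (n : ℕ) : BraidGroup n →* BraidGroup (n + 1) :=
  braidLift n (gen (n + 1)) (fun _ _ => gen_braid (by omega)) (fun _ _ h _ => gen_comm h)

theorem inclBraid_gen {n j : ℕ} (h : j + 1 < n) : inclBraid n (gen n j) = gen (n + 1) j :=
  braidLift_gen _ _ _ _ h

theorem AugRack.seqAct_inclBraid {G Y : Type*} [Group G] [MulAction G Y] (R : AugRack G Y)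
    (n : ℕ) (β : BraidGroup n) : R.seqAct (n + 1) (inclBraid n β) = R.seqAct n β := by
  have hcomp : (R.seqAct (n + 1)).comp (inclBraid n) = R.seqAct n := braidHom_ext fun j hj => by
    rw [MonoidHom.comp_apply, inclBraid_gen hj, R.seqAct_gen hj, R.seqAct_gen (by omega)]
  exact DFunLike.congr_fun hcomp β

/-- The inverses of the generators of `B_n`. Braids are combed with respect to these, because a
strand of trivial degree passes the other strands along them without acting on them. -/
def genInv (n j : ℕ) : BraidGroup n := (gen n j)⁻¹

theorem braidRelations_genInv (n : ℕ) : BraidRelations (genInv (n + 1)) n where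
  braid j hj := by
    simpa only [genInv, mul_inv_rev, mul_assoc] using
      congrArg (·⁻¹) (gen_braid (n := n + 1) (j := j) (by omega))
  comm i j h _ := Commute.inv_inv (gen_comm h)

theorem closure_genInv (n : ℕ) : Subgroup.closure (genInv (n + 1) '' {j | j < n}) = ⊤ := by
  rw [eq_top_iff, ← closure_gen, Subgroup.closure_le]
  rintro _ ⟨j, hj, rfl⟩
  rw [SetLike.mem_coe, ← inv_mem_iff]
  exact Subgroup.subset_closure ⟨j, Nat.lt_of_succ_lt_succ hj, rfl⟩

theorem initSubgroup_genInv_le_range (n : ℕ) :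
    initSubgroup (genInv (n + 1)) n ≤ (inclBraid n).range := by
  rw [initSubgroup, Subgroup.closure_le]
  rintro _ ⟨j, hj, rfl⟩
  exact ⟨(gen n j)⁻¹, by rw [map_inv, inclBraid_gen hj]; rfl⟩

theorem toPerm_genInv {n j : ℕ} (h : j + 1 < n) : toPerm n (genInv n j) = adj n j := by
  rw [genInv, map_inv, toPerm_gen h, adj_inv]

theorem toPerm_strandChain_last {n p : ℕ} (hp : p ≤ n) :
    (toPerm (n + 1) (strandChain (genInv (n + 1)) n p) (Fin.last n) : ℕ) = p := by
  induction hp using Nat.decreasingInduction with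
  | self => simp [strandChain_self]
  | of_succ p hp ih =>
    rw [strandChain_of_lt _ hp, map_mul, toPerm_genInv (by omega), Equiv.Perm.mul_apply,
      adj_val (by omega), ih]
    simp

theorem combSubgroup_genInv_le_ker_toPerm (n : ℕ) :
    combSubgroup (genInv (n + 1)) n ≤ (toPerm (n + 1)).ker := by
  rw [combSubgroup, Subgroup.closure_le]
  rintro _ ⟨i, hi, rfl⟩
  have hsq : adj (n + 1) i * adj (n + 1) i = 1 := mul_eq_one_iff_eq_inv.2 (adj_inv _ _).symm
  simp [pureGen, toPerm_genInv (Nat.succ_lt_succ hi), hsq]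

theorem toPerm_inclBraid_last {n : ℕ} (β : BraidGroup n) :
    toPerm (n + 1) (inclBraid n β) (Fin.last n) = Fin.last n := by
  induction β using braid_induction with
  | one => simp
  | of_gen j hj =>
    ext
    rw [inclBraid_gen hj, toPerm_gen (by omega), adj_val (by omega)]
    simp only [Fin.val_last]
    split_ifs <;> omega
  | mul β γ hβ hγ => rw [map_mul, map_mul, Equiv.Perm.mul_apply, hγ, hβ]
  | inv β hβ => rw [map_inv, map_inv, Equiv.Perm.inv_eq_iff_eq, hβ]

theorem exists_eq_inclBraid_mul {n : ℕ} {β : BraidGroup (n + 1)}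
    (hβ : toPerm (n + 1) β (Fin.last n) = Fin.last n) :
    ∃ γ, ∃ u ∈ combSubgroup (genInv (n + 1)) n, β = inclBraid n γ * u := by
  have hmem : β ∈ Subgroup.closure (genInv (n + 1) '' {j | j < n}) := by
    rw [closure_genInv]; exact Subgroup.mem_top β
  obtain ⟨p, hp, h, hh, u, hu, rfl⟩ := (braidRelations_genInv n).exists_comb hmem
  obtain ⟨γ, rfl⟩ := initSubgroup_genInv_le_range n hh
  have hpn : p = n := by
    rw [← toPerm_strandChain_last hp]
    simpa only [map_mul, Equiv.Perm.mul_apply, Equiv.Perm.one_apply, Fin.val_last,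
      toPerm_inclBraid_last, MonoidHom.mem_ker.1 (combSubgroup_genInv_le_ker_toPerm n hu)]
      using congrArg Fin.val hβ
  exact ⟨γ, u, hu, by rw [hpn, strandChain_self, one_mul]⟩

section FreeStrands

variable {G : Type*} [Group G]

/-- The base sequence of the first `z.label` strands with a strand `z` inserted in position `p`. -/
def insertStrand (p : ℕ) (z : Strand G) (i : ℕ) : Strand G :=
  if i < p then ⟨1, i⟩ else if i = p then z else if i ≤ z.label then ⟨1, i - 1⟩ else ⟨1, i⟩

variable {t : ℕ → G} {n : ℕ}

open Strand

theorem insertStrand_label_one : insertStrand n (⟨1, n⟩ : Strand G) = base G := by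
  funext i
  simp only [insertStrand, base]
  split_ifs <;> first | rfl | (subst i; rfl) | omega

theorem seqAct_genInv_insertStrand (ht : t n = 1) {j : ℕ} (hj : j < n) (g : G) :
    (rack t).seqAct (n + 1) (genInv (n + 1) j) (insertStrand (j + 1) ⟨g, n⟩) =
      insertStrand j ⟨g, n⟩ := by
  rw [genInv, map_inv, AugRack.seqAct_gen _ (by omega)]
  funext i
  rw [AugRack.cross_inv_apply]
  simp only [insertStrand, rack_deg]
  obtain h | rfl | rfl | h : i < j ∨ i = j ∨ i = j + 1 ∨ j + 1 < i := by omega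
  · simp [h, h.ne, show i ≠ j + 1 by omega, show i < j + 1 by omega]
  · simp
  · simp [ht, Nat.succ_le_iff.2 hj]
  · simp [h.ne', h.not_gt, show i ≠ j by omega, show ¬ i < j by omega]

theorem seqAct_strandChain_insertStrand (ht : t n = 1) {p : ℕ} (hp : p ≤ n) (g : G) :
    (rack t).seqAct (n + 1) (strandChain (genInv (n + 1)) n p) (insertStrand n ⟨g, n⟩) =
      insertStrand p ⟨g, n⟩ := by
  induction hp using Nat.decreasingInduction with
  | self => simp [strandChain_self]
  | of_succ p hp ih =>
    rw [strandChain_of_lt _ hp, map_mul, Equiv.Perm.mul_apply, ih,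
      seqAct_genInv_insertStrand ht hp]

theorem seqAct_genInv_insertStrand_self {i : ℕ} (hi : i < n) (g : G) :
    (rack t).seqAct (n + 1) (genInv (n + 1) i) (insertStrand i ⟨g, n⟩) =
      insertStrand (i + 1) ⟨(t i)⁻¹ * g, n⟩ := by
  rw [genInv, map_inv, AugRack.seqAct_gen _ (by omega)]
  funext l
  rw [AugRack.cross_inv_apply]
  obtain h | rfl | rfl | h : l < i ∨ l = i ∨ l = i + 1 ∨ i + 1 < l := by omega
  · simp [insertStrand, h, h.ne, show l ≠ i + 1 by omega, show l < i + 1 by omega]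
  · simp [insertStrand, Nat.succ_le_iff.2 hi]
  · ext <;> simp [insertStrand, rack_deg, Nat.succ_le_iff.2 hi]
  · simp [insertStrand, h.ne', h.not_gt, show l ≠ i by omega, show ¬ l < i by omega]

theorem seqAct_pureGen_insertStrand (ht : t n = 1) {i : ℕ} (hi : i < n) (g : G) :
    (rack t).seqAct (n + 1) (pureGen (genInv (n + 1)) n i) (insertStrand n ⟨g, n⟩) =
      insertStrand n ⟨(t i)⁻¹ * g, n⟩ := by
  rw [pureGen, map_mul, map_mul, map_inv, Equiv.Perm.mul_apply, Equiv.Perm.mul_apply,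
    Equiv.Perm.inv_eq_iff_eq, seqAct_strandChain_insertStrand ht hi,
    seqAct_strandChain_insertStrand ht hi, map_mul, Equiv.Perm.mul_apply,
    seqAct_genInv_insertStrand ht hi, seqAct_genInv_insertStrand_self hi]

theorem exists_seqAct_insertStrand {Q : Type*} [Group Q] {φ : BraidGroup (n + 1) →* Q}
    {f : G →* Q} (ht : t n = 1) (hf : ∀ i < n, f (t i) = (φ (pureGen (genInv (n + 1)) n i))⁻¹)
    {u : BraidGroup (n + 1)} (hu : u ∈ combSubgroup (genInv (n + 1)) n) :
    ∃ c, f c = φ u ∧ ∀ g,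
      (rack t).seqAct (n + 1) u (insertStrand n ⟨g, n⟩) = insertStrand n ⟨c * g, n⟩ := by
  induction hu using Subgroup.closure_induction with
  | mem x hx =>
    obtain ⟨i, hi, rfl⟩ := hx
    exact ⟨(t i)⁻¹, by simp [hf i hi], seqAct_pureGen_insertStrand ht hi⟩
  | one => exact ⟨1, by simp, by simp⟩
  | mul x y _ _ hx hy =>
    obtain ⟨c, hc, hx⟩ := hx
    obtain ⟨d, hd, hy⟩ := hy
    refine ⟨c * d, by simp [hc, hd], fun g => ?_⟩
    rw [map_mul, Equiv.Perm.mul_apply, hy, hx, mul_assoc]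
  | inv x _ hx =>
    obtain ⟨c, hc, hx⟩ := hx
    refine ⟨c⁻¹, by simp [hc], fun g => ?_⟩
    rw [map_inv, Equiv.Perm.inv_eq_iff_eq, hx, mul_inv_cancel_left]

theorem seqAct_base_of_map {G' : Type*} [Group G'] {t' : ℕ → G'} {f : G →* G'}
    (hf : ∀ i, f (t i) = t' i) {β : BraidGroup n}
    (hβ : (rack t).seqAct n β (base G) = base G) :
    (rack t').seqAct n β (base G') = base G' := by
  have hmap := (rack t).seqAct_map (rack t') (f := fun z => ⟨f z.val, z.label⟩)
    (fun y z => by ext <;> simp [rack_deg, hf]) β (base G)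
  have hbase : (fun z : Strand G => (⟨f z.val, z.label⟩ : Strand G')) ∘ base G = base G' := by
    funext i; simp [base]
  rwa [hβ, hbase] at hmap

/-- `B_{n+1}` acts on `n` strands of degrees `t i` and a last strand of degree `1`. The subgroup on
which only the last strand moves acts on it by left multiplication, the generator around the strand
`i` by `(t i)⁻¹`; so enlarging `t i` by the component `(φ (pureGen s n i))⁻¹` detects `φ` on it. -/
theorem exists_detecting_rack (n : ℕ) {Q : Type v} [Group Q] (φ : BraidGroup n →* Q) :
    ∃ (G : Type v) (_ : Group G) (t : ℕ → G), (Finite Q → Finite G) ∧ (∀ i ≥ n, t i = 1) ∧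
      ∀ β, (rack t).seqAct n β (base G) = base G → φ β = 1 := by
  induction n with
  | zero =>
    refine ⟨Q, inferInstance, fun _ => 1, id, fun _ _ => rfl, fun β _ => ?_⟩
    have := braidGroup_subsingleton (n := 0) (by omega)
    rw [Subsingleton.elim β 1, map_one]
  | succ n ih =>
    obtain ⟨G, _, t, hfin, ht, hdet⟩ := ih (φ.comp (inclBraid n))
    let t' : ℕ → G × Q := fun i =>
      if i < n then (t i, (φ (pureGen (genInv (n + 1)) n i))⁻¹) else 1
    have ht'_of_le : ∀ i ≥ n, t' i = 1 := fun i hi => if_neg hi.not_gt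
    have ht'_fst : ∀ i, MonoidHom.fst G Q (t' i) = t i := fun i => by
      obtain hi | hi := lt_or_ge i n
      · simp [t', hi]
      · simp [ht'_of_le i hi, ht i hi]
    have ht'_snd : ∀ i < n, MonoidHom.snd G Q (t' i) = (φ (pureGen (genInv (n + 1)) n i))⁻¹ :=
      fun i hi => by simp [t', hi]
    refine ⟨G × Q, inferInstance, t', fun h => have := hfin h; inferInstance,
      fun i hi => ht'_of_le i (by omega), fun β hβ => ?_⟩
    obtain ⟨γ, u, hu, rfl⟩ := exists_eq_inclBraid_mul (β := β) (by
      rw [toPerm_eq_one _ hβ, Equiv.Perm.one_apply])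
    obtain ⟨c, hc, hact⟩ := exists_seqAct_insertStrand (ht'_of_le n le_rfl) ht'_snd hu
    rw [map_mul, Equiv.Perm.mul_apply, ← insertStrand_label_one (n := n), hact, mul_one,
      AugRack.seqAct_inclBraid] at hβ
    obtain rfl : c = 1 := by
      have hlast := congrFun hβ n
      rw [AugRack.seqAct_of_le _ _ _ le_rfl] at hlast
      simpa [insertStrand] using hlast
    rw [insertStrand_label_one] at hβ
    rw [map_mul, ← hc, map_one, mul_one]
    exact hdet γ (seqAct_base_of_map ht'_fst hβ)

theorem seqAct_eq_self_of_base {Y : Type*} [MulAction G Y] (R : AugRack G Y) {w : ℕ → Y}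
    (ht : ∀ i, t i = R.deg (w i)) {β : BraidGroup n}
    (hβ : (rack t).seqAct n β (base G) = base G) : R.seqAct n β w = w := by
  have hmap := (rack t).seqAct_map R (f := fun z => z.val • w z.label)
    (fun y z => by simp only [rack_deg, smul_val, smul_label, ht, R.deg_smul, mul_smul]) β (base G)
  rw [hβ] at hmap
  simpa [Function.comp_def, base] using hmap

/-- The braids which fix the base sequence of free strands. -/
def baseStabilizer (n : ℕ) (t : ℕ → G) : Subgroup (BraidGroup n) :=
  (MulAction.stabilizer (Equiv.Perm (ℕ → Strand G)) (base G)).comap ((rack t).seqAct n)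

theorem mem_baseStabilizer {β : BraidGroup n} :
    β ∈ baseStabilizer n t ↔ (rack t).seqAct n β (base G) = base G := Iff.rfl

theorem seqAct_base_label (β : BraidGroup n) (i : Fin n) :
    ((rack t).seqAct n β (base G) i).label = (toPerm n β)⁻¹ i := by
  obtain ⟨j, rfl⟩ := (toPerm n β).surjective i
  rw [← Equiv.Perm.mul_apply, inv_mul_cancel, (rack t).seqAct_label (f := label) (by simp)]
  rfl

theorem finiteIndex_baseStabilizer [Finite G] (n : ℕ) (t : ℕ → G) :
    (baseStabilizer n t).FiniteIndex := by
  let f : BraidGroup n → Equiv.Perm (Fin n) × (Fin n → G) := fun β =>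
    (toPerm n β, fun i => ((rack t).seqAct n β (base G) i).val)
  have hf : ∀ β γ, f β = f γ → β⁻¹ * γ ∈ baseStabilizer n t := by
    intro β γ h
    obtain ⟨hperm, hval⟩ := Prod.ext_iff.1 h
    rw [mem_baseStabilizer, map_mul, map_inv, Equiv.Perm.mul_apply, Equiv.Perm.inv_eq_iff_eq]
    funext i
    obtain hi | hi := lt_or_ge i n
    · lift i to Fin n using hi
      refine Strand.ext (congrFun hval i).symm ?_
      rw [seqAct_base_label, seqAct_base_label, show toPerm n β = toPerm n γ from hperm]
    · rw [AugRack.seqAct_of_le _ _ _ hi, AugRack.seqAct_of_le _ _ _ hi]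
  have : Finite (BraidGroup n ⧸ baseStabilizer n t) := by
    refine Finite.of_injective (fun q => f q.out) fun q r h => ?_
    rw [← q.out_eq', ← r.out_eq']
    exact QuotientGroup.eq.2 (hf _ _ h)
  exact Subgroup.finiteIndex_of_finite_quotient

theorem exists_finiteIndex_seqAct_eq_self (n : ℕ) (G : Type*) [Group G] [Finite G] :
    ∃ K : Subgroup (BraidGroup n), K.FiniteIndex ∧ ∀ β ∈ K,
      ∀ (Y : Type v) [MulAction G Y] (R : AugRack G Y) (w : ℕ → Y), (∀ i ≥ n, R.deg (w i) = 1) →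
        R.seqAct n β w = w := by
  refine ⟨⨅ t : Fin n → G, baseStabilizer n (Function.extend Fin.val t 1),
    Subgroup.finiteIndex_iInf fun t => finiteIndex_baseStabilizer n _, ?_⟩
  intro β hβ Y _ R w hw
  have hfix := Subgroup.mem_iInf.1 hβ fun i => R.deg (w i)
  refine seqAct_eq_self_of_base R (fun i => ?_) (mem_baseStabilizer.1 hfix)
  obtain hi | hi := lt_or_ge i n
  · exact Fin.val_injective.extend_apply _ _ (⟨i, hi⟩ : Fin n)
  · rw [hw i hi, Function.extend_apply' _ _ _ (by rintro ⟨j, rfl⟩; exact hi.not_gt j.2),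
      Pi.one_apply]

end FreeStrands

/-! ### The braided Hopf algebra of words in an augmented rack -/

section Words

variable {G X : Type*} [Group G] [MulAction G X]

instance : MulDistribMulAction G (FreeMonoid X) where
  smul g w := FreeMonoid.map (g • ·) w
  one_smul w := by
    change FreeMonoid.map _ w = w
    simp only [one_smul]
    exact DFunLike.congr_fun FreeMonoid.map_id w
  mul_smul g h w := by
    change FreeMonoid.map _ w = FreeMonoid.map _ (FreeMonoid.map _ w)
    simp [FreeMonoid.map_map, Function.comp_def, mul_smul]
  smul_mul g a b := map_mul (FreeMonoid.map _) a b
  smul_one g := map_one (FreeMonoid.map _)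

@[simp] theorem smul_of (g : G) (x : X) : g • FreeMonoid.of x = FreeMonoid.of (g • x) :=
  FreeMonoid.map_of _ x

namespace AugRack

variable (R : AugRack G X)

/-- The degree of a word is the product of the degrees of its letters. -/
def degHom : FreeMonoid X →* G := FreeMonoid.lift R.deg

@[simp] theorem degHom_of (x : X) : R.degHom (FreeMonoid.of x) = R.deg x := by simp [degHom]

@[simp] theorem degHom_smul (g : G) (w : FreeMonoid X) :
    R.degHom (g • w) = g * R.degHom w * g⁻¹ := by
  induction w using FreeMonoid.inductionOn' with
  | one => simp
  | of_mul x w ih => simp [smul_mul', ih, R.deg_smul, mul_assoc]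

/-- The augmented rack of words, with the diagonal action. -/
def words : AugRack G (FreeMonoid X) where
  deg := R.degHom
  deg_smul := R.degHom_smul

end AugRack

/-- The tensor algebra on the vector space with basis an augmented rack, with its basis of words. -/
def WordAlg (k : Type*) [Field k] (_ : AugRack G X) : Type _ := MonoidAlgebra k (FreeMonoid X)

namespace WordAlg

variable {k : Type*} [Field k] {R : AugRack G X}

noncomputable instance : Ring (WordAlg k R) := inferInstanceAs (Ring (MonoidAlgebra k _))
noncomputable instance : Algebra k (WordAlg k R) := inferInstanceAs (Algebra k (MonoidAlgebra k _))

variable (k R) in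
/-- The basis of `WordAlg k R` given by the words. -/
noncomputable def wordBasis : Module.Basis (FreeMonoid X) k (WordAlg k R) := MonoidAlgebra.basis _ k

variable (k R) in
/-- The monomial of a word; as a homomorphism of monoids, it sends concatenation to the product. -/
noncomputable def word : FreeMonoid X →* WordAlg k R := MonoidAlgebra.of k _

theorem wordBasis_apply (w : FreeMonoid X) : wordBasis k R w = word k R w := rfl

section

variable {M : Type*} [AddCommMonoid M] [Module k M]

/-- The linear extension of a function on words. -/
noncomputable def lin (f : FreeMonoid X → M) : WordAlg k R →ₗ[k] M := (wordBasis k R).constr k f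

@[simp] theorem lin_word (f : FreeMonoid X → M) (w : FreeMonoid X) :
    lin (R := R) f (word k R w) = f w := by
  rw [← wordBasis_apply]; simp [lin]

theorem hom_ext {f g : WordAlg k R →ₗ[k] M} (h : ∀ w, f (word k R w) = g (word k R w)) : f = g :=
  (wordBasis k R).ext h

theorem hom_ext_of_mul {f g : WordAlg k R →ₗ[k] M} (one : f 1 = g 1)
    (of_mul : ∀ x a, f a = g a → f (word k R (.of x) * a) = g (word k R (.of x) * a)) :
    f = g :=
  hom_ext fun w => by
    induction w using FreeMonoid.inductionOn' with
    | one => simpa only [map_one] using one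
    | of_mul x w ih => simpa only [map_mul] using of_mul x _ ih

theorem hom_ext₂ {f g : WordAlg k R ⊗[k] WordAlg k R →ₗ[k] M}
    (h : ∀ v w, f (word k R v ⊗ₜ word k R w) = g (word k R v ⊗ₜ word k R w)) : f = g :=
  TensorProduct.ext (hom_ext fun v => hom_ext fun w => h v w)

theorem hom_ext₃ {f g : (WordAlg k R ⊗[k] WordAlg k R) ⊗[k] WordAlg k R →ₗ[k] M}
    (h : ∀ u v w, f ((word k R u ⊗ₜ word k R v) ⊗ₜ word k R w) =
      g ((word k R u ⊗ₜ word k R v) ⊗ₜ word k R w)) : f = g :=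
  TensorProduct.ext (hom_ext₂ fun u v => hom_ext fun w => h u v w)

end

/-- The action of the group on words, by algebra maps. -/
noncomputable def act (g : G) : WordAlg k R →ₐ[k] WordAlg k R :=
  MonoidAlgebra.mapDomainAlgHom k k (MulDistribMulAction.toMonoidHom (FreeMonoid X) g)

@[simp] theorem act_word (g : G) (w : FreeMonoid X) :
    act g (word k R w) = word k R (g • w) := by
  change MonoidAlgebra.mapDomainAlgHom k k _ (MonoidAlgebra.of k _ w) = MonoidAlgebra.of k _ _
  simp

variable (k R) in
/-- The braiding `v ⊗ w ↦ |v| w ⊗ v`. -/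
noncomputable def braidMap : WordAlg k R ⊗[k] WordAlg k R →ₗ[k] WordAlg k R ⊗[k] WordAlg k R :=
  TensorProduct.lift (lin fun v => lin fun w => word k R (R.degHom v • w) ⊗ₜ word k R v)

@[simp] theorem braidMap_word (v w : FreeMonoid X) :
    braidMap k R (word k R v ⊗ₜ word k R w) = word k R (R.degHom v • w) ⊗ₜ word k R v := by
  simp [braidMap]

variable (k R) in
/-- The inverse braiding. -/
noncomputable def braidInv : WordAlg k R ⊗[k] WordAlg k R →ₗ[k] WordAlg k R ⊗[k] WordAlg k R :=
  TensorProduct.lift (lin fun v => lin fun w => word k R w ⊗ₜ word k R ((R.degHom w)⁻¹ • v))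

@[simp] theorem braidInv_word (v w : FreeMonoid X) :
    braidInv k R (word k R v ⊗ₜ word k R w) = word k R w ⊗ₜ word k R ((R.degHom w)⁻¹ • v) := by
  simp [braidInv]

variable (k R) in
/-- The braiding of the algebra of words. -/
noncomputable def braiding : Braiding k (WordAlg k R) where
  σ := LinearEquiv.ofLinearMap (braidMap k R) (braidInv k R)
    (hom_ext₂ fun v w => by simp) (hom_ext₂ fun v w => by simp)
  braid_eq := by
    apply hom_ext₃
    intro u v w
    simp [applyRight, smul_smul]

@[simp] theorem braiding_word (v w : FreeMonoid X) :
    (braiding k R).σ (word k R v ⊗ₜ word k R w) = word k R (R.degHom v • w) ⊗ₜ word k R v :=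
  braidMap_word v w

variable (k R) in
/-- Multiplication by `x ⊗ 1 + 1 ⊗ x` from the left, in the braided tensor square. -/
noncomputable def comulOp (x : X) : Module.End k (WordAlg k R ⊗[k] WordAlg k R) :=
  (LinearMap.mulLeft k (word k R (.of x))).rTensor _ +
    TensorProduct.map (act (R.deg x)).toLinearMap (LinearMap.mulLeft k (word k R (.of x)))

@[simp] theorem comulOp_tmul (x : X) (a b : WordAlg k R) : comulOp k R x (a ⊗ₜ b) =
    (word k R (.of x) * a) ⊗ₜ b + act (R.deg x) a ⊗ₜ (word k R (.of x) * b) := by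
  simp [comulOp]

variable (k R) in
/-- The comultiplication for which the letters are primitive. -/
noncomputable def comulMap : WordAlg k R →ₗ[k] WordAlg k R ⊗[k] WordAlg k R :=
  lin fun w => FreeMonoid.lift (comulOp k R) w (1 ⊗ₜ 1)

@[simp] theorem comulMap_one : comulMap k R 1 = 1 ⊗ₜ 1 := by
  rw [← map_one (word k R), comulMap, lin_word, map_one, Module.End.one_apply]
  simp only [map_one]

theorem comulMap_of_mul (x : X) (a : WordAlg k R) :
    comulMap k R (word k R (.of x) * a) = comulOp k R x (comulMap k R a) := by
  have hcomp : comulMap k R ∘ₗ LinearMap.mulLeft k (word k R (.of x)) =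
      comulOp k R x ∘ₗ comulMap k R := hom_ext fun w => by
    rw [LinearMap.comp_apply, LinearMap.comp_apply, LinearMap.mulLeft_apply, ← map_mul (word k R),
      comulMap, lin_word, lin_word, map_mul, Module.End.mul_apply, FreeMonoid.lift_eval_of]
  exact LinearMap.congr_fun hcomp a

variable (k R) in
/-- The counit, which kills the letters. -/
noncomputable def counitMap : WordAlg k R →ₐ[k] k :=
  MonoidAlgebra.lift k k _ (FreeMonoid.lift fun _ => 0)

@[simp] theorem counitMap_of (x : X) : counitMap k R (word k R (.of x)) = 0 := by
  change MonoidAlgebra.lift k k _ _ (MonoidAlgebra.of k _ _) = 0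
  rw [MonoidAlgebra.lift_of, FreeMonoid.lift_eval_of]

theorem counitMap_act (g : G) (a : WordAlg k R) :
    counitMap k R (act g a) = counitMap k R a := by
  have hcomp : (counitMap k R).toLinearMap ∘ₗ (act g).toLinearMap = (counitMap k R).toLinearMap :=
    hom_ext_of_mul (by simp) fun x a _ => by simp
  exact LinearMap.congr_fun hcomp a

theorem comulOp_smul_map_act (g : G) (x : X) (t : WordAlg k R ⊗[k] WordAlg k R) :
    comulOp k R (g • x) (TensorProduct.map (act g).toLinearMap (act g).toLinearMap t) =
      TensorProduct.map (act g).toLinearMap (act g).toLinearMap (comulOp k R x t) := by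
  refine LinearMap.congr_fun (f := comulOp k R (g • x) ∘ₗ TensorProduct.map _ _)
    (g := TensorProduct.map _ _ ∘ₗ comulOp k R x) (hom_ext₂ fun v w => ?_) t
  simp [← map_mul, smul_smul, R.deg_smul, smul_mul']

theorem comulMap_act (g : G) (a : WordAlg k R) : comulMap k R (act g a) =
    TensorProduct.map (act g).toLinearMap (act g).toLinearMap (comulMap k R a) := by
  have hcomp : comulMap k R ∘ₗ (act g).toLinearMap =
      TensorProduct.map (act g).toLinearMap (act g).toLinearMap ∘ₗ comulMap k R :=
    hom_ext_of_mul (by simp) fun x a ih => by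
      simp only [LinearMap.comp_apply, AlgHom.toLinearMap_apply] at ih ⊢
      rw [map_mul, act_word, smul_of, comulMap_of_mul, ih, comulOp_smul_map_act, comulMap_of_mul]
  exact LinearMap.congr_fun hcomp a

variable (k R) in
/-- The operator on the triple tensor product by which a letter contributes to the iterated
comultiplication. -/
noncomputable def comulOp₃ (x : X) :
    Module.End k (WordAlg k R ⊗[k] (WordAlg k R ⊗[k] WordAlg k R)) :=
  (LinearMap.mulLeft k (word k R (.of x))).rTensor _ +
    TensorProduct.map (act (R.deg x)).toLinearMap (comulOp k R x)

theorem lTensor_comulMap_comulOp (x : X) (t : WordAlg k R ⊗[k] WordAlg k R) :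
    (comulMap k R).lTensor (WordAlg k R) (comulOp k R x t) =
      comulOp₃ k R x ((comulMap k R).lTensor (WordAlg k R) t) := by
  induction t with
  | zero => simp
  | add s t hs ht => simp [hs, ht]
  | tmul a b => simp [comulOp₃, comulMap_of_mul]

theorem assoc_rTensor_comulMap_comulOp (x : X) (t : WordAlg k R ⊗[k] WordAlg k R) :
    TensorProduct.assoc k _ _ _ ((comulMap k R).rTensor (WordAlg k R) (comulOp k R x t)) =
      comulOp₃ k R x
        (TensorProduct.assoc k _ _ _ ((comulMap k R).rTensor (WordAlg k R) t)) := by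
  induction t with
  | zero => simp
  | add s t hs ht => simp [hs, ht]
  | tmul a b =>
    simp only [comulOp_tmul, map_add, LinearMap.rTensor_tmul, comulMap_of_mul, comulMap_act]
    induction comulMap k R a with
    | zero => simp
    | add s t hs ht =>
      simp only [map_add, TensorProduct.add_tmul, ← hs, ← ht]
      abel
    | tmul c d => simp [comulOp₃, TensorProduct.add_tmul, TensorProduct.tmul_add, add_assoc]

theorem comulMap_coassoc :
    (TensorProduct.assoc k (WordAlg k R) (WordAlg k R) (WordAlg k R)).toLinearMap ∘ₗ
      (comulMap k R).rTensor (WordAlg k R) ∘ₗ comulMap k R =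
    (comulMap k R).lTensor (WordAlg k R) ∘ₗ comulMap k R :=
  hom_ext_of_mul (by simp) fun x a ih => by
    simp only [LinearMap.comp_apply, LinearEquiv.coe_coe] at ih ⊢
    rw [comulMap_of_mul, lTensor_comulMap_comulOp, assoc_rTensor_comulMap_comulOp, ih]

theorem rTensor_counitMap_comulOp (x : X) (t : WordAlg k R ⊗[k] WordAlg k R) :
    (counitMap k R).toLinearMap.rTensor (WordAlg k R) (comulOp k R x t) =
      (LinearMap.mulLeft k (word k R (.of x))).lTensor k
        ((counitMap k R).toLinearMap.rTensor (WordAlg k R) t) := by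
  induction t with
  | zero => simp
  | add s t hs ht => simp [hs, ht]
  | tmul a b => simp [counitMap_act]

theorem lTensor_counitMap_comulOp (x : X) (t : WordAlg k R ⊗[k] WordAlg k R) :
    (counitMap k R).toLinearMap.lTensor (WordAlg k R) (comulOp k R x t) =
      (LinearMap.mulLeft k (word k R (.of x))).rTensor k
        ((counitMap k R).toLinearMap.lTensor (WordAlg k R) t) := by
  induction t with
  | zero => simp
  | add s t hs ht => simp [hs, ht]
  | tmul a b => simp

noncomputable instance : Coalgebra k (WordAlg k R) where
  comul := comulMap k R
  counit := (counitMap k R).toLinearMap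
  coassoc := comulMap_coassoc
  rTensor_counit_comp_comul := hom_ext_of_mul (by simp) fun x a ih => by
    rw [LinearMap.comp_apply] at ih ⊢
    rw [comulMap_of_mul, rTensor_counitMap_comulOp, ih]
    simp
  lTensor_counit_comp_comul := hom_ext_of_mul (by simp) fun x a ih => by
    rw [LinearMap.comp_apply] at ih ⊢
    rw [comulMap_of_mul, lTensor_counitMap_comulOp, ih]
    simp

theorem comul_eq : Coalgebra.comul (R := k) (A := WordAlg k R) = comulMap k R := rfl

theorem counit_eq : Coalgebra.counit (R := k) (A := WordAlg k R) = (counitMap k R).toLinearMap :=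
  rfl

theorem isPrimitive_of (x : X) : IsPrimitive k (word k R (.of x)) := by
  rw [IsPrimitive, comul_eq, ← mul_one (word k R (.of x)), comulMap_of_mul, comulMap_one]
  simp

variable (k R) in
/-- The antipode: a letter `x` acts by `a ↦ -(|x| a) x`. -/
noncomputable def antipodeMap : WordAlg k R →ₗ[k] WordAlg k R :=
  lin fun w => FreeMonoid.lift (M := Module.End k (WordAlg k R)) (fun x =>
    -(LinearMap.mulRight k (word k R (.of x)) ∘ₗ (act (R.deg x)).toLinearMap)) w 1

@[simp] theorem antipodeMap_one : antipodeMap k R 1 = 1 := by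
  rw [← map_one (word k R), antipodeMap, lin_word, map_one (FreeMonoid.lift _),
    Module.End.one_apply, map_one]

theorem antipodeMap_of_mul (x : X) (a : WordAlg k R) : antipodeMap k R (word k R (.of x) * a) =
    -(act (R.deg x) (antipodeMap k R a) * word k R (.of x)) := by
  have hcomp : antipodeMap k R ∘ₗ LinearMap.mulLeft k (word k R (.of x)) =
      -(LinearMap.mulRight k (word k R (.of x)) ∘ₗ (act (R.deg x)).toLinearMap) ∘ₗ
        antipodeMap k R := hom_ext fun w => by
    rw [LinearMap.comp_apply, LinearMap.neg_apply, LinearMap.comp_apply, LinearMap.mulLeft_apply,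
      ← map_mul (word k R), antipodeMap, lin_word, lin_word, map_mul (FreeMonoid.lift _),
      Module.End.mul_apply, FreeMonoid.lift_eval_of]
    rfl
  exact LinearMap.congr_fun hcomp a

theorem act_act (g h : G) (a : WordAlg k R) : act g (act h a) = act (g * h) a := by
  have hcomp : (act g).toLinearMap ∘ₗ (act h).toLinearMap =
      (act (k := k) (R := R) (g * h)).toLinearMap := hom_ext fun w => by simp [mul_smul]
  exact LinearMap.congr_fun hcomp a

theorem antipodeMap_act (g : G) (a : WordAlg k R) :
    antipodeMap k R (act g a) = act g (antipodeMap k R a) := by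
  have hcomp : antipodeMap k R ∘ₗ (act g).toLinearMap = (act g).toLinearMap ∘ₗ antipodeMap k R :=
    hom_ext_of_mul (by simp) fun x a ih => by
      simp only [LinearMap.comp_apply, AlgHom.toLinearMap_apply] at ih ⊢
      rw [map_mul, act_word, smul_of, antipodeMap_of_mul, ih, antipodeMap_of_mul, map_neg, map_mul,
        act_word, smul_of, act_act, act_act, R.deg_smul, inv_mul_cancel_right]
  exact LinearMap.congr_fun hcomp a

theorem mul_rTensor_antipodeMap_comulOp (x : X) (t : WordAlg k R ⊗[k] WordAlg k R) :
    LinearMap.mul' k _ ((antipodeMap k R).rTensor (WordAlg k R) (comulOp k R x t)) = 0 := by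
  induction t with
  | zero => simp
  | add s t hs ht => simp [hs, ht]
  | tmul a b => simp [antipodeMap_of_mul, antipodeMap_act, mul_assoc]

theorem mul_lTensor_antipodeMap_comulOp (x : X) (t : WordAlg k R ⊗[k] WordAlg k R) :
    LinearMap.mul' k _ ((antipodeMap k R).lTensor (WordAlg k R) (comulOp k R x t)) =
      word k R (.of x) * LinearMap.mul' k _ ((antipodeMap k R).lTensor (WordAlg k R) t) -
        act (R.deg x) (LinearMap.mul' k _ ((antipodeMap k R).lTensor (WordAlg k R) t)) *
          word k R (.of x) := by
  induction t with
  | zero => simp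
  | add s t hs ht => simp only [map_add, hs, ht, mul_add, add_mul]; abel
  | tmul a b => simp [antipodeMap_of_mul, mul_assoc, sub_eq_add_neg]

theorem mul_rTensor_antipodeMap_comulMap :
    LinearMap.mul' k _ ∘ₗ (antipodeMap k R).rTensor (WordAlg k R) ∘ₗ comulMap k R =
      Algebra.linearMap k _ ∘ₗ (counitMap k R).toLinearMap :=
  hom_ext_of_mul (by simp) fun x a _ => by
    simp [comulMap_of_mul, mul_rTensor_antipodeMap_comulOp]

theorem mul_lTensor_antipodeMap_comulMap :
    LinearMap.mul' k _ ∘ₗ (antipodeMap k R).lTensor (WordAlg k R) ∘ₗ comulMap k R =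
      Algebra.linearMap k _ ∘ₗ (counitMap k R).toLinearMap :=
  hom_ext_of_mul (by simp) fun x a ih => by
    simp only [LinearMap.comp_apply] at ih ⊢
    rw [comulMap_of_mul, mul_lTensor_antipodeMap_comulOp, ih]
    simp [← Algebra.commutes]

variable (k R) in
/-- The braiding of the tensor cube that carries the last factor past the first two. -/
noncomputable def braidOverRight : (WordAlg k R ⊗[k] WordAlg k R) ⊗[k] WordAlg k R →ₗ[k]
    (WordAlg k R ⊗[k] WordAlg k R) ⊗[k] WordAlg k R :=
  (braiding k R).σ.toLinearMap.rTensor (WordAlg k R) ∘ₗ applyRight (braiding k R).σ.toLinearMap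

@[simp] theorem braidOverRight_word (u v w : FreeMonoid X) :
    braidOverRight k R ((word k R u ⊗ₜ word k R v) ⊗ₜ word k R w) =
      (word k R (R.degHom (u * v) • w) ⊗ₜ word k R u) ⊗ₜ word k R v := by
  simp [braidOverRight, applyRight, mul_smul]

theorem braidOverRight_comulOp (x : X) (t : WordAlg k R ⊗[k] WordAlg k R) (w : FreeMonoid X) :
    TensorProduct.assoc k _ _ _ (braidOverRight k R (comulOp k R x t ⊗ₜ word k R w)) =
      TensorProduct.map (act (R.deg x)).toLinearMap (comulOp k R x)
        (TensorProduct.assoc k _ _ _ (braidOverRight k R (t ⊗ₜ word k R w))) := by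
  refine LinearMap.congr_fun
    (f := (TensorProduct.assoc k _ _ _).toLinearMap ∘ₗ braidOverRight k R ∘ₗ
      (TensorProduct.mk k _ _).flip (word k R w) ∘ₗ comulOp k R x)
    (g := TensorProduct.map (act (R.deg x)).toLinearMap (comulOp k R x) ∘ₗ
      (TensorProduct.assoc k _ _ _).toLinearMap ∘ₗ braidOverRight k R ∘ₗ
      (TensorProduct.mk k _ _).flip (word k R w)) (hom_ext₂ fun a b => ?_) t
  simp [TensorProduct.tmul_add, -map_mul, ← map_mul (word k R),
    R.degHom.map_mul, smul_smul, mul_assoc]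

theorem braidOverRight_comulMap (v w : FreeMonoid X) :
    TensorProduct.assoc k _ _ _ (braidOverRight k R (comulMap k R (word k R v) ⊗ₜ word k R w)) =
      word k R (R.degHom v • w) ⊗ₜ comulMap k R (word k R v) := by
  induction v using FreeMonoid.inductionOn' with
  | one =>
    simpa only [map_one, mul_one, comulMap_one, TensorProduct.assoc_tmul] using
      congrArg (TensorProduct.assoc k (WordAlg k R) (WordAlg k R) (WordAlg k R))
        (braidOverRight_word 1 1 w)
  | of_mul x v ih =>
    rw [map_mul (word k R), comulMap_of_mul, braidOverRight_comulOp, ih]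
    simp [mul_smul]

variable (k R) in
/-- The braiding of the tensor cube that carries the first factor past the last two. -/
noncomputable def braidOverLeft : (WordAlg k R ⊗[k] WordAlg k R) ⊗[k] WordAlg k R →ₗ[k]
    (WordAlg k R ⊗[k] WordAlg k R) ⊗[k] WordAlg k R :=
  applyRight (braiding k R).σ.toLinearMap ∘ₗ (braiding k R).σ.toLinearMap.rTensor (WordAlg k R)

theorem braidOverLeft_word_tmul (v : FreeMonoid X) (t : WordAlg k R ⊗[k] WordAlg k R) :
    braidOverLeft k R ((TensorProduct.assoc k _ _ _).symm (word k R v ⊗ₜ t)) =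
      TensorProduct.map (act (R.degHom v)).toLinearMap (act (R.degHom v)).toLinearMap t ⊗ₜ
        word k R v := by
  refine LinearMap.congr_fun
    (f := braidOverLeft k R ∘ₗ (TensorProduct.assoc k _ _ _).symm.toLinearMap ∘ₗ
      TensorProduct.mk k _ _ (word k R v))
    (g := (TensorProduct.mk k _ _).flip (word k R v) ∘ₗ
      TensorProduct.map (act (R.degHom v)).toLinearMap (act (R.degHom v)).toLinearMap)
    (hom_ext₂ fun a b => ?_) t
  simp [braidOverLeft, applyRight]

theorem braidOverLeft_comulMap (v w : FreeMonoid X) :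
    braidOverLeft k R
        ((TensorProduct.assoc k _ _ _).symm (word k R v ⊗ₜ comulMap k R (word k R w))) =
      comulMap k R (word k R (R.degHom v • w)) ⊗ₜ word k R v := by
  rw [braidOverLeft_word_tmul, ← comulMap_act, act_word]

variable (k R) in
/-- The product `(μ ⊗ μ)(id ⊗ σ ⊗ id)` of the braided tensor square. -/
noncomputable def squareMul : (WordAlg k R ⊗[k] WordAlg k R) ⊗[k] (WordAlg k R ⊗[k] WordAlg k R)
    →ₗ[k] WordAlg k R ⊗[k] WordAlg k R :=
  TensorProduct.map (LinearMap.mul' k (WordAlg k R)) (LinearMap.mul' k (WordAlg k R)) ∘ₗ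
    (TensorProduct.assoc k _ _ (WordAlg k R ⊗[k] WordAlg k R)).symm.toLinearMap ∘ₗ
    ((TensorProduct.assoc k _ _ _).toLinearMap ∘ₗ
      (braiding k R).σ.toLinearMap.rTensor (WordAlg k R) ∘ₗ
      (TensorProduct.assoc k _ _ _).symm.toLinearMap).lTensor (WordAlg k R) ∘ₗ
    (TensorProduct.assoc k _ _ (WordAlg k R ⊗[k] WordAlg k R)).toLinearMap

theorem squareMul_word (a b c d : FreeMonoid X) :
    squareMul k R ((word k R a ⊗ₜ word k R b) ⊗ₜ (word k R c ⊗ₜ word k R d)) =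
      word k R (a * R.degHom b • c) ⊗ₜ word k R (b * d) := by
  simp [squareMul]

theorem squareMul_one_tmul (t : WordAlg k R ⊗[k] WordAlg k R) :
    squareMul k R ((1 ⊗ₜ 1) ⊗ₜ t) = t := by
  refine LinearMap.congr_fun (f := squareMul k R ∘ₗ TensorProduct.mk k _ _ (1 ⊗ₜ 1))
    (g := LinearMap.id) (hom_ext₂ fun c d => ?_) t
  simpa using squareMul_word 1 1 c d

theorem squareMul_comulOp_tmul (x : X) (s t : WordAlg k R ⊗[k] WordAlg k R) :
    squareMul k R (comulOp k R x s ⊗ₜ t) = comulOp k R x (squareMul k R (s ⊗ₜ t)) := by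
  have hcomp : squareMul k R ∘ₗ (comulOp k R x).rTensor _ = comulOp k R x ∘ₗ squareMul k R :=
    TensorProduct.ext (hom_ext₂ fun a b => hom_ext₂ fun c d => by
      simp [squareMul_word, TensorProduct.add_tmul, -map_mul, ← map_mul (word k R),
        R.degHom.map_mul, smul_mul', mul_smul, mul_assoc])
  exact LinearMap.congr_fun hcomp (s ⊗ₜ t)

theorem comulMap_mul (a b : WordAlg k R) :
    comulMap k R (a * b) = squareMul k R (comulMap k R a ⊗ₜ comulMap k R b) := by
  refine LinearMap.congr_fun (f := comulMap k R ∘ₗ LinearMap.mulRight k b)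
    (g := squareMul k R ∘ₗ (TensorProduct.mk k _ _).flip (comulMap k R b) ∘ₗ comulMap k R)
    (hom_ext_of_mul (by simp [squareMul_one_tmul]) fun x a ih => ?_) a
  simp only [LinearMap.comp_apply, LinearMap.mulRight_apply, LinearMap.flip_apply,
    TensorProduct.mk_apply] at ih ⊢
  rw [mul_assoc, comulMap_of_mul, ih, comulMap_of_mul, squareMul_comulOp_tmul]

theorem braiding_one_tmul (a : WordAlg k R) : (braiding k R).σ (1 ⊗ₜ a) = a ⊗ₜ 1 := by
  refine LinearMap.congr_fun (f := (braiding k R).σ.toLinearMap ∘ₗ TensorProduct.mk k _ _ 1)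
    (g := (TensorProduct.mk k _ _).flip 1) (hom_ext fun w => ?_) a
  simpa using braiding_word (k := k) (R := R) 1 w

theorem braiding_tmul_one (a : WordAlg k R) : (braiding k R).σ (a ⊗ₜ 1) = 1 ⊗ₜ a := by
  refine LinearMap.congr_fun (f := (braiding k R).σ.toLinearMap ∘ₗ (TensorProduct.mk k _ _).flip 1)
    (g := TensorProduct.mk k _ _ 1) (hom_ext fun w => ?_) a
  simpa using braiding_word (k := k) (R := R) w 1

theorem counitMap_smul_act (v : FreeMonoid X) (a : WordAlg k R) :
    counitMap k R (word k R v) • act (R.degHom v) a = counitMap k R (word k R v) • a := by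
  induction v using FreeMonoid.inductionOn' with
  | one =>
    have hact : (act (k := k) (R := R) (R.degHom 1)).toLinearMap = LinearMap.id :=
      hom_ext fun w => by simp
    exact congrArg (_ • ·) (LinearMap.congr_fun hact a)
  | of_mul x v _ => simp

variable (k R) in
/-- The braided Hopf algebra of words in an augmented rack, in which the letters are primitive. -/
noncomputable def hopf : BraidedHopfAlgebra k (WordAlg k R) where
  toBraiding := braiding k R
  braid_mul_left := hom_ext₃ fun u v w => by
    simp [applyRight, -map_mul, ← map_mul (word k R), map_mul R.degHom, mul_smul]
  braid_mul_right := hom_ext₃ fun u v w => by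
    simp [applyRight, ← map_mul, smul_mul']
  braid_one_left := braiding_one_tmul
  braid_one_right := braiding_tmul_one
  braid_comul_left := hom_ext₂ fun v w => by
    simpa [comul_eq, braidOverRight] using
      congrArg (TensorProduct.assoc k _ _ _).symm (braidOverRight_comulMap v w).symm
  braid_comul_right := hom_ext₂ fun v w => by
    simpa [comul_eq, braidOverLeft] using (braidOverLeft_comulMap v w).symm
  braid_counit_left := hom_ext₂ fun v w => by
    simpa [counit_eq] using counitMap_smul_act v (word k R w)
  braid_counit_right := hom_ext₂ fun v w => by
    simpa [counit_eq] using
      congrArg (· • word k R v) (counitMap_act (R.degHom v) (word k R w))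
  comul_mul := hom_ext₂ fun v w => comulMap_mul (word k R v) (word k R w)
  comul_one := comulMap_one
  counit_mul := map_mul (counitMap k R)
  counit_one := map_one (counitMap k R)
  exists_antipode :=
    ⟨antipodeMap k R, mul_rTensor_antipodeMap_comulMap, mul_lTensor_antipodeMap_comulMap⟩

end WordAlg

end Words

/-! ### A recursion for the elements `𝔖_{p,q}` -/

/-- The inclusion `B_n → B_{n+1}` of the braids which leave the first strand alone. -/
def shiftBraid (n : ℕ) : BraidGroup n →* BraidGroup (n + 1) :=
  braidLift n (fun j => gen (n + 1) (j + 1)) (fun _ _ => gen_braid (by omega))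
    (fun _ _ h _ => gen_comm (by omega))

theorem shiftBraid_gen {n j : ℕ} (h : j + 1 < n) : shiftBraid n (gen n j) = gen (n + 1) (j + 1) :=
  braidLift_gen _ _ _ _ h

section MovePerm

variable {n p : ℕ}

/-- The permutation which sends the first position to `x` and is `τ` on the remaining ones. -/
def movePerm (x : Fin (n + 1)) (τ : Equiv.Perm (Fin n)) : Equiv.Perm (Fin (n + 1)) :=
  x.cycleRange⁻¹ * Equiv.Perm.decomposeFin.symm (0, τ)

theorem movePerm_symm_self (x : Fin (n + 1)) (τ : Equiv.Perm (Fin n)) :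
    (movePerm x τ).symm x = 0 := by
  rw [Equiv.symm_apply_eq, movePerm, Equiv.Perm.mul_apply,
    Equiv.Perm.decomposeFin_symm_apply_zero]
  simp [Equiv.Perm.inv_def]

theorem movePerm_symm_succAbove (x : Fin (n + 1)) (τ : Equiv.Perm (Fin n)) (i : Fin n) :
    (movePerm x τ).symm (x.succAbove i) = (τ.symm i).succ := by
  rw [Equiv.symm_apply_eq, movePerm, Equiv.Perm.mul_apply,
    Equiv.Perm.decomposeFin_symm_apply_succ]
  simp [Equiv.Perm.inv_def]

theorem movePerm_zero (x : Fin (n + 1)) (τ : Equiv.Perm (Fin n)) : movePerm x τ 0 = x := by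
  rw [← movePerm_symm_self x τ, Equiv.apply_symm_apply]

theorem bijective_movePerm :
    Function.Bijective fun xτ : Fin (n + 1) × Equiv.Perm (Fin n) => movePerm xτ.1 xτ.2 := by
  refine (Fintype.bijective_iff_injective_and_card _).2
    ⟨?_, by simp [Fintype.card_perm, Nat.factorial_succ]⟩
  rintro ⟨x, τ⟩ ⟨x', τ'⟩ h
  obtain rfl : x = x' := by
    simpa only [movePerm_zero] using congrArg (fun σ : Equiv.Perm _ => σ 0) h
  exact Prod.ext rfl
    (Prod.ext_iff.1 (Equiv.Perm.decomposeFin.symm.injective (mul_left_cancel h))).2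

theorem sum_movePerm {M : Type*} [AddCommMonoid M] (f : Equiv.Perm (Fin (n + 1)) → M) :
    ∑ σ, f σ = ∑ x, ∑ τ, f (movePerm x τ) := by
  rw [← bijective_movePerm.sum_comp, Fintype.sum_prod_type]

theorem invCount_movePerm_self (x : Fin (n + 1)) (τ : Equiv.Perm (Fin n)) :
    invCount (movePerm x τ) x = x := by
  rw [invCount, ← card_val_lt (n := n + 1) x.2.le]
  congr 1
  ext u
  obtain rfl | ⟨w, rfl⟩ := Fin.eq_self_or_eq_succAbove x u
  · simp
  · simp [movePerm_symm_self, movePerm_symm_succAbove]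

theorem invCount_movePerm_succAbove (x : Fin (n + 1)) (τ : Equiv.Perm (Fin n)) (v : Fin n) :
    invCount (movePerm x τ) (x.succAbove v) = invCount τ v := by
  rw [invCount, invCount, Fin.univ_succAbove n x, Finset.filter_cons_of_neg, Finset.filter_map,
    Finset.card_map]
  · simp [movePerm_symm_succAbove]
  · simp [movePerm_symm_self]

/-- The part of the reduced word of a permutation which belongs to the value `v`. -/
def wordPart (τ : Equiv.Perm (Fin n)) (v : ℕ) : List ℕ :=
  if h : v < n then (List.range (invCount τ ⟨v, h⟩)).map fun t => v - 1 - t else []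

theorem reducedWord_eq_flatMap (τ : Equiv.Perm (Fin n)) :
    reducedWord τ = (List.range n).flatMap (wordPart τ) := by
  rw [← List.map_coe_finRange_eq_range, List.flatMap_map]
  simp [reducedWord, wordPart]

theorem wordPart_val (τ : Equiv.Perm (Fin n)) (v : Fin n) :
    wordPart τ v = (List.range (invCount τ v)).map fun t => (v : ℕ) - 1 - t :=
  dif_pos v.2

theorem wordPart_movePerm_self (x : Fin (n + 1)) (τ : Equiv.Perm (Fin n)) :
    wordPart (movePerm x τ) x = (List.range x).map fun t => (x : ℕ) - 1 - t := by
  rw [wordPart_val, invCount_movePerm_self]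

theorem wordPart_movePerm_of_lt (x : Fin (n + 1)) (τ : Equiv.Perm (Fin n)) {v : ℕ} (hv : v < x) :
    wordPart (movePerm x τ) v = wordPart τ v := by
  have hx : x.succAbove ⟨v, by omega⟩ = ⟨v, by omega⟩ := Fin.succAbove_of_castSucc_lt _ _ hv
  rw [wordPart, wordPart, dif_pos (by omega), dif_pos (by omega), ← hx,
    invCount_movePerm_succAbove]

theorem wordPart_movePerm_succ (x : Fin (n + 1)) (τ : Equiv.Perm (Fin n)) {v : ℕ} (hv : x ≤ v) :
    wordPart (movePerm x τ) (v + 1) = (wordPart τ v).map (· + 1) := by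
  by_cases hvn : v < n
  · have hx : x.succAbove ⟨v, hvn⟩ = ⟨v + 1, by omega⟩ := Fin.succAbove_of_le_castSucc _ _ hv
    rw [wordPart, wordPart, dif_pos (by omega), dif_pos hvn, ← hx, invCount_movePerm_succAbove,
      List.map_map]
    refine List.map_congr_left fun t ht => ?_
    have hle := invCount_le τ ⟨v, hvn⟩
    rw [List.mem_range] at ht
    simp only [Function.comp_apply] at hle ⊢
    omega
  · rw [wordPart, wordPart, dif_neg (by omega), dif_neg hvn, List.map_nil]

theorem reducedWord_movePerm (x : Fin (n + 1)) {τ : Equiv.Perm (Fin n)}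
    (h : ∀ v : Fin n, (v : ℕ) < x → invCount τ v = 0) :
    reducedWord (movePerm x τ) =
      (List.range x).map (fun t => (x : ℕ) - 1 - t) ++ (reducedWord τ).map (· + 1) := by
  obtain ⟨q, hq⟩ := Nat.exists_eq_add_of_le (Nat.lt_succ_iff.1 x.2)
  have hnil : (List.range x).flatMap (wordPart τ) = [] := by
    rw [List.flatMap_eq_nil_iff]
    intro v hv
    rw [List.mem_range] at hv
    rw [wordPart, dif_pos (by omega), h _ hv, List.range_zero, List.map_nil]
  have hnil' : (List.range x).flatMap (wordPart (movePerm x τ)) = [] := by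
    rw [← hnil]
    exact List.flatMap_congr fun v hv => wordPart_movePerm_of_lt x τ (List.mem_range.1 hv)
  have hrange : List.range (n + 1) =
      List.range x ++ [(x : ℕ)] ++ (List.range q).map (fun t => (x : ℕ) + 1 + t) := by
    rw [← List.range_succ, ← List.range_add, Nat.succ_add, ← hq]
  have hrange' : List.range n = List.range x ++ (List.range q).map (fun t => (x : ℕ) + t) := by
    rw [← List.range_add, ← hq]
  rw [reducedWord_eq_flatMap, reducedWord_eq_flatMap, hrange, hrange', List.flatMap_append,
    List.flatMap_append, List.flatMap_append, hnil, hnil', List.nil_append, List.nil_append,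
    List.flatMap_singleton, wordPart_movePerm_self, List.flatMap_map, List.flatMap_map,
    List.map_flatMap]
  refine congrArg _ (List.flatMap_congr fun t _ => ?_)
  rw [add_right_comm, wordPart_movePerm_succ x τ (Nat.le_add_right _ _)]

theorem reducedWord_lt (τ : Equiv.Perm (Fin n)) : ∀ j ∈ reducedWord τ, j + 1 < n := by
  intro j hj
  simp only [reducedWord, List.mem_flatMap, List.mem_map, List.mem_range] at hj
  obtain ⟨v, -, t, ht, rfl⟩ := hj
  have := invCount_le τ v
  omega

theorem matsumotoLift_movePerm (x : Fin (n + 1)) {τ : Equiv.Perm (Fin n)}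
    (h : ∀ v : Fin n, (v : ℕ) < x → invCount τ v = 0) :
    matsumotoLift (movePerm x τ) = fatRight (n + 1) x 0 * shiftBraid n (matsumotoLift τ) := by
  rw [matsumotoLift, reducedWord_movePerm x h, List.map_append, List.prod_append,
    matsumotoLift, map_list_prod, List.map_map, List.map_map, List.map_map, fatRight]
  congr 2
  · exact List.map_congr_left fun t _ => by simp
  · exact List.map_congr_left fun j hj => (shiftBraid_gen (reducedWord_lt τ j hj)).symm

theorem matsumotoLift_one : matsumotoLift (1 : Equiv.Perm (Fin n)) = 1 := by
  have hnil : reducedWord (1 : Equiv.Perm (Fin n)) = [] :=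
    List.eq_nil_of_length_eq_zero (Nat.le_zero.1 (length_reducedWord_le 1 [] rfl))
  simp [matsumotoLift, hnil]

theorem IsUnshuffle.invCount_eq_zero {τ : Equiv.Perm (Fin n)} (h : IsUnshuffle p τ) {v : Fin n}
    (hv : (v : ℕ) < p) : invCount τ v = 0 := by
  rw [invCount, Finset.card_eq_zero, Finset.filter_eq_empty_iff]
  rintro u - ⟨huv, hlt⟩
  exact lt_asymm hlt (h u v huv (Or.inl hv))

theorem isUnshuffle_movePerm_iff {x : Fin (n + 1)} (hx : (x : ℕ) = 0 ∨ (x : ℕ) = p)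
    (τ : Equiv.Perm (Fin n)) : IsUnshuffle p (movePerm x τ) ↔ ∀ i j : Fin n, i < j →
      ((x.succAbove j : ℕ) < p ∨ p ≤ (x.succAbove i : ℕ)) → τ.symm i < τ.symm j := by
  constructor
  · intro h i j hij hp
    simpa only [movePerm_symm_succAbove, Fin.succ_lt_succ_iff] using
      h _ _ (Fin.succAbove_lt_succAbove_iff.2 hij) hp
  · intro h i j hij hp
    obtain rfl | ⟨j, rfl⟩ := Fin.eq_self_or_eq_succAbove x j
    · rw [Fin.lt_def] at hij
      omega
    rw [movePerm_symm_succAbove]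
    obtain rfl | ⟨i, rfl⟩ := Fin.eq_self_or_eq_succAbove x i
    · rw [movePerm_symm_self]
      exact Fin.succ_pos _
    · rw [movePerm_symm_succAbove, Fin.succ_lt_succ_iff]
      exact h i j (Fin.succAbove_lt_succAbove_iff.1 hij) hp

theorem isUnshuffle_movePerm_zero (τ : Equiv.Perm (Fin n)) :
    IsUnshuffle (p + 1) (movePerm 0 τ) ↔ IsUnshuffle p τ := by
  rw [isUnshuffle_movePerm_iff (Or.inl rfl)]
  simp [IsUnshuffle]

theorem isUnshuffle_movePerm_self (x : Fin (n + 1)) (τ : Equiv.Perm (Fin n)) :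
    IsUnshuffle x (movePerm x τ) ↔ IsUnshuffle x τ := by
  have hval (i : Fin n) : (x.succAbove i : ℕ) = if (i : ℕ) < x then (i : ℕ) else i + 1 := by
    rw [Fin.succAbove]
    simp only [Fin.lt_def, Fin.val_castSucc]
    split_ifs <;> rfl
  rw [isUnshuffle_movePerm_iff (Or.inr rfl)]
  refine forall₃_congr fun i j _ => imp_congr_left ?_
  rw [hval, hval]
  split_ifs <;> omega

theorem IsUnshuffle.apply_zero {τ : Equiv.Perm (Fin (n + 1))} (h : IsUnshuffle p τ)
    (h0 : τ 0 ≠ 0) : ((τ 0 : Fin (n + 1)) : ℕ) = p := by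
  by_contra hne
  rcases lt_or_gt_of_ne hne with hlt | hlt
  · simpa using h 0 (τ 0) (Fin.pos_iff_ne_zero.2 h0) (Or.inl hlt)
  · simpa using h ⟨p, by omega⟩ (τ 0) hlt (Or.inr le_rfl)

theorem isUnshuffle_zero_iff {τ : Equiv.Perm (Fin n)} : IsUnshuffle 0 τ ↔ τ = 1 := by
  refine ⟨fun h => ?_, by rintro rfl i j hij -; exact hij⟩
  have hmono : StrictMono τ.symm := fun i j hij => h i j hij (Or.inr (Nat.zero_le _))
  have hid : ⇑τ.symm = id := (StrictMono.range_inj hmono strictMono_id).1 (by simp)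
  rw [← inv_eq_one]
  exact Equiv.ext (congrFun hid)

theorem isUnshuffle_self_iff {τ : Equiv.Perm (Fin n)} : IsUnshuffle n τ ↔ τ = 1 := by
  rw [← isUnshuffle_zero_iff]
  exact forall₃_congr fun i j _ => imp_congr_left (by simp)

end MovePerm

section ShuffleSum

variable (k : Type*) [Field k]

theorem shuffleSum_zero (n : ℕ) : shuffleSum k n 0 = 1 := by
  simp only [shuffleSum, isUnshuffle_zero_iff, Finset.filter_eq', Finset.mem_univ, if_true,
    Finset.sum_singleton, matsumotoLift_one, map_one]

theorem shuffleSum_self (n : ℕ) : shuffleSum k n n = 1 := by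
  simp only [shuffleSum, isUnshuffle_self_iff, Finset.filter_eq', Finset.mem_univ, if_true,
    Finset.sum_singleton, matsumotoLift_one, map_one]

/-- The inclusion of group algebras induced by `shiftBraid`. -/
noncomputable def shiftAlg (n : ℕ) :
    MonoidAlgebra k (BraidGroup n) →ₐ[k] MonoidAlgebra k (BraidGroup (n + 1)) :=
  MonoidAlgebra.mapDomainAlgHom k k (shiftBraid n)

theorem shiftAlg_of {n : ℕ} (β : BraidGroup n) :
    shiftAlg k n (MonoidAlgebra.of k _ β) = MonoidAlgebra.of k _ (shiftBraid n β) := by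
  simp [shiftAlg]

open Classical in
theorem shuffleSum_eq_sum_movePerm (n p : ℕ) : shuffleSum k (n + 1) p =
    ∑ x, ∑ τ with IsUnshuffle p (movePerm x τ), MonoidAlgebra.of k _ (matsumotoLift (movePerm x τ))
    := by
  simp only [shuffleSum, Finset.sum_filter, sum_movePerm]

open Classical in
theorem sum_isUnshuffle_movePerm_zero (n p : ℕ) :
    ∑ τ : Equiv.Perm (Fin n) with IsUnshuffle (p + 1) (movePerm 0 τ),
      MonoidAlgebra.of k _ (matsumotoLift (movePerm 0 τ)) = shiftAlg k n (shuffleSum k n p) := by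
  rw [shuffleSum, map_sum]
  refine Finset.sum_congr (by simp only [isUnshuffle_movePerm_zero]) fun τ _ => ?_
  rw [shiftAlg_of, matsumotoLift_movePerm 0 (by simp), Fin.val_zero, fatRight_zero, one_mul]

open Classical in
theorem sum_isUnshuffle_movePerm_self {n : ℕ} (x : Fin (n + 1)) :
    ∑ τ with IsUnshuffle x (movePerm x τ), MonoidAlgebra.of k _ (matsumotoLift (movePerm x τ)) =
      MonoidAlgebra.of k _ (fatRight (n + 1) x 0) * shiftAlg k n (shuffleSum k n x) := by
  rw [shuffleSum, map_sum, Finset.mul_sum]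
  refine Finset.sum_congr (by simp only [isUnshuffle_movePerm_self]) fun τ hτ => ?_
  rw [shiftAlg_of, ← map_mul, matsumotoLift_movePerm x fun v hv =>
    (Finset.mem_filter.1 hτ).2.invCount_eq_zero hv]

open Classical in
theorem sum_isUnshuffle_movePerm_of_ne {n p : ℕ} {x : Fin (n + 1)} (h0 : x ≠ 0)
    (hp : (x : ℕ) ≠ p) :
    ∑ τ with IsUnshuffle p (movePerm x τ), MonoidAlgebra.of k _ (matsumotoLift (movePerm x τ)) = 0
    := by
  refine (congrArg (Finset.sum · _) (Finset.filter_false_of_mem fun τ _ hτ => hp ?_)).trans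
    Finset.sum_empty
  simpa only [movePerm_zero] using hτ.apply_zero (by rwa [movePerm_zero])

-- An unshuffle sends the first position to `0` or to `p + 1`, where its last block begins.
theorem shuffleSum_succ (n p : ℕ) : shuffleSum k (n + 1) (p + 1) = shiftAlg k n (shuffleSum k n p) +
    if p + 1 ≤ n then MonoidAlgebra.of k _ (fatRight (n + 1) (p + 1) 0) *
      shiftAlg k n (shuffleSum k n (p + 1)) else 0 := by
  rw [shuffleSum_eq_sum_movePerm, Fin.sum_univ_succ, sum_isUnshuffle_movePerm_zero]
  refine congrArg _ ?_
  split_ifs with hp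
  · rw [Fintype.sum_eq_single ⟨p, hp⟩ fun x hx =>
      sum_isUnshuffle_movePerm_of_ne k x.succ_ne_zero fun h => hx (Fin.ext (Nat.succ_injective h))]
    exact sum_isUnshuffle_movePerm_self k (Fin.succ ⟨p, hp⟩)
  · exact Finset.sum_eq_zero fun x _ =>
      sum_isUnshuffle_movePerm_of_ne k x.succ_ne_zero (by rw [Fin.val_succ]; omega)

end ShuffleSum

/-! ### Tensor powers of a braided vector space -/

section Cons

variable {k : Type*} [Field k] {V : Type*} [AddCommGroup V] [Module k V] {n : ℕ}

/-- The action of the group algebra of the braid group on a tensor power. -/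
noncomputable def Braiding.actLin (c : Braiding k V) (n : ℕ) :
    MonoidAlgebra k (BraidGroup n) →ₐ[k] Module.End k (⨂[k] _ : Fin n, V) :=
  MonoidAlgebra.lift k _ _ (LinearEquiv.automorphismGroup.toLinearMapMonoidHom.comp (c.action n))

theorem Braiding.actLin_of (c : Braiding k V) (β : BraidGroup n) (t : ⨂[k] _ : Fin n, V) :
    c.actLin n (MonoidAlgebra.of k _ β) t = c.action n β t := by
  rw [actLin, MonoidAlgebra.lift_of]
  rfl

theorem Braiding.action_gen (c : Braiding k V) {j : ℕ} (h : j + 1 < n) :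
    c.action n (gen n j) = c.crossing n j :=
  braidLift_gen _ _ _ _ h

theorem Braiding.crossing_tprod (c : Braiding k V) {j : ℕ} (h : j + 1 < n) (a : Fin n → V) :
    c.crossing n j (PiTensorProduct.tprod k a) =
      insertPair a ⟨j, by omega⟩ ⟨j + 1, h⟩ (by simp)
        (c.σ (a ⟨j, by omega⟩ ⊗ₜ a ⟨j + 1, h⟩)) := by
  rw [crossing, dif_pos h]
  exact applyAt_tprod _ _ _ _ _

variable (k V n) in
/-- Tensoring with a vector from the left. -/
noncomputable def consMap : V →ₗ[k] (⨂[k] _ : Fin n, V) →ₗ[k] ⨂[k] _ : Fin (n + 1), V :=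
  (PiTensorProduct.lift (R := k) (s := fun _ : Fin n => V)).toLinearMap ∘ₗ
    (PiTensorProduct.tprod k (s := fun _ : Fin (n + 1) => V)).curryLeft

@[simp] theorem consMap_tprod (x : V) (b : Fin n → V) :
    consMap k V n x (PiTensorProduct.tprod k b) =
      PiTensorProduct.tprod k (Fin.cons x b : Fin (n + 1) → V) := by
  simp [consMap]

theorem hom_ext_cons {M : Type*} [AddCommMonoid M] [Module k M]
    {f g : (⨂[k] _ : Fin (n + 1), V) →ₗ[k] M}
    (h : ∀ x b, f (consMap k V n x (PiTensorProduct.tprod k b)) =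
      g (consMap k V n x (PiTensorProduct.tprod k b))) : f = g := by
  apply PiTensorProduct.ext
  ext a
  simpa using h (a 0) (Fin.tail a)

theorem insertPair_cons (x : V) (b : Fin n → V) (i j : Fin n) (h : i ≠ j) (t : V ⊗[k] V) :
    insertPair (Fin.cons x b : Fin (n + 1) → V) i.succ j.succ
      (fun e => h (Fin.succ_injective _ e)) t = consMap k V n x (insertPair b i j h t) := by
  induction t with
  | zero => simp
  | add s t hs ht => simp [hs, ht]
  | tmul y z =>
    rw [insertPair_tmul, insertPair_tmul, consMap_tprod, Fin.cons_update, Fin.cons_update]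

theorem crossing_consMap (c : Braiding k V) {j : ℕ} (h : j + 1 < n) (x : V)
    (t : ⨂[k] _ : Fin n, V) :
    c.crossing (n + 1) (j + 1) (consMap k V n x t) = consMap k V n x (c.crossing n j t) := by
  have hcomp : (c.crossing (n + 1) (j + 1)).toLinearMap ∘ₗ consMap k V n x =
      consMap k V n x ∘ₗ (c.crossing n j).toLinearMap := by
    apply PiTensorProduct.ext
    ext b
    simp only [LinearMap.compMultilinearMap_apply, LinearMap.comp_apply, LinearEquiv.coe_coe,
      consMap_tprod, c.crossing_tprod h, c.crossing_tprod (show j + 1 + 1 < n + 1 by omega)]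
    exact insertPair_cons x b ⟨j, by omega⟩ ⟨j + 1, h⟩ (by simp) _
  exact LinearMap.congr_fun hcomp t

theorem action_shiftBraid (c : Braiding k V) (β : BraidGroup n) (x : V)
    (t : ⨂[k] _ : Fin n, V) :
    c.action (n + 1) (shiftBraid n β) (consMap k V n x t) = consMap k V n x (c.action n β t) := by
  induction β using braid_induction generalizing t with
  | one => simp
  | of_gen j hj =>
    rw [shiftBraid_gen hj, c.action_gen hj, c.action_gen (by omega), crossing_consMap c hj]
  | mul β γ hβ hγ => simp only [map_mul, LinearEquiv.mul_apply, hβ, hγ]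
  | inv β hβ =>
    apply (c.action (n + 1) (shiftBraid n β)).injective
    rw [hβ, ← LinearEquiv.mul_apply, ← LinearEquiv.mul_apply, ← map_mul, ← map_mul, ← map_mul]
    simp

theorem actLin_shiftAlg (c : Braiding k V) (z : MonoidAlgebra k (BraidGroup n)) (x : V)
    (t : ⨂[k] _ : Fin n, V) :
    c.actLin (n + 1) (shiftAlg k n z) (consMap k V n x t) = consMap k V n x (c.actLin n z t) := by
  induction z using MonoidAlgebra.induction_on with
  | of β => rw [shiftAlg_of, c.actLin_of, c.actLin_of, action_shiftBraid]
  | add y z hy hz => simp only [map_add, LinearMap.add_apply, hy, hz]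
  | smul r z hz => simp only [map_smul, LinearMap.smul_apply, hz]

variable (k V n) in
/-- Tensoring with a tensor of order two from the left. -/
noncomputable def consTwo :
    V ⊗[k] V →ₗ[k] (⨂[k] _ : Fin n, V) →ₗ[k] ⨂[k] _ : Fin (n + 2), V :=
  TensorProduct.lift ((LinearMap.llcomp k _ _ _).compl₁₂ (consMap k V (n + 1)) (consMap k V n))

@[simp] theorem consTwo_tmul (x y : V) (t : ⨂[k] _ : Fin n, V) :
    consTwo k V n (x ⊗ₜ y) t = consMap k V (n + 1) x (consMap k V n y t) := rfl

theorem insertPair_zero_one (x y : V) (b : Fin n → V) (s : V ⊗[k] V) :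
    insertPair (Fin.cons x (Fin.cons y b : Fin (n + 1) → V) : Fin (n + 2) → V) 0 1
      Fin.zero_ne_one s = consTwo k V n s (PiTensorProduct.tprod k b) := by
  induction s with
  | zero => simp
  | add s t hs ht => simp only [map_add, LinearMap.add_apply, hs, ht]
  | tmul u v =>
    rw [insertPair_tmul, consTwo_tmul, consMap_tprod, consMap_tprod, Fin.update_cons_zero]
    congr 1
    rw [← Fin.succ_zero_eq_one, ← Fin.cons_update, Fin.update_cons_zero]

theorem crossing_zero_consMap (c : Braiding k V) (x y : V) (t : ⨂[k] _ : Fin n, V) :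
    c.crossing (n + 2) 0 (consMap k V (n + 1) x (consMap k V n y t)) =
      consTwo k V n (c.σ (x ⊗ₜ y)) t := by
  have hcomp : (c.crossing (n + 2) 0).toLinearMap ∘ₗ consTwo k V n (x ⊗ₜ y) =
      consTwo k V n (c.σ (x ⊗ₜ y)) := by
    apply PiTensorProduct.ext
    ext b
    simp only [LinearMap.compMultilinearMap_apply, LinearMap.comp_apply, LinearEquiv.coe_coe,
      consTwo_tmul, consMap_tprod, c.crossing_tprod (show 0 + 1 < n + 2 by omega)]
    exact insertPair_zero_one x y b _
  exact LinearMap.congr_fun hcomp t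

theorem shiftBraid_fatRight {n p : ℕ} (h : p + 1 ≤ n) :
    shiftBraid n (fatRight n p 0) * gen (n + 1) 0 = fatRight (n + 1) (p + 1) 0 := by
  induction p with
  | zero => simp [fatRight]
  | succ p ih =>
    rw [fatRight_succ, map_mul, mul_assoc, ih (by omega), fatRight_succ _ (p + 1),
      shiftBraid_gen (by omega)]
    congr 2

end Cons

/-! ### The coproduct of a product of primitive elements -/

section Primitive

variable {k : Type*} [Field k] {A : Type*} [Ring A] [Algebra k A] {n : ℕ}

variable (k A n) in
/-- The `n`-fold multiplication. -/
noncomputable def mulMap : (⨂[k] _ : Fin n, A) →ₗ[k] A :=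
  PiTensorProduct.lift (MultilinearMap.mkPiAlgebraFin k n A)

@[simp] theorem mulMap_tprod (a : Fin n → A) :
    mulMap k A n (PiTensorProduct.tprod k a) = (List.ofFn a).prod := by
  simp [mulMap]

variable (k A n) in
/-- Multiply the first `p` factors and the remaining factors separately. -/
noncomputable def splitMap (p : ℕ) : (⨂[k] _ : Fin n, A) →ₗ[k] A ⊗[k] A :=
  PiTensorProduct.lift ((MultilinearMap.mkPiAlgebraFin k n (A ⊗[k] A)).compLinearMap fun i =>
    if (i : ℕ) < p then (Algebra.TensorProduct.includeLeft (R := k) (S := k)).toLinearMap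
    else Algebra.TensorProduct.includeRight.toLinearMap)

theorem splitMap_tprod (p : ℕ) (a : Fin n → A) :
    splitMap k A n p (PiTensorProduct.tprod k a) =
      (List.ofFn fun i : Fin n => if (i : ℕ) < p then a i ⊗ₜ[k] (1 : A) else 1 ⊗ₜ a i).prod := by
  rw [splitMap, PiTensorProduct.lift.tprod, MultilinearMap.compLinearMap_apply,
    MultilinearMap.mkPiAlgebraFin_apply]
  congr 2
  funext i
  split_ifs <;> rfl

theorem mulMap_consMap (x : A) (t : ⨂[k] _ : Fin n, A) :
    mulMap k A (n + 1) (consMap k A n x t) = x * mulMap k A n t := by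
  refine LinearMap.congr_fun (f := mulMap k A (n + 1) ∘ₗ consMap k A n x)
    (g := LinearMap.mulLeft k x ∘ₗ mulMap k A n) (PiTensorProduct.ext ?_) t
  ext b
  simp

theorem splitMap_succ_consMap (p : ℕ) (x : A) (t : ⨂[k] _ : Fin n, A) :
    splitMap k A (n + 1) (p + 1) (consMap k A n x t) = (x ⊗ₜ 1) * splitMap k A n p t := by
  refine LinearMap.congr_fun (f := splitMap k A (n + 1) (p + 1) ∘ₗ consMap k A n x)
    (g := LinearMap.mulLeft k (x ⊗ₜ 1) ∘ₗ splitMap k A n p) (PiTensorProduct.ext ?_) t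
  ext b
  simp [splitMap_tprod]

theorem splitMap_zero (t : ⨂[k] _ : Fin n, A) :
    splitMap k A n 0 t = 1 ⊗ₜ mulMap k A n t := by
  refine LinearMap.congr_fun (f := splitMap k A n 0)
    (g := TensorProduct.mk k A A 1 ∘ₗ mulMap k A n) (PiTensorProduct.ext ?_) t
  ext b
  have hprod := map_list_prod (Algebra.TensorProduct.includeRight (R := k) (A := A) (B := A))
    (List.ofFn b)
  simp only [Algebra.TensorProduct.includeRight_apply, List.map_ofFn] at hprod
  simp [splitMap_tprod, hprod, Function.comp_def]

theorem splitMap_of_le {p : ℕ} (hp : n ≤ p) (t : ⨂[k] _ : Fin n, A) :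
    splitMap k A n p t = mulMap k A n t ⊗ₜ 1 := by
  refine LinearMap.congr_fun (f := splitMap k A n p)
    (g := (TensorProduct.mk k A A).flip 1 ∘ₗ mulMap k A n) (PiTensorProduct.ext ?_) t
  ext b
  have hprod := map_list_prod
    (Algebra.TensorProduct.includeLeft (R := k) (S := k) (A := A) (B := A)) (List.ofFn b)
  simp only [Algebra.TensorProduct.includeLeft_apply, List.map_ofFn] at hprod
  have hlt : ∀ i : Fin n, (i : ℕ) < p := fun i => by omega
  simp [splitMap_tprod, hprod, Function.comp_def, hlt]

theorem exists_of_rTensor_lTensor_eq_zero {V W : Type*} [AddCommGroup V] [Module k V]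
    [AddCommGroup W] [Module k W] (f : V →ₗ[k] W) (t : V ⊗[k] V)
    (hr : f.rTensor V t = 0) (hl : f.lTensor V t = 0) :
    ∃ s : LinearMap.ker f ⊗[k] LinearMap.ker f,
      TensorProduct.map (LinearMap.ker f).subtype (LinearMap.ker f).subtype s = t := by
  set ι := (LinearMap.ker f).subtype
  obtain ⟨s₁, rfl⟩ := (Module.Flat.rTensor_exact V (LinearMap.exact_subtype_ker_map f) t).1 hr
  obtain ⟨s₂, hs₂⟩ := (Module.Flat.lTensor_exact V (LinearMap.exact_subtype_ker_map f) _).1 hl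
  obtain ⟨π, hπ⟩ := LinearMap.exists_leftInverse_of_injective ι (Submodule.ker_subtype _)
  refine ⟨π.lTensor _ s₁, ?_⟩
  calc TensorProduct.map ι ι (π.lTensor _ s₁)
      = (ι ∘ₗ π).lTensor V (ι.rTensor V s₁) := by
        rw [LinearMap.lTensor, LinearMap.lTensor, LinearMap.rTensor, ← LinearMap.comp_apply,
          ← LinearMap.comp_apply, ← TensorProduct.map_comp, ← TensorProduct.map_comp,
          LinearMap.comp_id, LinearMap.id_comp, LinearMap.comp_id]
    _ = (ι ∘ₗ π).lTensor V (ι.lTensor V s₂) := by rw [hs₂]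
    _ = ι.lTensor V s₂ := by
        rw [← LinearMap.comp_apply, ← LinearMap.lTensor_comp, LinearMap.comp_assoc, hπ,
          LinearMap.comp_id]
    _ = ι.rTensor V s₁ := hs₂

variable [Coalgebra k A] (H : BraidedHopfAlgebra k A)

namespace BraidedHopfAlgebra

/-- Multiplication by `1 ⊗ x` from the left, in the braided tensor square. -/
noncomputable def rightOp (x : A) : A ⊗[k] A →ₗ[k] A ⊗[k] A :=
  TensorProduct.lift ((LinearMap.mul k (A ⊗[k] A)).compl₁₂
    (H.σ.toLinearMap ∘ₗ TensorProduct.mk k A A x) (TensorProduct.mk k A A 1))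

@[simp] theorem rightOp_tmul (x u v : A) :
    H.rightOp x (u ⊗ₜ v) = H.σ (x ⊗ₜ u) * (1 ⊗ₜ v) := by
  simp [rightOp]

theorem comul_mul_of_isPrimitive {x : A} (hx : IsPrimitive k x) (m : A) :
    Coalgebra.comul (R := k) (x * m) =
      (x ⊗ₜ 1) * Coalgebra.comul (R := k) m + H.rightOp x (Coalgebra.comul (R := k) m) := by
  have h := LinearMap.congr_fun H.comul_mul (x ⊗ₜ m)
  rw [LinearMap.comp_apply, LinearMap.mul'_apply] at h
  rw [h]
  simp only [LinearMap.comp_apply, TensorProduct.map_tmul]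
  rw [hx]
  induction Coalgebra.comul (R := k) m with
  | zero => simp
  | add s t hs ht =>
    simp only [TensorProduct.tmul_add, map_add, mul_add, hs, ht]
    abel
  | tmul u v =>
    simp only [TensorProduct.add_tmul, map_add, LinearEquiv.coe_coe, TensorProduct.assoc_tmul,
      LinearMap.lTensor_tmul, LinearMap.comp_apply, TensorProduct.assoc_symm_tmul,
      LinearMap.rTensor_tmul, H.braid_one_left, rightOp_tmul]
    congr 1
    · simp
    · induction H.σ (x ⊗ₜ u) with
      | zero => simp
      | add s t hs ht =>
        simp only [TensorProduct.add_tmul, TensorProduct.tmul_add, map_add, add_mul, hs, ht]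
      | tmul a b => simp

theorem braid_mul_tmul (x y u : A) : H.σ (x ⊗ₜ (y * u)) =
    (LinearMap.mul' k A).rTensor A (applyRight H.σ.toLinearMap (H.σ (x ⊗ₜ y) ⊗ₜ u)) := by
  simpa using LinearMap.congr_fun H.braid_mul_right ((x ⊗ₜ y) ⊗ₜ u)

/-- The operator `y ⊗ x ↦ (y ⊗ 1)(1 ⊗ x)` in the braided tensor square. -/
noncomputable def pairOp : A ⊗[k] A →ₗ[k] A ⊗[k] A →ₗ[k] A ⊗[k] A :=
  TensorProduct.lift (LinearMap.mk₂ k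
    (fun y x => LinearMap.mulLeft k (y ⊗ₜ 1) ∘ₗ H.rightOp x)
    (fun y y' x => by ext; simp [TensorProduct.add_tmul, add_mul])
    (fun c y x => by ext; simp [← TensorProduct.smul_tmul'])
    (fun y x x' => by ext; simp [TensorProduct.add_tmul, add_mul, mul_add])
    (fun c y x => by ext; simp [← TensorProduct.smul_tmul']))

@[simp] theorem pairOp_tmul (y x : A) (w : A ⊗[k] A) :
    H.pairOp (y ⊗ₜ x) w = (y ⊗ₜ 1) * H.rightOp x w := rfl

theorem pairOp_braid (x y : A) (w : A ⊗[k] A) :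
    H.pairOp (H.σ (x ⊗ₜ y)) w = H.rightOp x ((y ⊗ₜ 1) * w) := by
  induction w with
  | zero => simp
  | add s t hs ht => simp [hs, ht, mul_add]
  | tmul u v =>
    rw [Algebra.TensorProduct.tmul_mul_tmul, one_mul, rightOp_tmul, braid_mul_tmul]
    induction H.σ (x ⊗ₜ y) with
    | zero => simp
    | add s t hs ht =>
      simp only [map_add, LinearMap.add_apply, TensorProduct.add_tmul, add_mul, hs, ht]
    | tmul a b =>
      rw [pairOp_tmul, rightOp_tmul, ← mul_assoc]
      congr 1
      simp only [applyRight, LinearMap.comp_apply, LinearEquiv.coe_coe, TensorProduct.assoc_tmul,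
        LinearMap.lTensor_tmul]
      induction H.σ (b ⊗ₜ u) with
      | zero => simp
      | add s t hs ht => simp only [TensorProduct.tmul_add, map_add, mul_add, hs, ht]
      | tmul c d => simp

theorem splitMap_fatRight {p : ℕ} (hp : p ≤ n) (x : A) (t : ⨂[k] _ : Fin n, A) :
    splitMap k A (n + 1) p (H.action (n + 1) (fatRight (n + 1) p 0) (consMap k A n x t)) =
      H.rightOp x (splitMap k A n p t) := by
  induction p generalizing n x with
  | zero =>
    rw [fatRight_zero, map_one, LinearEquiv.coe_one, id, splitMap_zero, splitMap_zero,
      mulMap_consMap, rightOp_tmul, H.braid_one_right]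
    simp
  | succ p ih =>
    obtain ⟨m, rfl⟩ : ∃ m, n = m + 1 := ⟨n - 1, by omega⟩
    refine LinearMap.congr_fun (f := splitMap k A (m + 1 + 1) (p + 1) ∘ₗ
      (H.action (m + 1 + 1) (fatRight (m + 1 + 1) (p + 1) 0)).toLinearMap ∘ₗ consMap k A (m + 1) x)
      (g := H.rightOp x ∘ₗ splitMap k A (m + 1) (p + 1)) (hom_ext_cons fun y b => ?_) t
    simp only [LinearMap.comp_apply, LinearEquiv.coe_coe]
    generalize PiTensorProduct.tprod k b = s
    rw [splitMap_succ_consMap, ← pairOp_braid, ← shiftBraid_fatRight (by omega), map_mul,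
      LinearEquiv.mul_apply, H.action_gen (by omega), crossing_zero_consMap]
    induction H.σ (x ⊗ₜ y) with
    | zero => simp
    | add u v hu hv => simp only [map_add, LinearMap.add_apply, hu, hv]
    | tmul a b =>
      rw [consTwo_tmul, action_shiftBraid, splitMap_succ_consMap, ih (by omega), pairOp_tmul]

theorem splitMap_shuffleSum_zero_consMap (x : A) (t : ⨂[k] _ : Fin n, A) :
    splitMap k A (n + 1) 0 (H.actLin (n + 1) (shuffleSum k (n + 1) 0) (consMap k A n x t)) =
      H.rightOp x (splitMap k A n 0 (H.actLin n (shuffleSum k n 0) t)) := by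
  simp only [shuffleSum_zero, map_one, Module.End.one_apply]
  rw [← splitMap_fatRight H (Nat.zero_le n), fatRight_zero, map_one]
  rfl

theorem splitMap_shuffleSum_succ_consMap (p : ℕ) (x : A) (t : ⨂[k] _ : Fin n, A) :
    splitMap k A (n + 1) (p + 1)
        (H.actLin (n + 1) (shuffleSum k (n + 1) (p + 1)) (consMap k A n x t)) =
      (x ⊗ₜ 1) * splitMap k A n p (H.actLin n (shuffleSum k n p) t) +
        if p + 1 ≤ n then
          H.rightOp x (splitMap k A n (p + 1) (H.actLin n (shuffleSum k n (p + 1)) t))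
        else 0 := by
  rw [shuffleSum_succ, map_add, LinearMap.add_apply, map_add, actLin_shiftAlg,
    splitMap_succ_consMap]
  congr 1
  split_ifs with h
  · rw [map_mul, Module.End.mul_apply, actLin_shiftAlg, Braiding.actLin_of,
      splitMap_fatRight H h]
  · simp

theorem sum_splitMap_shuffleSum_consMap (x : A) (t : ⨂[k] _ : Fin n, A) :
    ∑ p ∈ Finset.range (n + 2),
        splitMap k A (n + 1) p (H.actLin (n + 1) (shuffleSum k (n + 1) p) (consMap k A n x t)) =
      (x ⊗ₜ 1) * ∑ p ∈ Finset.range (n + 1), splitMap k A n p (H.actLin n (shuffleSum k n p) t) +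
        H.rightOp x
          (∑ p ∈ Finset.range (n + 1), splitMap k A n p (H.actLin n (shuffleSum k n p) t)) := by
  rw [Finset.sum_range_succ' _ (n + 1), splitMap_shuffleSum_zero_consMap,
    Finset.sum_congr rfl fun p _ => H.splitMap_shuffleSum_succ_consMap p x t,
    Finset.sum_add_distrib, ← Finset.mul_sum, map_sum, add_assoc]
  congr 1
  rw [Finset.sum_range_succ, if_neg (by omega), add_zero, Finset.sum_range_succ' _ n]
  congr 1
  exact Finset.sum_congr rfl fun p hp => if_pos (Finset.mem_range.1 hp)

theorem comul_mulMap_tprod (a : Fin n → A) (ha : ∀ i, IsPrimitive k (a i)) :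
    Coalgebra.comul (R := k) (mulMap k A n (PiTensorProduct.tprod k a)) =
      ∑ p ∈ Finset.range (n + 1),
        splitMap k A n p (H.actLin n (shuffleSum k n p) (PiTensorProduct.tprod k a)) := by
  induction n with
  | zero =>
    rw [Finset.sum_range_one, shuffleSum_zero, map_one, Module.End.one_apply, splitMap_zero]
    simp [H.comul_one]
  | succ n ih =>
    obtain ⟨x, b, rfl⟩ : ∃ x b, a = Fin.cons x b := ⟨a 0, Fin.tail a, (Fin.cons_self_tail a).symm⟩
    have hx : IsPrimitive k x := ha 0
    rw [← consMap_tprod, mulMap_consMap, H.comul_mul_of_isPrimitive hx, ih b fun i => ha i.succ,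
      sum_splitMap_shuffleSum_consMap]

variable (k A) in
/-- The defect `Δ(x) - x ⊗ 1 - 1 ⊗ x` of primitivity, a linear map whose kernel is `P(A)`. -/
noncomputable def primDefect : A →ₗ[k] A ⊗[k] A :=
  Coalgebra.comul (R := k) - (TensorProduct.mk k A A).flip 1 - TensorProduct.mk k A A 1

theorem isPrimitive_iff_mem_ker {x : A} : IsPrimitive k x ↔ x ∈ LinearMap.ker (primDefect k A) := by
  rw [LinearMap.mem_ker, primDefect, IsPrimitive]
  simp only [LinearMap.sub_apply, LinearMap.flip_apply, TensorProduct.mk_apply]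
  rw [sub_sub, sub_eq_zero]

theorem applyRight_braiding_tmul_one (t : A ⊗[k] A) :
    applyRight H.σ.toLinearMap (t ⊗ₜ 1) = ((TensorProduct.mk k A A).flip 1).rTensor A t := by
  induction t with
  | zero => simp
  | add s t hs ht => simp only [TensorProduct.add_tmul, map_add, hs, ht]
  | tmul a b => simp [applyRight, H.braid_one_right]

theorem applyRight_braiding_one_tmul (x y : A) :
    applyRight H.σ.toLinearMap ((1 ⊗ₜ x) ⊗ₜ y) =
      (TensorProduct.mk k A A 1).rTensor A (H.σ (x ⊗ₜ y)) := by
  simp only [applyRight, LinearMap.comp_apply, LinearEquiv.coe_coe, TensorProduct.assoc_tmul,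
    LinearMap.lTensor_tmul]
  induction H.σ (x ⊗ₜ y) with
  | zero => simp
  | add s t hs ht => simp only [TensorProduct.tmul_add, map_add, hs, ht]
  | tmul a b => simp

theorem rTensor_braiding_rTensor_mk_one (t : A ⊗[k] A) :
    H.σ.toLinearMap.rTensor A ((TensorProduct.mk k A A 1).rTensor A t) =
      ((TensorProduct.mk k A A).flip 1).rTensor A t := by
  induction t with
  | zero => simp
  | add s t hs ht => simp only [map_add, hs, ht]
  | tmul a b => simp [H.braid_one_left]

theorem rTensor_primDefect_braid {x y : A} (hy : IsPrimitive k y) :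
    (primDefect k A).rTensor A (H.σ (x ⊗ₜ y)) = 0 := by
  have h := LinearMap.congr_fun H.braid_comul_right (x ⊗ₜ y)
  simp only [LinearMap.comp_apply, LinearMap.lTensor_tmul, LinearEquiv.coe_coe] at h
  rw [hy] at h
  simp only [TensorProduct.tmul_add, map_add, TensorProduct.assoc_symm_tmul,
    LinearMap.rTensor_tmul, LinearEquiv.coe_coe, H.braid_one_right,
    applyRight_braiding_tmul_one, applyRight_braiding_one_tmul] at h
  rw [primDefect, LinearMap.rTensor_sub, LinearMap.rTensor_sub, LinearMap.sub_apply,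
    LinearMap.sub_apply, h]
  abel

theorem assoc_symm_lTensor_primDefect (t : A ⊗[k] A) :
    (TensorProduct.assoc k A A A).symm ((primDefect k A).lTensor A t) =
      (TensorProduct.assoc k A A A).symm ((Coalgebra.comul (R := k) (A := A)).lTensor A t) -
        (t ⊗ₜ 1 + ((TensorProduct.mk k A A).flip 1).rTensor A t) := by
  induction t with
  | zero => simp
  | add s t hs ht =>
    simp only [TensorProduct.add_tmul, map_add, hs, ht]
    abel
  | tmul a b => simp [primDefect, sub_sub]

theorem lTensor_primDefect_braid {x y : A} (hx : IsPrimitive k x) :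
    (primDefect k A).lTensor A (H.σ (x ⊗ₜ y)) = 0 := by
  have h := LinearMap.congr_fun H.braid_comul_left (x ⊗ₜ y)
  simp only [LinearMap.comp_apply, LinearMap.rTensor_tmul, LinearEquiv.coe_coe] at h
  have hleft : H.σ.toLinearMap.rTensor A (applyRight H.σ.toLinearMap ((x ⊗ₜ[k] 1) ⊗ₜ[k] y)) =
      H.σ (x ⊗ₜ y) ⊗ₜ 1 := by
    simp [applyRight, H.braid_one_left]
  rw [hx, TensorProduct.add_tmul, map_add, map_add, hleft, applyRight_braiding_one_tmul,
    rTensor_braiding_rTensor_mk_one] at h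
  apply (TensorProduct.assoc k A A A).symm.injective
  rw [assoc_symm_lTensor_primDefect, h, sub_self, map_zero]

variable (k A n) in
/-- The span of the tensor products of primitive elements. -/
noncomputable def primTensors : Submodule k (⨂[k] _ : Fin n, A) :=
  Submodule.span k {t | ∃ a : Fin n → A, (∀ i, IsPrimitive k (a i)) ∧
    t = PiTensorProduct.tprod k a}

theorem tprod_mem_primTensors {a : Fin n → A} (ha : ∀ i, IsPrimitive k (a i)) :
    PiTensorProduct.tprod k a ∈ primTensors k A n :=
  Submodule.subset_span ⟨a, ha, rfl⟩

theorem crossing_mem_primTensors {j : ℕ} (hj : j + 1 < n) {t : ⨂[k] _ : Fin n, A}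
    (ht : t ∈ primTensors k A n) : H.crossing n j t ∈ primTensors k A n := by
  induction ht using Submodule.span_induction with
  | zero => simp
  | add s t _ _ hs ht => rw [map_add]; exact add_mem hs ht
  | smul c t _ ht => rw [map_smul]; exact Submodule.smul_mem _ _ ht
  | mem t ht =>
    obtain ⟨a, ha, rfl⟩ := ht
    rw [H.crossing_tprod hj]
    obtain ⟨s, hs⟩ := exists_of_rTensor_lTensor_eq_zero (primDefect k A) _
      (H.rTensor_primDefect_braid (x := a ⟨j, by omega⟩) (ha ⟨j + 1, hj⟩))
      (H.lTensor_primDefect_braid (ha ⟨j, by omega⟩))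
    rw [← hs]
    clear hs
    induction s with
    | zero => simp
    | add s t hs ht => rw [map_add, map_add]; exact add_mem hs ht
    | tmul x y =>
      rw [TensorProduct.map_tmul, insertPair_tmul]
      apply tprod_mem_primTensors
      intro i
      rw [Function.update_apply, Function.update_apply]
      split_ifs
      · exact isPrimitive_iff_mem_ker.2 y.2
      · exact isPrimitive_iff_mem_ker.2 x.2
      · exact ha i

theorem action_mem_primTensors (hH : H.FinitelyBraided) (β : BraidGroup n)
    {t : ⨂[k] _ : Fin n, A} (ht : t ∈ primTensors k A n) :
    H.action n β t ∈ primTensors k A n := by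
  induction β using braid_induction generalizing t with
  | one => simpa using ht
  | of_gen j hj => rw [H.action_gen hj]; exact H.crossing_mem_primTensors hj ht
  | mul β γ hβ hγ => rw [map_mul, LinearEquiv.mul_apply]; exact hβ (hγ ht)
  | inv β ih =>
    obtain ⟨m, hm, -, hker⟩ := Subgroup.exists_pow_mem_of_index_ne_zero (hH n).index_ne_zero β
    obtain ⟨m, rfl⟩ : ∃ l, m = l + 1 := ⟨m - 1, by omega⟩
    have hinv : H.action n β⁻¹ = H.action n β ^ m := by
      rw [map_inv, inv_eq_iff_mul_eq_one, ← pow_succ', ← map_pow]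
      exact hker
    rw [hinv]
    clear hinv hker hm
    induction m with
    | zero => simpa using ht
    | succ m hm => rw [pow_succ', LinearEquiv.mul_apply]; exact ih hm

theorem actLin_mem_primTensors (hH : H.FinitelyBraided) (z : MonoidAlgebra k (BraidGroup n))
    {t : ⨂[k] _ : Fin n, A} (ht : t ∈ primTensors k A n) :
    H.actLin n z t ∈ primTensors k A n := by
  induction z using MonoidAlgebra.induction_on with
  | of β => rw [Braiding.actLin_of]; exact H.action_mem_primTensors hH β ht
  | add y z hy hz => rw [map_add]; exact add_mem hy hz
  | smul r z hz => rw [map_smul]; exact Submodule.smul_mem _ _ hz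

theorem comul_mulMap {t : ⨂[k] _ : Fin n, A} (ht : t ∈ primTensors k A n) :
    Coalgebra.comul (R := k) (mulMap k A n t) =
      ∑ p ∈ Finset.range (n + 1), splitMap k A n p (H.actLin n (shuffleSum k n p) t) := by
  induction ht using Submodule.span_induction with
  | zero => simp
  | add s t _ _ hs ht => simp only [map_add, hs, ht, Finset.sum_add_distrib]
  | smul c t _ ht => simp only [map_smul, ht, Finset.smul_sum]
  | mem t ht => obtain ⟨a, ha, rfl⟩ := ht; exact H.comul_mulMap_tprod a ha

theorem isPrimitive_mulMap (hH : H.FinitelyBraided) (hn : 1 < n)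
    {z : MonoidAlgebra k (BraidGroup n)}
    (hz : ∀ p ∈ Finset.Ioo 0 n, H.actLin n (shuffleSum k n p * z) = 0) {a : Fin n → A}
    (ha : ∀ i, IsPrimitive k (a i)) :
    IsPrimitive k (mulMap k A n (H.actLin n z (PiTensorProduct.tprod k a))) := by
  rw [IsPrimitive, H.comul_mulMap (H.actLin_mem_primTensors hH z (tprod_mem_primTensors ha)),
    Finset.sum_range_succ, ← Finset.sum_subset (s₁ := {0})]
  · rw [Finset.sum_singleton, shuffleSum_zero, shuffleSum_self, map_one, Module.End.one_apply,
      splitMap_zero, splitMap_of_le le_rfl, add_comm]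
  · simp; omega
  · intro p hp hp0
    rw [Finset.mem_range] at hp
    rw [Finset.mem_singleton] at hp0
    rw [← Module.End.mul_apply, ← map_mul, hz p (Finset.mem_Ioo.2 ⟨by omega, by omega⟩),
      LinearMap.zero_apply, map_zero]

end BraidedHopfAlgebra

end Primitive

/-! ### The action of the braid group on words -/

namespace WordAlg

variable {G X : Type*} [Group G] [MulAction G X] {k : Type*} [Field k] {R : AugRack G X} {n : ℕ}

variable (k R n) in
/-- The tensor product of the first `n` words of a sequence. -/
noncomputable def wordTensor (w : ℕ → FreeMonoid X) : ⨂[k] _ : Fin n, WordAlg k R :=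
  PiTensorProduct.tprod k fun i : Fin n => word k R (w i)

theorem crossing_wordTensor {j : ℕ} (hj : j + 1 < n) (w : ℕ → FreeMonoid X) :
    (hopf k R).crossing n j (wordTensor k R n w) = wordTensor k R n (R.words.cross j w) := by
  rw [wordTensor, Braiding.crossing_tprod _ hj]
  change insertPair _ _ _ _ ((braiding k R).σ _) = _
  rw [braiding_word, insertPair_tmul, wordTensor]
  congr 1
  funext i
  rw [AugRack.cross_apply, Function.update_apply, Function.update_apply]
  by_cases h1 : (i : ℕ) = j
  · rw [if_neg (by simp [Fin.ext_iff, h1]), if_pos (Fin.ext h1), if_pos h1]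
    rfl
  by_cases h2 : (i : ℕ) = j + 1
  · rw [if_pos (Fin.ext h2), if_neg h1, if_pos h2]
  · rw [if_neg (by simp [Fin.ext_iff, h2]), if_neg (by simp [Fin.ext_iff, h1]), if_neg h1,
      if_neg h2]

theorem action_wordTensor (β : BraidGroup n) (w : ℕ → FreeMonoid X) :
    (hopf k R).action n β (wordTensor k R n w) = wordTensor k R n (R.words.seqAct n β w) := by
  induction β using braid_induction generalizing w with
  | one => simp
  | of_gen j hj => rw [Braiding.action_gen _ hj, R.words.seqAct_gen hj, crossing_wordTensor hj]
  | mul β γ hβ hγ =>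
    rw [map_mul, map_mul, LinearEquiv.mul_apply, hγ, hβ]
    rfl
  | inv β h =>
    apply ((hopf k R).action n β).injective
    rw [h, ← LinearEquiv.mul_apply, ← map_mul, ← Equiv.Perm.mul_apply, ← map_mul]
    simp

theorem wordTensor_hom_ext {M : Type*} [AddCommMonoid M] [Module k M]
    {f g : (⨂[k] _ : Fin n, WordAlg k R) →ₗ[k] M}
    (h : ∀ w : ℕ → FreeMonoid X, (∀ i ≥ n, w i = 1) →
      f (wordTensor k R n w) = g (wordTensor k R n w)) : f = g := by
  apply PiTensorProduct.ext
  refine Module.Basis.ext_multilinear (fun _ => wordBasis k R) fun v => ?_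
  simpa [wordTensor, wordBasis_apply] using
    h (fun i => if hi : i < n then v ⟨i, hi⟩ else 1) fun i hi => dif_neg (by omega)

theorem finitelyBraided [Finite G] : (hopf k R).FinitelyBraided := by
  intro n
  obtain ⟨K, hK, h⟩ := exists_finiteIndex_seqAct_eq_self n G
  refine Subgroup.finiteIndex_of_le (H := K) fun β hβ => ?_
  rw [MonoidHom.mem_ker]
  apply LinearEquiv.toLinearMap_injective
  refine wordTensor_hom_ext fun w hw => ?_
  rw [LinearEquiv.coe_coe, action_wordTensor,
    h β hβ _ R.words w fun i hi => (congrArg R.degHom (hw i hi)).trans (map_one R.degHom)]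
  rfl

/-- The word formed by the first `n` letters of a sequence. -/
def toWord (n : ℕ) (s : ℕ → X) : FreeMonoid X := FreeMonoid.ofList (List.ofFn fun i : Fin n => s i)

theorem toWord_succ (s : ℕ → X) :
    toWord (n + 1) s = .of (s 0) * toWord n fun i => s (i + 1) := by
  rw [toWord, List.ofFn_succ, FreeMonoid.ofList_cons]
  rfl

theorem toWord_injective {s s' : ℕ → X} (h : toWord n s = toWord n s') {i : ℕ} (hi : i < n) :
    s i = s' i :=
  congrFun (List.ofFn_injective (FreeMonoid.ofList.injective h)) ⟨i, hi⟩

variable (k R n) in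
/-- The tensor product of the first `n` letters of a sequence. -/
noncomputable def letterTensor (s : ℕ → X) : ⨂[k] _ : Fin n, WordAlg k R :=
  wordTensor k R n (FreeMonoid.of ∘ s)

theorem letterTensor_mem_primTensors (s : ℕ → X) :
    letterTensor k R n s ∈ BraidedHopfAlgebra.primTensors k (WordAlg k R) n :=
  BraidedHopfAlgebra.tprod_mem_primTensors fun _ => isPrimitive_of _

theorem action_letterTensor (β : BraidGroup n) (s : ℕ → X) :
    (hopf k R).action n β (letterTensor k R n s) = letterTensor k R n (R.seqAct n β s) := by
  rw [letterTensor, action_wordTensor, letterTensor]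
  congr 1
  refine R.seqAct_map R.words (fun y z => ?_) β s
  change _ = R.degHom _ • _
  simp

theorem letterTensor_succ (s : ℕ → X) :
    letterTensor k R (n + 1) s =
      consMap k _ n (word k R (.of (s 0))) (letterTensor k R n fun i => s (i + 1)) := by
  rw [letterTensor, wordTensor, letterTensor, wordTensor, consMap_tprod]
  congr 1
  funext i
  refine Fin.cases rfl (fun i => ?_) i
  simp

theorem mulMap_letterTensor (s : ℕ → X) :
    mulMap k (WordAlg k R) n (letterTensor k R n s) = word k R (toWord n s) := by
  induction n generalizing s with
  | zero => simp [letterTensor, wordTensor, toWord]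
  | succ n ih => rw [letterTensor_succ, mulMap_consMap, ih, toWord_succ, map_mul]

theorem word_injective : Function.Injective (word k R) := (wordBasis k R).injective

theorem exists_splitMap_letterTensor_eq {p : ℕ} (hp : p ≤ n) (s : ℕ → X) :
    ∃ v w, splitMap k (WordAlg k R) n p (letterTensor k R n s) = word k R v ⊗ₜ word k R w ∧
      v * w = toWord n s ∧ v.length = p := by
  induction n generalizing p s with
  | zero =>
    obtain rfl : p = 0 := by omega
    exact ⟨1, _, by rw [splitMap_zero, mulMap_letterTensor, map_one], one_mul _, rfl⟩
  | succ n ih =>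
    cases p with
    | zero => exact ⟨1, _, by rw [splitMap_zero, mulMap_letterTensor, map_one], one_mul _, rfl⟩
    | succ p =>
      obtain ⟨v, w, hsplit, hvw, hlen⟩ := ih (Nat.le_of_succ_le_succ hp) fun i => s (i + 1)
      refine ⟨.of (s 0) * v, w, ?_, ?_, ?_⟩
      · rw [letterTensor_succ, splitMap_succ_consMap, hsplit, map_mul]
        simp
      · rw [mul_assoc, hvw, toWord_succ]
      · rw [FreeMonoid.length_mul, hlen, FreeMonoid.length_of, add_comm]

end WordAlg

/-! ### Finite levels -/

section Level

variable {k : Type*} [Field k] {n : ℕ}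

theorem toLevel_of (N : FinQuot n) (β : BraidGroup n) :
    toLevel k N (MonoidAlgebra.of k _ β) =
      MonoidAlgebra.of k _ (β : BraidGroup n ⧸ N.toSubgroup) := by
  simp [toLevel]

theorem toLevel_surjective (N : FinQuot n) : Function.Surjective (toLevel k N) := by
  intro x
  induction x using MonoidAlgebra.induction_on with
  | of q =>
    obtain ⟨β, rfl⟩ := QuotientGroup.mk_surjective q
    exact ⟨_, toLevel_of N β⟩
  | add x y hx hy =>
    obtain ⟨x, rfl⟩ := hx
    obtain ⟨y, rfl⟩ := hy
    exact ⟨x + y, map_add _ _ _⟩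
  | smul r x hx =>
    obtain ⟨x, rfl⟩ := hx
    exact ⟨r • x, map_smul _ _ _⟩

theorem transition_toLevel {N N' : FinQuot n} (h : N ≤ N') (z : MonoidAlgebra k (BraidGroup n)) :
    transition k h (toLevel k N z) = toLevel k N' z := by
  induction z using MonoidAlgebra.induction_on with
  | of β =>
    rw [toLevel_of, toLevel_of, transition, MonoidAlgebra.mapDomainAlgHom_apply,
      MonoidAlgebra.of_apply, MonoidAlgebra.mapDomain_single]
    rfl
  | add x y hx hy => simp only [map_add, hx, hy]
  | smul r x hx => simp only [map_smul, hx]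

variable {V : Type*} [AddCommGroup V] [Module k V]

theorem Braiding.lift_toLevel (c : Braiding k V) {P : FinQuot n}
    (hP : P.toSubgroup ≤ (c.action n).ker) (z : MonoidAlgebra k (BraidGroup n)) :
    (MonoidAlgebra.lift k _ _ (LinearEquiv.automorphismGroup.toLinearMapMonoidHom.comp
      (QuotientGroup.lift P.toSubgroup (c.action n) hP)) : BrAssLevel k n P →ₐ[k] _)
      (toLevel k P z) = c.actLin n z := by
  induction z using MonoidAlgebra.induction_on with
  | of β =>
    rw [toLevel_of, MonoidAlgebra.lift_of]
    exact LinearMap.ext fun t => (Braiding.actLin_of c β t).symm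
  | add x y hx hy => simp only [map_add, hx, hy]
  | smul r x hx => simp only [map_smul, hx]

theorem Braiding.actLin_eq_zero (c : Braiding k V) {P : FinQuot n}
    (hP : P.toSubgroup ≤ (c.action n).ker) {z : MonoidAlgebra k (BraidGroup n)}
    (hz : toLevel k P z = 0) : c.actLin n z = 0 := by
  rw [← Braiding.lift_toLevel c hP, hz, map_zero]

theorem mem_brPrim (hn : 1 < n) {N : FinQuot n} {x : BrAssLevel k n N} :
    x ∈ brPrim k n N ↔ ∀ p ∈ Finset.Ioo 0 n, toLevel k N (shuffleSum k n p) * x = 0 := by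
  rw [brPrim, if_pos hn]
  simp [Submodule.mem_iInf]

theorem brPrimStar_zero (N : FinQuot 0) : brPrimStar k 0 N = ⊥ := by
  rw [brPrimStar, if_neg (by omega), brPrim, if_neg (by omega)]

theorem monoidAlgebra_eq_smul_one {M : Type*} [Monoid M] [Subsingleton M] (x : MonoidAlgebra k M) :
    ∃ c : k, x = c • 1 := by
  induction x using MonoidAlgebra.induction_on with
  | of q => exact ⟨1, by rw [Subsingleton.elim q 1, map_one, one_smul]⟩
  | add x y hx hy =>
    obtain ⟨c, rfl⟩ := hx
    obtain ⟨d, rfl⟩ := hy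
    exact ⟨c + d, (add_smul _ _ _).symm⟩
  | smul r x hx =>
    obtain ⟨c, rfl⟩ := hx
    exact ⟨r * c, (mul_smul _ _ _).symm⟩

theorem brPrimStar_one (N : FinQuot 1) : brPrimStar k 1 N = ⊤ := by
  rw [brPrimStar, if_pos rfl, eq_top_iff]
  intro x _
  have := braidGroup_subsingleton (n := 1) le_rfl
  have : Subsingleton (BraidGroup 1 ⧸ N.toSubgroup) := Quotient.instSubsingletonQuotient _
  obtain ⟨c, rfl⟩ := monoidAlgebra_eq_smul_one x
  exact Submodule.smul_mem _ _ (Submodule.mem_span_singleton_self 1)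

theorem brPrimStar_of_lt (hn : 1 < n) (N : FinQuot n) : brPrimStar k n N = brPrim k n N := by
  rw [brPrimStar, if_neg (by omega)]

end Level

/-! ### Primitive operations and primitive elements -/

section Detection

variable {k : Type*} [Field k] {n : ℕ}

theorem IsPrimitive.smul {A : Type*} [Ring A] [Algebra k A] [Coalgebra k A] {x : A}
    (hx : IsPrimitive k x) (c : k) : IsPrimitive k (c • x) := by
  rw [IsPrimitive, map_smul, hx]
  simp [TensorProduct.smul_tmul']

theorem BraidedHopfAlgebra.isPrimitive_of_mem {A : Type*} [Ring A] [Algebra k A] [Coalgebra k A]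
    (H : BraidedHopfAlgebra k A) (hH : H.FinitelyBraided) {P : FinQuot n}
    (hP : P.toSubgroup ≤ (H.action n).ker) {z : MonoidAlgebra k (BraidGroup n)}
    (hz : toLevel k P z ∈ brPrimStar k n P) {a : Fin n → A} (ha : ∀ i, IsPrimitive k (a i)) :
    IsPrimitive k (mulMap k A n (H.actLin n z (PiTensorProduct.tprod k a))) := by
  rcases lt_trichotomy n 1 with hn | rfl | hn
  · obtain rfl : n = 0 := by omega
    rw [brPrimStar_zero, Submodule.mem_bot] at hz
    rw [H.actLin_eq_zero hP hz]
    simp [IsPrimitive]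
  · have := braidGroup_subsingleton (n := 1) le_rfl
    obtain ⟨c, rfl⟩ := monoidAlgebra_eq_smul_one z
    rw [map_smul, map_one, LinearMap.smul_apply, Module.End.one_apply, map_smul, mulMap_tprod]
    simpa using (ha 0).smul c
  · rw [brPrimStar_of_lt hn, mem_brPrim hn] at hz
    refine H.isPrimitive_mulMap hH hn (fun p hp => H.actLin_eq_zero hP ?_) ha
    rw [map_mul, hz p hp]

theorem evaluate_eq {A : Type*} [Ring A] [Algebra k A] (c : Braiding k A)
    (hc : c.FinitelyBraided) (α : BrAssHat k n) (a : Fin n → A)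
    {z : MonoidAlgebra k (BraidGroup n)} (hz : toLevel k (actionKernel c hc n) z = α.1 _) :
    evaluate c hc α a = mulMap k A n (c.actLin n z (PiTensorProduct.tprod k a)) := by
  rw [← c.lift_toLevel (P := actionKernel c hc n) le_rfl, hz]
  rfl

namespace WordAlg

variable {G X : Type*} [Group G] [MulAction G X] {R : AugRack G X} {s : ℕ → X} {L : FinQuot n}

theorem factorsThrough_toWord_seqAct (hL : ∀ β, R.seqAct n β s = s → β ∈ L.toSubgroup) :
    Function.FactorsThrough (fun β => toLevel k L (MonoidAlgebra.of k _ β))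
      (fun β => toWord n (R.seqAct n β s)) := by
  intro β γ h
  dsimp only at h ⊢
  rw [toLevel_of, toLevel_of]
  congr 1
  refine QuotientGroup.eq.2 (hL _ ?_)
  rw [map_mul, map_inv, Equiv.Perm.mul_apply, Equiv.Perm.inv_eq_iff_eq]
  funext i
  obtain hi | hi := lt_or_ge i n
  · exact (toWord_injective h hi).symm
  · rw [R.seqAct_of_le _ _ hi, R.seqAct_of_le _ _ hi]

open Classical in
variable (k R s L) in
/-- The linear map which reads off the component of bidegree `(p, ∗)` of a tensor of words: `v ⊗ w`
with `v` of length `p` and `v w` the word of `β • s` is sent to the class of `β` in `k[B_n / L]`,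
any other pair of words to `0`. -/
noncomputable def readLevel (p : ℕ) : WordAlg k R ⊗[k] WordAlg k R →ₗ[k] BrAssLevel k n L :=
  TensorProduct.lift <| lin fun v => lin fun w =>
    if v.length = p then
      Function.extend (fun β => toWord n (R.seqAct n β s))
        (fun β => toLevel k L (MonoidAlgebra.of k _ β)) 0 (v * w)
    else 0

theorem readLevel_splitMap (hL : ∀ β, R.seqAct n β s = s → β ∈ L.toSubgroup) {p q : ℕ}
    (hq : q ≤ n) (z : MonoidAlgebra k (BraidGroup n)) :
    readLevel k R s L p (splitMap k _ n q ((hopf k R).actLin n z (letterTensor k R n s))) =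
      if q = p then toLevel k L z else 0 := by
  induction z using MonoidAlgebra.induction_on with
  | of β =>
    obtain ⟨v, w, hsplit, hvw, hlen⟩ :=
      exists_splitMap_letterTensor_eq (k := k) (R := R) hq (R.seqAct n β s)
    rw [Braiding.actLin_of, action_letterTensor, hsplit, readLevel, TensorProduct.lift.tmul,
      lin_word, lin_word, hvw, hlen]
    congr 1
    exact (factorsThrough_toWord_seqAct hL).extend_apply _ β
  | add y z hy hz =>
    simp only [map_add, LinearMap.add_apply, hy, hz]
    split_ifs <;> simp
  | smul r z hz =>
    simp only [map_smul, LinearMap.smul_apply, hz]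
    split_ifs <;> simp

/-- The term of index `p` in the coproduct of `z(s₀, …, s_{n-1})` recovers `𝔖_{p,n-p} z` in
`k[B_n / L]`, while `x ⊗ 1` and `1 ⊗ x` are the terms of index `n` and `0`. -/
theorem mem_brPrimStar_of_isPrimitive (hL : ∀ β, R.seqAct n β s = s → β ∈ L.toSubgroup)
    (hH : (hopf k R).FinitelyBraided) {z : MonoidAlgebra k (BraidGroup n)} (hn : 0 < n)
    (hz : IsPrimitive k (mulMap k _ n ((hopf k R).actLin n z (letterTensor k R n s)))) :
    toLevel k L z ∈ brPrimStar k n L := by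
  rcases Nat.eq_or_lt_of_le (show 1 ≤ n from hn) with rfl | hn
  · rw [brPrimStar_one]
    trivial
  rw [brPrimStar_of_lt hn, mem_brPrim hn]
  intro p hp
  have hpn := Finset.mem_Ioo.1 hp
  set t := (hopf k R).actLin n z (letterTensor k R n s)
  have ht : t ∈ BraidedHopfAlgebra.primTensors k _ n :=
    (hopf k R).actLin_mem_primTensors hH z (letterTensor_mem_primTensors s)
  have hterm : ∀ q ∈ Finset.range (n + 1),
      readLevel k R s L p (splitMap k _ n q ((hopf k R).actLin n (shuffleSum k n q) t)) =
        if q = p then toLevel k L (shuffleSum k n p) * toLevel k L z else 0 := by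
    intro q hq
    rw [← Module.End.mul_apply, ← map_mul,
      readLevel_splitMap hL (Finset.mem_range_succ_iff.1 hq)]
    split_ifs with h
    · rw [h, map_mul]
    · rfl
  calc toLevel k L (shuffleSum k n p) * toLevel k L z
      = readLevel k R s L p (Coalgebra.comul (R := k) (mulMap k _ n t)) := by
        rw [(hopf k R).comul_mulMap ht, map_sum, Finset.sum_congr rfl hterm, Finset.sum_ite_eq',
          if_pos (Finset.mem_range.2 (by omega))]
    _ = readLevel k R s L p (splitMap k _ n n t) + readLevel k R s L p (splitMap k _ n 0 t) := by
        rw [hz, splitMap_zero, splitMap_of_le le_rfl, map_add]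
    _ = 0 := by
        rw [readLevel_splitMap hL le_rfl, readLevel_splitMap hL (Nat.zero_le n),
          if_neg (by omega), if_neg (by omega), add_zero]

theorem ker_action_le (hL : ∀ β, R.seqAct n β s = s → β ∈ L.toSubgroup) :
    ((hopf k R).action n).ker ≤ L.toSubgroup := by
  intro β hβ
  have hletters := action_letterTensor (k := k) (R := R) β s
  rw [MonoidHom.mem_ker.1 hβ] at hletters
  have hwords := congrArg (mulMap k _ n) hletters
  rw [LinearEquiv.coe_one, id, mulMap_letterTensor, mulMap_letterTensor] at hwords
  refine hL β (funext fun i => ?_)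
  obtain hi | hi := lt_or_ge i n
  · exact (toWord_injective (word_injective hwords) hi).symm
  · exact R.seqAct_of_le _ _ hi

end WordAlg

open WordAlg in
theorem exists_detecting_wordAlg (k : Type*) [Field k] (n : ℕ) (L : FinQuot n) :
    ∃ (G : Type v) (_ : Group G) (t : ℕ → G) (_ : (hopf k (Strand.rack t)).FinitelyBraided),
      ∀ β, (Strand.rack t).seqAct n β (Strand.base G) = Strand.base G → β ∈ L.toSubgroup := by
  obtain ⟨G, _, t, hfin, -, hdet⟩ := exists_detecting_rack.{v} n
    ((MulEquiv.ulift.symm : _ ≃* ULift.{v} (BraidGroup n ⧸ L.toSubgroup)).toMonoidHom.comp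
      (QuotientGroup.mk' L.toSubgroup))
  have : Finite (BraidGroup n ⧸ L.toSubgroup) := Subgroup.finite_quotient_of_finiteIndex
  have : Finite G := hfin inferInstance
  exact ⟨G, _, t, finitelyBraided, fun β hβ => by simpa using hdet β hβ⟩

theorem eq_zero_of_isPrimitive_smul_one {A : Type*} [Ring A] [Algebra k A] [Coalgebra k A]
    (H : BraidedHopfAlgebra k A) {c : k} (hc : IsPrimitive k (c • (1 : A))) : c = 0 := by
  have h := congrArg (TensorProduct.lid k k ∘ TensorProduct.map (Coalgebra.counit (R := k))
    (Coalgebra.counit (R := k) (A := A))) hc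
  simpa [H.comul_one, H.counit_one, TensorProduct.smul_tmul'] using h

theorem isPrimitive_evaluate {A : Type*} [Ring A] [Algebra k A] [Coalgebra k A]
    (H : BraidedHopfAlgebra k A) (hH : H.FinitelyBraided) {α : BrAssHat k n}
    (hα : α ∈ (brPrimStar k).elements n) {a : Fin n → A} (ha : ∀ i, IsPrimitive k (a i)) :
    IsPrimitive k (evaluate H.toBraiding hH α a) := by
  obtain ⟨z, hz⟩ := toLevel_surjective (k := k) (actionKernel H.toBraiding hH n) (α.1 _)
  rw [evaluate_eq H.toBraiding hH α a hz]
  exact H.isPrimitive_of_mem hH (P := actionKernel H.toBraiding hH n) le_rfl (hz ▸ hα _) ha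

open WordAlg in
theorem apply_mem_brPrimStar_of_isPrimitive_evaluate {G X : Type*} [Group G] [MulAction G X]
    {R : AugRack G X} {s : ℕ → X} {L : FinQuot n}
    (hL : ∀ β, R.seqAct n β s = s → β ∈ L.toSubgroup) (hH : (hopf k R).FinitelyBraided)
    {α : BrAssHat k n}
    (hα : IsPrimitive k (evaluate (hopf k R).toBraiding hH α fun i => word k R (.of (s i)))) :
    α.1 L ∈ brPrimStar k n L := by
  obtain ⟨z, hz⟩ := toLevel_surjective (k := k) (actionKernel (hopf k R).toBraiding hH n) (α.1 _)
  have hzL : toLevel k L z = α.1 L := by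
    rw [← α.2 _ L (show actionKernel (hopf k R).toBraiding hH n ≤ L from ker_action_le hL), ← hz,
      transition_toLevel]
  rw [evaluate_eq _ hH α _ hz] at hα
  rw [← hzL]
  rcases Nat.eq_zero_or_pos n with rfl | hn
  · have := braidGroup_subsingleton (n := 0) (by omega)
    obtain ⟨c, rfl⟩ := monoidAlgebra_eq_smul_one z
    rw [map_smul, map_one, LinearMap.smul_apply, Module.End.one_apply, map_smul,
      mulMap_tprod, List.ofFn_zero, List.prod_nil] at hα
    rw [eq_zero_of_isPrimitive_smul_one (hopf k R) hα, zero_smul, map_zero]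
    exact Submodule.zero_mem _
  · exact mem_brPrimStar_of_isPrimitive hL hH hn hα

end Detection

open WordAlg in
theorem mem_elements_brPrimStar_iff (k : Type u) [Field k] (n : ℕ) (α : BrAssHat k n) :
    α ∈ (brPrimStar k).elements n ↔
      ∀ (A : Type (max u v)) [Ring A] [Algebra k A] [Coalgebra k A]
        (H : BraidedHopfAlgebra k A) (hH : H.FinitelyBraided) (a : Fin n → A),
        (∀ i, IsPrimitive k (a i)) → IsPrimitive k (evaluate H.toBraiding hH α a) := by
  refine ⟨fun hα A _ _ _ H hH a ha => isPrimitive_evaluate H hH hα ha, fun h L => ?_⟩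
  obtain ⟨G, _, t, hH, hL⟩ := exists_detecting_wordAlg.{v} k n L
  exact apply_mem_brPrimStar_of_isPrimitive_evaluate hL hH
    (h _ (hopf k (Strand.rack t)) hH _ fun i => isPrimitive_of _)

/-! ### Cabling of words -/

/-- Replace the `n` entries of a sequence in the positions `i, …, i + n - 1` by their product. -/
def merge {M : Type*} [Monoid M] (n i : ℕ) (w : ℕ → M) : ℕ → M := fun j =>
  if j < i then w j else if j = i then ((List.range n).map fun t => w (i + t)).prod
  else w (j + n - 1)

section merge

variable {M : Type*} [Monoid M] {n i : ℕ}

theorem merge_of_lt (w : ℕ → M) {j : ℕ} (h : j < i) : merge n i w j = w j := if_pos h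

theorem merge_self (w : ℕ → M) : merge n i w i = ((List.range n).map fun t => w (i + t)).prod := by
  simp [merge]

theorem merge_of_gt (w : ℕ → M) {j : ℕ} (h : i < j) : merge n i w j = w (j + n - 1) := by
  rw [merge, if_neg (by omega), if_neg (by omega)]

theorem prod_merge {m : ℕ} (hi : i < m) (w : ℕ → M) :
    ((List.range m).map (merge n i w)).prod = ((List.range (m + n - 1)).map w).prod := by
  obtain ⟨r, rfl⟩ : ∃ r, m = i + (1 + r) := ⟨m - i - 1, by omega⟩
  rw [show i + (1 + r) + n - 1 = i + (n + r) by omega]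
  simp only [List.range_add, List.map_append, List.prod_append, List.map_map, List.range_one,
    List.map_cons, List.map_nil, List.prod_cons, List.prod_nil, mul_one, Function.comp_def,
    add_zero, merge_self]
  congr 2
  · exact List.map_congr_left fun j hj => merge_of_lt w (List.mem_range.1 hj)
  · refine congrArg List.prod (List.map_congr_left fun j _ => ?_)
    rw [merge_of_gt w (by omega)]
    congr 1
    omega

end merge

namespace AugRack

variable {G Y : Type*} [Group G] [MulAction G Y] (R : AugRack G Y)

theorem seqAct_fatLeft {N n j : ℕ} (h : j + n < N) (w : ℕ → Y) (x : ℕ) :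
    R.seqAct N (fatLeft N n j) w x =
      if x = j then ((List.range n).map fun t => R.deg (w (j + t))).prod • w (j + n)
      else if j < x ∧ x ≤ j + n then w (x - 1) else w x := by
  induction n generalizing w x with
  | zero =>
    rw [fatLeft_zero, map_one, Equiv.Perm.one_apply]
    by_cases hx : x = j
    · simp [hx]
    · rw [if_neg hx, if_neg (by omega)]
  | succ n ih =>
    rw [fatLeft_succ, map_mul, Equiv.Perm.mul_apply, ih (by omega), R.seqAct_gen (by omega)]
    by_cases hx : x = j
    · rw [if_pos hx, if_pos hx, cross_left, List.range_succ, List.map_append, List.prod_append,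
        mul_smul]
      congr 1
      · refine congrArg List.prod (List.map_congr_left fun t ht => ?_)
        have ht := List.mem_range.1 ht
        rw [cross_of_ne _ _ (by omega) (by omega)]
      · simp [add_assoc]
    rw [if_neg hx, if_neg hx]
    by_cases hmid : j < x ∧ x ≤ j + n
    · rw [if_pos hmid, if_pos (by omega), cross_of_ne _ _ (by omega) (by omega)]
    rw [if_neg hmid]
    by_cases hlast : x = j + n + 1
    · rw [hlast, cross_right, if_pos (by omega)]
      rfl
    · rw [cross_of_ne _ _ (by omega) (by omega), if_neg (by omega)]

theorem seqAct_fatRight {N n j : ℕ} (h : j + n < N) (w : ℕ → Y) (x : ℕ) :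
    R.seqAct N (fatRight N n j) w x =
      if j ≤ x ∧ x < j + n then R.deg (w j) • w (x + 1) else if x = j + n then w j else w x := by
  induction n generalizing x with
  | zero =>
    rw [fatRight_zero, map_one, Equiv.Perm.one_apply, if_neg (by omega)]
    split_ifs with hx
    · simp [hx]
    · rfl
  | succ n ih =>
    rw [fatRight_succ, map_mul, Equiv.Perm.mul_apply, R.seqAct_gen (by omega), cross_apply,
      ih (by omega), ih (by omega), ih (by omega),
      if_neg (show ¬(j ≤ j + n ∧ j + n < j + n) by omega), if_pos rfl,
      if_neg (show ¬(j ≤ j + n + 1 ∧ j + n + 1 < j + n) by omega),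
      if_neg (show ¬j + n + 1 = j + n by omega)]
    by_cases hend : x = j + n
    · rw [if_pos hend, if_pos (by omega), hend]
    rw [if_neg hend]
    by_cases hnext : x = j + n + 1
    · rw [if_pos hnext, if_neg (by omega), if_pos (by omega)]
    rw [if_neg hnext, if_neg hend]
    by_cases hmid : j ≤ x ∧ x < j + n
    · rw [if_pos hmid, if_pos (by omega)]
    · rw [if_neg hmid, if_neg (by omega), if_neg (by omega)]

theorem seqAct_insertAt {m n : ℕ} (i : Fin m) (ρ : BraidGroup n) (w : ℕ → Y) :
    (fun t => R.seqAct (m + n - 1) (insertAt n i ρ) w (i + t)) =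
      R.seqAct n ρ (fun t => w (i + t)) := by
  have hi := i.2
  induction ρ using braid_induction generalizing w with
  | one => simp
  | of_gen j hj =>
    rw [insertAt, braidLift_gen _ _ _ _ hj, R.seqAct_gen hj, R.seqAct_gen (by omega)]
    funext t
    simp only [cross_apply, add_assoc, Nat.add_left_cancel_iff]
  | mul ρ ρ' hρ hρ' =>
    simp only [map_mul, Equiv.Perm.mul_apply] at *
    rw [hρ, hρ']
  | inv ρ hρ =>
    apply (R.seqAct n ρ).injective
    rw [← hρ, ← Equiv.Perm.mul_apply (R.seqAct n ρ), ← map_mul]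
    simp

theorem seqAct_insertAt_of_lt {m n : ℕ} (i : Fin m) (ρ : BraidGroup n) (w : ℕ → Y) {j : ℕ}
    (hj : j < i) : R.seqAct (m + n - 1) (insertAt n i ρ) w j = w j := by
  have := i.2
  induction ρ using braid_induction generalizing w with
  | one => simp
  | of_gen t ht =>
    rw [insertAt, braidLift_gen _ _ _ _ ht, R.seqAct_gen (by omega),
      cross_of_ne _ _ (by omega) (by omega)]
  | mul ρ ρ' hρ hρ' => rw [map_mul, map_mul, Equiv.Perm.mul_apply, hρ, hρ']
  | inv ρ hρ =>
    rw [← hρ (R.seqAct _ (insertAt n i ρ⁻¹) w), ← Equiv.Perm.mul_apply, ← map_mul, ← map_mul]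
    simp

section merge

variable {M : Type*} [Monoid M] [MulAction G M] (R : AugRack G M) {n i j : ℕ} (w : ℕ → M)

theorem merge_cross_of_lt (h : i < j) :
    merge n i (R.cross (j + n - 1) w) = R.cross j (merge n i w) := by
  funext x
  rcases lt_trichotomy x i with hx | rfl | hx
  · rw [merge_of_lt _ hx, cross_of_ne _ _ (by omega) (by omega),
      cross_of_ne _ _ (by omega) (by omega), merge_of_lt _ hx]
  · rw [merge_self, cross_of_ne _ _ (by omega) (by omega), merge_self]
    refine congrArg List.prod (List.map_congr_left fun t ht => ?_)
    have ht := List.mem_range.1 ht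
    rw [cross_of_ne _ _ (by omega) (by omega)]
  · rw [merge_of_gt _ hx]
    by_cases hj : x = j
    · rw [hj, cross_left, cross_left, merge_of_gt _ h, merge_of_gt _ (by omega)]
      congr 2
      omega
    by_cases hj' : x = j + 1
    · rw [hj', show j + 1 + n - 1 = j + n - 1 + 1 by omega, cross_right, cross_right,
        merge_of_gt _ h]
    · rw [cross_of_ne _ _ (by omega) (by omega), cross_of_ne _ _ hj hj', merge_of_gt _ hx]

theorem merge_cross_of_gt (h : j + 1 < i) :
    merge n i (R.cross j w) = R.cross j (merge n i w) := by
  funext x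
  rw [cross_apply, merge_of_lt w (show j < i by omega), merge_of_lt w h]
  rcases lt_trichotomy x i with hx | rfl | hx
  · rw [merge_of_lt _ hx, merge_of_lt _ hx, cross_apply]
  · rw [merge_self, if_neg (by omega), if_neg (by omega), merge_self]
    refine congrArg List.prod (List.map_congr_left fun t _ => ?_)
    rw [cross_of_ne _ _ (by omega) (by omega)]
  · rw [merge_of_gt _ hx, merge_of_gt _ hx, if_neg (by omega), if_neg (by omega),
      cross_of_ne _ _ (by omega) (by omega)]

end merge

section words

variable {X : Type*} [MulAction G X] (R : AugRack G X)

theorem words_deg_list_prod (l : List (FreeMonoid X)) :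
    R.words.deg l.prod = (l.map R.words.deg).prod := map_list_prod R.degHom l

theorem smul_list_prod (g : G) (l : List (FreeMonoid X)) :
    g • l.prod = (l.map fun w => g • w).prod :=
  map_list_prod (MulDistribMulAction.toMonoidHom (FreeMonoid X) g) l

theorem merge_seqAct_fatLeft {N n i : ℕ} (h : i + n < N) (w : ℕ → FreeMonoid X) :
    merge n (i + 1) (R.words.seqAct N (fatLeft N n i) w) = R.words.cross i (merge n i w) := by
  funext x
  rw [cross_apply, merge_self, merge_of_gt w (show i < i + 1 by omega)]
  rcases lt_trichotomy x (i + 1) with hx | rfl | hx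
  · rw [merge_of_lt _ hx, seqAct_fatLeft _ h]
    by_cases hxi : x = i
    · rw [if_pos hxi, if_pos hxi, words_deg_list_prod, List.map_map]
      congr 2
      omega
    · rw [if_neg hxi, if_neg hxi, if_neg (by omega), if_neg (by omega), merge_of_lt _ (by omega)]
  · rw [if_neg (by omega), if_pos rfl, merge_self]
    refine congrArg List.prod (List.map_congr_left fun t ht => ?_)
    have ht := List.mem_range.1 ht
    rw [seqAct_fatLeft _ h, if_neg (by omega), if_pos (by omega)]
    congr 1
    omega
  · rw [merge_of_gt _ hx, if_neg (by omega), if_neg (by omega), merge_of_gt _ (by omega),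
      seqAct_fatLeft _ h, if_neg (by omega), if_neg (by omega)]

theorem merge_seqAct_fatRight {N n j : ℕ} (h : j + n < N) (w : ℕ → FreeMonoid X) :
    merge n j (R.words.seqAct N (fatRight N n j) w) = R.words.cross j (merge n (j + 1) w) := by
  funext x
  rw [cross_apply, merge_self, merge_of_lt w (show j < j + 1 by omega)]
  rcases lt_trichotomy x j with hx | rfl | hx
  · rw [merge_of_lt _ hx, if_neg (by omega), if_neg (by omega), merge_of_lt _ (by omega),
      seqAct_fatRight _ h, if_neg (by omega), if_neg (by omega)]
  · rw [merge_self, if_pos rfl, smul_list_prod, List.map_map]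
    refine congrArg List.prod (List.map_congr_left fun t ht => ?_)
    have ht := List.mem_range.1 ht
    rw [seqAct_fatRight _ h, if_pos (by omega), Function.comp_apply]
    congr 2
    omega
  · rw [merge_of_gt _ hx, if_neg (by omega), seqAct_fatRight _ h, if_neg (by omega)]
    by_cases hxj : x = j + 1
    · rw [if_pos (by omega), if_pos hxj]
    · rw [if_neg (by omega), if_neg hxj, merge_of_gt _ (by omega)]

theorem merge_seqAct_block {m n j : ℕ} (hj : j + 1 < m) (i : Fin m) (w : ℕ → FreeMonoid X) :
    merge n (adj m j i : Fin m) (R.words.seqAct (m + n - 1) (block (m + n - 1) n j i) w) =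
      R.words.cross j (merge n i w) := by
  have hi := i.2
  rw [adj_val hj, block]
  generalize (i : ℕ) = i at *
  split_ifs with hij hij' hlt
  · rw [hij]
    exact R.merge_seqAct_fatLeft (by omega) w
  · rw [hij']
    exact R.merge_seqAct_fatRight (by omega) w
  · rw [R.words.seqAct_gen (by omega)]
    exact R.words.merge_cross_of_lt w hlt
  · rw [R.words.seqAct_gen (by omega)]
    exact R.words.merge_cross_of_gt w (by omega)


theorem fatten_one {m n : ℕ} (i : Fin m) : fatten n i 1 = 1 := by
  simp [fatten]

theorem merge_seqAct_fatten {m n : ℕ} (i : Fin m) (γ : BraidGroup m) (w : ℕ → FreeMonoid X) :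
    merge n (toPerm m γ i : Fin m) (R.words.seqAct (m + n - 1) (fatten n i γ) w) =
      R.words.seqAct m γ (merge n i w) := by
  induction γ using braid_induction generalizing i w with
  | one => simp [fatten_one]
  | of_gen j hj =>
    rw [fatten_gen hj, toPerm_gen hj, R.words.seqAct_gen hj, R.merge_seqAct_block hj]
  | mul γ γ' hγ hγ' =>
    rw [fatten_mul, map_mul, map_mul, map_mul, Equiv.Perm.mul_apply, Equiv.Perm.mul_apply,
      Equiv.Perm.mul_apply, hγ, hγ']
  | inv γ hγ =>
    apply (R.words.seqAct m γ).injective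
    rw [← hγ, ← Equiv.Perm.mul_apply, ← map_mul, ← Equiv.Perm.mul_apply, ← map_mul, ← fatten_mul,
      ← Equiv.Perm.mul_apply, ← map_mul]
    simp [fatten_one]

theorem prod_seqAct_cabling {m n : ℕ} (i : Fin m) (γ : BraidGroup m) (ρ : BraidGroup n)
    (w : ℕ → FreeMonoid X) :
    ((List.range (m + n - 1)).map (R.words.seqAct (m + n - 1) (cabling i γ ρ) w)).prod =
      ((List.range m).map (R.words.seqAct m γ (Function.update (merge n i w) i
        ((List.range n).map (R.words.seqAct n ρ fun t => w (i + t))).prod))).prod := by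
  rw [cabling, map_mul, Equiv.Perm.mul_apply, ← prod_merge (toPerm m γ i).2,
    R.merge_seqAct_fatten]
  congr 3
  funext x
  rcases lt_trichotomy x i with hx | rfl | hx
  · rw [merge_of_lt _ hx, seqAct_insertAt_of_lt _ _ _ _ hx, Function.update_of_ne (by omega),
      merge_of_lt _ hx]
  · rw [merge_self, Function.update_self, ← seqAct_insertAt]
  · rw [merge_of_gt _ hx, Function.update_of_ne (by omega), merge_of_gt _ hx]
    by_cases hn : n = 0
    · subst hn
      have hsub := braidGroup_subsingleton (n := 0) (by omega)
      rw [Subsingleton.elim ρ 1]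
      simp
    have hact := congrFun (R.words.seqAct_insertAt i ρ w) (x + n - 1 - i)
    rw [R.words.seqAct_of_le ρ _ (by omega)] at hact
    rw [show x + n - 1 = i + (x + n - 1 - i) by omega]
    exact hact

end words

end AugRack

section Cabling

variable {k : Type*} [Field k] {m n : ℕ}

namespace WordAlg

variable {G X : Type*} [Group G] [MulAction G X] {R : AugRack G X}

theorem mulMap_wordTensor (w : ℕ → FreeMonoid X) :
    mulMap k (WordAlg k R) n (wordTensor k R n w) = word k R ((List.range n).map w).prod := by
  rw [wordTensor, mulMap_tprod, map_list_prod, List.map_map, ← List.map_coe_finRange_eq_range,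
    List.map_map, List.ofFn_eq_map]
  rfl

theorem mulMap_cabling (i : Fin m) (γ : BraidGroup m) (ρ : BraidGroup n) (s : ℕ → X) :
    mulMap k _ (m + n - 1) ((hopf k R).action (m + n - 1) (cabling i γ ρ)
        (letterTensor k R (m + n - 1) s)) =
      mulMap k _ m ((hopf k R).action m γ (PiTensorProduct.tprod k (Function.update
        (fun j : Fin m => word k R (merge n i (FreeMonoid.of ∘ s) j)) i
        (mulMap k _ n ((hopf k R).action n ρ (letterTensor k R n fun t => s (i + t))))))) := by
  have hletters : letterTensor k R n (fun t => s (i + t)) =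
      wordTensor k R n fun t => (FreeMonoid.of ∘ s) (i + t) := rfl
  rw [hletters, letterTensor, action_wordTensor, action_wordTensor, mulMap_wordTensor,
    mulMap_wordTensor, R.prod_seqAct_cabling, ← mulMap_wordTensor, ← action_wordTensor, wordTensor]
  congr 3
  funext j
  rw [Function.update_apply, Function.update_apply]
  by_cases hj : j = i
  · rw [if_pos hj, if_pos (congrArg _ hj)]
  · rw [if_neg hj, if_neg fun h => hj (Fin.ext h)]

end WordAlg

section comp

variable {i : Fin m} {P : FinQuot m} {Q : FinQuot n} {L : FinQuot (m + n - 1)}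
  (h : CablingDescends i P Q L)

theorem comp_add_left (x x' : BrAssLevel k m P) (y : BrAssLevel k n Q) :
    comp i h (x + x') y = comp i h x y + comp i h x' y := by
  classical
  simp only [comp, MonoidAlgebra.coeff_add]
  rw [Finsupp.sum_add_index']
  · simp
  · simp [add_mul, Finsupp.sum_add]

theorem comp_smul_left (c : k) (x : BrAssLevel k m P) (y : BrAssLevel k n Q) :
    comp i h (c • x) y = c • comp i h x y := by
  simp only [comp, MonoidAlgebra.coeff_smul]
  rw [Finsupp.sum_smul_index' (by simp), Finsupp.smul_sum]
  simp only [Finsupp.smul_sum, MonoidAlgebra.smul_single, smul_eq_mul, mul_assoc]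

theorem comp_add_right (x : BrAssLevel k m P) (y y' : BrAssLevel k n Q) :
    comp i h x (y + y') = comp i h x y + comp i h x y' := by
  classical
  simp only [comp, MonoidAlgebra.coeff_add]
  rw [← Finsupp.sum_add]
  congr 1
  funext g a
  rw [Finsupp.sum_add_index']
  · simp
  · simp [mul_add]

theorem comp_smul_right (c : k) (x : BrAssLevel k m P) (y : BrAssLevel k n Q) :
    comp i h x (c • y) = c • comp i h x y := by
  simp only [comp, MonoidAlgebra.coeff_smul]
  rw [Finsupp.smul_sum]
  congr 1
  funext g a
  rw [Finsupp.sum_smul_index' (by simp), Finsupp.smul_sum]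
  simp only [MonoidAlgebra.smul_single, smul_eq_mul, mul_left_comm]

theorem comp_of (γ : BraidGroup m) (ρ : BraidGroup n) :
    comp i h (toLevel k P (MonoidAlgebra.of k _ γ)) (toLevel k Q (MonoidAlgebra.of k _ ρ)) =
      toLevel k L (MonoidAlgebra.of k _ (cabling i γ ρ)) := by
  rw [toLevel_of, toLevel_of, toLevel_of]
  simp only [comp, MonoidAlgebra.of_apply, MonoidAlgebra.coeff_single]
  rw [Finsupp.sum_single_index (by simp), Finsupp.sum_single_index (by simp), mul_one]
  rfl

variable (k i) in
/-- The composition `∘_i` of elements of the group algebras of the braid groups. -/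
noncomputable def cablingMap : MonoidAlgebra k (BraidGroup m) →ₗ[k]
    MonoidAlgebra k (BraidGroup n) →ₗ[k] MonoidAlgebra k (BraidGroup (m + n - 1)) :=
  (MonoidAlgebra.basis _ k).constr k fun γ => (MonoidAlgebra.basis _ k).constr k fun ρ =>
    MonoidAlgebra.of k _ (cabling i γ ρ)

theorem cablingMap_of_of (γ : BraidGroup m) (ρ : BraidGroup n) :
    cablingMap k i (MonoidAlgebra.of k _ γ) (MonoidAlgebra.of k _ ρ) =
      MonoidAlgebra.of k _ (cabling i γ ρ) := by
  simp only [cablingMap, MonoidAlgebra.of_apply, ← MonoidAlgebra.basis_apply,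
    Module.Basis.constr_basis]

theorem comp_toLevel (x : MonoidAlgebra k (BraidGroup m)) (y : MonoidAlgebra k (BraidGroup n)) :
    comp i h (toLevel k P x) (toLevel k Q y) = toLevel k L (cablingMap k i x y) := by
  induction x using MonoidAlgebra.induction_on with
  | of γ =>
    induction y using MonoidAlgebra.induction_on with
    | of ρ => rw [comp_of, cablingMap_of_of]
    | add y y' hy hy' => rw [map_add, comp_add_right, hy, hy', map_add, map_add]
    | smul r y hy => rw [map_smul, comp_smul_right, hy, map_smul, map_smul]
  | add x x' hx hx' => rw [map_add, comp_add_left, hx, hx', map_add, LinearMap.add_apply, map_add]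
  | smul r x hx => rw [map_smul, comp_smul_left, hx, map_smul, LinearMap.smul_apply, map_smul]

end comp

open WordAlg in
theorem mulMap_cablingMap {G X : Type*} [Group G] [MulAction G X] (R : AugRack G X) (s : ℕ → X)
    (i : Fin m) (x : MonoidAlgebra k (BraidGroup m)) (y : MonoidAlgebra k (BraidGroup n)) :
    mulMap k _ (m + n - 1) ((hopf k R).actLin (m + n - 1) (cablingMap k i x y)
        (letterTensor k R (m + n - 1) s)) =
      mulMap k _ m ((hopf k R).actLin m x (PiTensorProduct.tprod k (Function.update
        (fun j : Fin m => word k R (merge n i (FreeMonoid.of ∘ s) j)) i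
        (mulMap k _ n ((hopf k R).actLin n y (letterTensor k R n fun t => s (i + t))))))) := by
  induction x using MonoidAlgebra.induction_on with
  | of γ =>
    induction y using MonoidAlgebra.induction_on with
    | of ρ =>
      rw [cablingMap_of_of]
      simp only [Braiding.actLin_of]
      exact mulMap_cabling i γ ρ s
    | add y y' hy hy' =>
      simp only [map_add, LinearMap.add_apply, MultilinearMap.map_update_add, hy, hy']
    | smul r y hy =>
      simp only [map_smul, LinearMap.smul_apply, MultilinearMap.map_update_smul, hy]
  | add x x' hx hx' => simp only [map_add, LinearMap.add_apply, hx, hx']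
  | smul r x hx => simp only [map_smul, LinearMap.smul_apply, hx]

theorem CablingDescends.mono {i : Fin m} {P P' : FinQuot m} {Q Q' : FinQuot n}
    {L : FinQuot (m + n - 1)} (h : CablingDescends i P Q L) (hP : P' ≤ P) (hQ : Q' ≤ Q) :
    CablingDescends i P' Q' L :=
  fun γ γ' ρ ρ' hγ hρ => h γ γ' ρ ρ' (hP hγ) (hQ hρ)

open WordAlg in
theorem comp_mem_brPrimStar {G X : Type*} [Group G] [MulAction G X] {R : AugRack G X} {s : ℕ → X}
    {i : Fin m} {P : FinQuot m} {Q : FinQuot n} {L : FinQuot (m + n - 1)}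
    (hL : ∀ β, R.seqAct (m + n - 1) β s = s → β ∈ L.toSubgroup) (hH : (hopf k R).FinitelyBraided)
    (hn : 0 < n) (h : CablingDescends i P Q L) (hP : P.toSubgroup ≤ ((hopf k R).action m).ker)
    (hQ : Q.toSubgroup ≤ ((hopf k R).action n).ker) {x : BrAssLevel k m P}
    (hx : x ∈ brPrimStar k m P) {y : BrAssLevel k n Q} (hy : y ∈ brPrimStar k n Q) :
    comp i h x y ∈ brPrimStar k (m + n - 1) L := by
  have hi := i.2
  obtain ⟨x, rfl⟩ := toLevel_surjective P x
  obtain ⟨y, rfl⟩ := toLevel_surjective Q y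
  rw [comp_toLevel]
  refine mem_brPrimStar_of_isPrimitive hL hH (by omega) ?_
  rw [mulMap_cablingMap]
  refine (hopf k R).isPrimitive_of_mem hH hP hx fun j => ?_
  rw [Function.update_apply]
  split_ifs with hj
  · exact (hopf k R).isPrimitive_of_mem hH hQ hy fun _ => isPrimitive_of _
  · rcases lt_or_gt_of_ne (Fin.val_ne_of_ne hj) with hji | hji
    · rw [merge_of_lt _ hji]
      exact isPrimitive_of _
    · rw [merge_of_gt _ hji]
      exact isPrimitive_of _

theorem exists_comp_mem_brPrimStar (i : Fin m) (L : FinQuot (m + n - 1)) :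
    ∃ (P₀ : FinQuot m) (Q₀ : FinQuot n), ∀ P ≤ P₀, ∀ Q ≤ Q₀, ∃ h : CablingDescends i P Q L,
      ∀ x ∈ brPrimStar k m P, ∀ y ∈ brPrimStar k n Q,
        comp i h x y ∈ brPrimStar k (m + n - 1) L := by
  obtain ⟨P₁, Q₁, hdesc⟩ := exists_cablingDescends i L
  rcases Nat.eq_zero_or_pos n with rfl | hn
  · refine ⟨P₁, Q₁, fun P hP Q hQ => ⟨hdesc.mono hP hQ, fun x _ y hy => ?_⟩⟩
    rw [brPrimStar_zero, Submodule.mem_bot] at hy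
    have hzero := comp_smul_right (hdesc.mono hP hQ) 0 x y
    rw [zero_smul, zero_smul] at hzero
    rw [hy, hzero]
    exact Submodule.zero_mem _
  · obtain ⟨G, _, t, hH, hL⟩ := exists_detecting_wordAlg.{0} k (m + n - 1) L
    exact ⟨P₁ ⊓ actionKernel _ hH m, Q₁ ⊓ actionKernel _ hH n, fun P hP Q hQ =>
      ⟨hdesc.mono (hP.trans inf_le_left) (hQ.trans inf_le_left), fun x hx y hy =>
        comp_mem_brPrimStar hL hH hn _ (hP.trans inf_le_right) (hQ.trans inf_le_right) hx hy⟩⟩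

end Cabling

/-! ### Averaging over the kernel of a homomorphism -/

section KerAverage

variable {k Q Q' : Type*} [Field k] [Group Q] [Monoid Q'] (f : Q →* Q') [Fintype f.ker]

variable (k) in
/-- The average of the elements of a finite kernel, an element of the group algebra which is
invariant under the kernel and used to split the surjection of group algebras induced by `f`. -/
noncomputable def kerAverage : MonoidAlgebra k Q :=
  (Fintype.card f.ker : k)⁻¹ • ∑ g : f.ker, MonoidAlgebra.of k Q g

theorem of_mul_kerAverage {g : Q} (hg : g ∈ f.ker) :
    MonoidAlgebra.of k Q g * kerAverage k f = kerAverage k f := by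
  simp only [kerAverage, mul_smul_comm, Finset.mul_sum, ← map_mul]
  congr 1
  exact Fintype.sum_equiv (Equiv.mulLeft (⟨g, hg⟩ : f.ker)) _ _ fun _ => rfl

theorem mapDomainAlgHom_kerAverage (hcard : (Fintype.card f.ker : k) ≠ 0) :
    MonoidAlgebra.mapDomainAlgHom k k f (kerAverage k f) = 1 := by
  have hker : ∀ g : f.ker, MonoidAlgebra.mapDomainAlgHom k k f (MonoidAlgebra.of k Q g) = 1 :=
    fun g => by
      rw [MonoidAlgebra.of_apply, MonoidAlgebra.mapDomainAlgHom_apply,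
        MonoidAlgebra.mapDomain_single, MonoidHom.mem_ker.1 g.2, MonoidAlgebra.one_def]
  rw [kerAverage, map_smul, map_sum, Finset.sum_congr rfl fun g _ => hker g, Finset.sum_const,
    Finset.card_univ, ← Nat.cast_smul_eq_nsmul k, inv_smul_smul₀ hcard]

/-- Since `of g * kerAverage k f` depends only on `f g`, right multiplication by the average factors
through the map induced by `f`. -/
theorem mul_kerAverage_eq_zero {u : MonoidAlgebra k Q}
    (hu : MonoidAlgebra.mapDomainAlgHom k k f u = 0) : u * kerAverage k f = 0 := by
  have hfactors : (fun g => MonoidAlgebra.of k Q g * kerAverage k f).FactorsThrough f :=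
    fun g g' h => by
      dsimp only
      rw [← mul_inv_cancel_left g g', map_mul, mul_assoc,
        of_mul_kerAverage f (f.eq_iff.1 h.symm)]
  let S : MonoidAlgebra k Q' →ₗ[k] MonoidAlgebra k Q :=
    (MonoidAlgebra.basis Q' k).constr k
      (Function.extend f (fun g => MonoidAlgebra.of k Q g * kerAverage k f) 0)
  have hS : ∀ v, S (MonoidAlgebra.mapDomainAlgHom k k f v) = v * kerAverage k f := by
    intro v
    induction v using MonoidAlgebra.induction_on with
    | of g =>
      rw [MonoidAlgebra.of_apply, MonoidAlgebra.mapDomainAlgHom_apply,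
        MonoidAlgebra.mapDomain_single, ← MonoidAlgebra.basis_apply, Module.Basis.constr_basis,
        hfactors.extend_apply, MonoidAlgebra.of_apply]
    | add x y hx hy => simp only [map_add, hx, hy, add_mul]
    | smul c x hx => simp only [map_smul, hx, smul_mul_assoc]
  rw [← hS, hu, map_zero]

end KerAverage

/-! ### Transition maps -/

section Strict

variable {k : Type*} [Field k] {n : ℕ}

theorem transition_mem_brPrimStar {N N' : FinQuot n} (h : N ≤ N') {x : BrAssLevel k n N}
    (hx : x ∈ brPrimStar k n N) : transition k h x ∈ brPrimStar k n N' := by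
  rcases lt_trichotomy n 1 with hn | rfl | hn
  · obtain rfl : n = 0 := by omega
    rw [brPrimStar_zero, Submodule.mem_bot] at hx ⊢
    rw [hx, map_zero]
  · rw [brPrimStar_one]
    exact Submodule.mem_top
  · rw [brPrimStar_of_lt hn, mem_brPrim hn] at hx ⊢
    intro p hp
    rw [← transition_toLevel h, ← map_mul, hx p hp, map_zero]

theorem mul_mem_brPrimStar {N : FinQuot n} {x : BrAssLevel k n N} (hx : x ∈ brPrimStar k n N)
    (y : BrAssLevel k n N) : x * y ∈ brPrimStar k n N := by
  rcases lt_trichotomy n 1 with hn | rfl | hn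
  · obtain rfl : n = 0 := by omega
    rw [brPrimStar_zero, Submodule.mem_bot] at hx ⊢
    rw [hx, zero_mul]
  · rw [brPrimStar_one]
    exact Submodule.mem_top
  · rw [brPrimStar_of_lt hn, mem_brPrim hn] at hx ⊢
    intro p hp
    rw [← mul_assoc, hx p hp, zero_mul]

theorem exists_brPrimStar_transition_eq [CharZero k] {N N' : FinQuot n} (h : N ≤ N')
    {x : BrAssLevel k n N'} (hx : x ∈ brPrimStar k n N') :
    ∃ y ∈ brPrimStar k n N, transition k h y = x := by
  obtain ⟨z, rfl⟩ := toLevel_surjective N' x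
  rcases lt_trichotomy n 1 with hn | rfl | hn
  · obtain rfl : n = 0 := by omega
    rw [brPrimStar_zero, Submodule.mem_bot] at hx
    exact ⟨0, Submodule.zero_mem _, by rw [hx, map_zero]⟩
  · exact ⟨toLevel k N z, by rw [brPrimStar_one]; exact Submodule.mem_top, transition_toLevel h z⟩
  · let f := QuotientGroup.map N.toSubgroup N'.toSubgroup (MonoidHom.id _) h
    have : Finite (BraidGroup n ⧸ N.toSubgroup) := Subgroup.finite_quotient_of_finiteIndex
    have := Fintype.ofFinite f.ker
    refine ⟨toLevel k N z * kerAverage k f, ?_, ?_⟩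
    · rw [brPrimStar_of_lt hn, mem_brPrim hn] at hx ⊢
      intro p hp
      rw [← mul_assoc, ← map_mul]
      refine mul_kerAverage_eq_zero f ?_
      change transition k h _ = 0
      rw [transition_toLevel, map_mul, hx p hp]
    · have haverage : transition k h (kerAverage k f) = 1 :=
        mapDomainAlgHom_kerAverage f (Nat.cast_ne_zero.2 Fintype.card_ne_zero)
      rw [map_mul, haverage, mul_one, transition_toLevel]

theorem map_transition_brPrimStar [CharZero k] {N N' : FinQuot n} (h : N ≤ N') :
    (brPrimStar k n N).map (transition k h).toLinearMap = brPrimStar k n N' :=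
  le_antisymm (Submodule.map_le_iff_le_comap.2 fun _ hx => transition_mem_brPrimStar h hx)
    fun _ hx => exists_brPrimStar_transition_eq h hx

end Strict

end BraidedPrimitive

theorem mainTheorem7 (k : Type u) [Field k] [CharZero k] :
    (∀ (n : ℕ) (α : BrAssHat k n),
      α ∈ (brPrimStar k).elements n ↔
        ∀ (A : Type (max u v)) [Ring A] [Algebra k A] [Coalgebra k A]
          (H : BraidedHopfAlgebra k A) (hH : H.FinitelyBraided) (a : Fin n → A),
          (∀ i, IsPrimitive k (a i)) → IsPrimitive k (evaluate H.toBraiding hH α a)) ∧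
    IsSuboperad (brPrimStar k) ∧ IsReducedSeq (brPrimStar k) ∧ IsUnitalSeq (brPrimStar k) ∧
      IsStrictSeq (brPrimStar k) :=
  ⟨mem_elements_brPrimStar_iff.{u, v} k,
    ⟨fun _ _ _ h _ => transition_mem_brPrimStar h, fun _ _ _ _ hx => mul_mem_brPrimStar hx _,
      fun _ _ => exists_comp_mem_brPrimStar⟩,
    brPrimStar_zero, fun N => by rw [brPrimStar_one]; trivial,
    fun _ _ _ => map_transition_brPrimStar⟩
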